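/- Let $\Delta=-\frac{d^2}{dx^2}-\frac1{4x^2}$ act on $C_0^\infty(0,\infty)\subset L^2(0,\infty)$, let $\Delta_{\min}$ be its graph closure and $\Delta_{\max}=(\Delta_{\min})^*$. Every $f$ in the domain of $\Delta_{\max}$ can be written $f(x)=c_+(f)\sqrt x+c_-(f)\sqrt x\log x+\widetilde f(x)$ with unique $c_\pm(f)\in\mathbb C$ and $\widetilde f\in C^1(0,\infty)$, $\widetilde f(x)=O(x^{3/2}\log x)$, $\widetilde f'(x)=O(x^{1/2}\log x)$ as $x\to0+$. For $\theta\in[0,\pi)$ let $\Delta(\theta)$ be the restriction of $\Delta_{\max}$ to $\{f:\cos\theta\,c_+(f)+\sin\theta\,c_-(f)=0\}$. For $x,y,t>0$ put $$E_+(x,y,t)=\frac{\sqrt{xy}}{2t}\,I_0\!\Big(\frac{xy}{2t}\Big)e^{-(x^2+y^2)/(4t)},\qquad N'E_+(x,t)=\frac{\sqrt x}{2t}\,e^{-x^2/(4t)},$$ where $I_0(z)=\sum_{k\ge0}(z/2)^{2k}/(k!)^2$; and for $\theta\ne\pi/2$ put $\kappa_\theta=\gamma-\log2+\tan\theta$,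 with $\gamma$ the Euler–Mascheroni constant. **Theorem.** One has $N'E_+(x,t)=\lim_{y\to0+}y^{-1/2}E_+(x,y,t)$ for all $x,t>0$. Let $\theta\in[0,\pi)$. If $\theta\neq\pi/2$, the function $(\log\sqrt\zeta+\kappa_\theta)^{-1}$ (principal branches) is analytic on $\operatorname{Re}\zeta>e^{-2\kappa_\theta}$ and has an inverse Laplace transform there: for all $t>0$ the limit $$K_\theta(t)=\lim_{R\to\infty}\frac1{2\pi i}\int_{\delta-iR}^{\delta+iR}\frac{e^{t\zeta}}{\log\sqrt\zeta+\kappa_\theta}\,d\zeta$$ exists for every $\delta>e^{-2\kappa_\theta}$ and does not depend on $\delta$. If $\theta=\pi/2$ put $K_\theta=0$. Then $K_\theta$ is integrable on $(0,b)$ for every $b>0$, and the heat kernel of $\Delta(\theta)$ is $$E_\theta=E_++N'E_+*_tK_\theta*_tN'E_+,$$ that is, $$E_\theta(x,y,t)=E_+(x,y,t)+\int_0^t N'E_+(x,t-s)\int_0^s K_\theta(s-r)\,N'E_+(y,r)\,dr\,ds .$$ Here "heat kernel" means: $-\Delta(\theta)$ generates a strongly continuous semigroup $(e^{-t\Delta(\theta)})_{t\ge0}$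 on $L^2(0,\infty)$, and for every $t>0$ the function $E_\theta(\cdot,\cdot,t)$ is measurable and, for every $\varphi\in L^2(0,\infty)$ and almost every $x>0$, $y\mapsto E_\theta(x,y,t)\varphi(y)$ is integrable on $(0,\infty)$ and $(e^{-t\Delta(\theta)}\varphi)(x)=\int_0^\infty E_\theta(x,y,t)\varphi(y)\,dy$. -/

import Mathlib

open MeasureTheory Filter Topology Set
open scoped ContDiff

noncomputable section

namespace RegSing

/-! ### The Hilbert space and the minimal and maximal operators -/

/-- Lebesgue measure on the half-line `(0, ∞)`. -/
abbrev halfLine : Measure ℝ := volume.restrict (Ioi (0 : ℝ))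

/-- The complex Hilbert space `L²(0, ∞)`. -/
abbrev L2 : Type := Lp ℂ 2 halfLine

/-- Smooth complex functions with compact support in `(0, ∞)` (extended by zero to the real line). -/
def IsTestFunction (φ : ℝ → ℂ) : Prop :=
  ContDiff ℝ ∞ φ ∧ HasCompactSupport φ ∧ tsupport φ ⊆ Ioi 0

/-- The differential expression `-φ'' - φ / (4 x²)`. -/
def diffExpr (φ : ℝ → ℂ) (x : ℝ) : ℂ :=
  -deriv (deriv φ) x - φ x / (4 * (x : ℂ) ^ 2)

theorem IsTestFunction.add {φ ψ : ℝ → ℂ} (hφ : IsTestFunction φ) (hψ : IsTestFunction ψ) :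
    IsTestFunction (φ + ψ) :=
  ⟨hφ.1.add hψ.1, hφ.2.1.add hψ.2.1,
    (tsupport_add φ ψ).trans (union_subset hφ.2.2 hψ.2.2)⟩

theorem IsTestFunction.const_smul {φ : ℝ → ℂ} (hφ : IsTestFunction φ) (c : ℂ) :
    IsTestFunction (c • φ) := by
  refine ⟨contDiff_const.smul hφ.1, hφ.2.1.smul_left (f := fun _ => c), ?_⟩
  exact (closure_mono (Function.support_const_smul_subset c φ)).trans hφ.2.2

theorem IsTestFunction.differentiable {φ : ℝ → ℂ} (hφ : IsTestFunction φ) :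
    Differentiable ℝ φ :=
  hφ.1.differentiable (by simp)

theorem IsTestFunction.differentiable_deriv {φ : ℝ → ℂ} (hφ : IsTestFunction φ) :
    Differentiable ℝ (deriv φ) :=
  ((contDiff_infty_iff_deriv.1 hφ.1).2).differentiable (by simp)

theorem diffExpr_add {φ ψ : ℝ → ℂ} (hφ : IsTestFunction φ) (hψ : IsTestFunction ψ) :
    diffExpr (φ + ψ) = diffExpr φ + diffExpr ψ := by
  have h1 : deriv (φ + ψ) = deriv φ + deriv ψ := by
    funext x; exact deriv_add (hφ.differentiable x) (hψ.differentiable x)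
  funext x
  have h2 : deriv (deriv φ + deriv ψ) x = deriv (deriv φ) x + deriv (deriv ψ) x :=
    deriv_add (hφ.differentiable_deriv x) (hψ.differentiable_deriv x)
  simp only [diffExpr, Pi.add_apply, h1, h2]
  ring

theorem diffExpr_const_smul (φ : ℝ → ℂ) (c : ℂ) : diffExpr (c • φ) = c • diffExpr φ := by
  have h1 : deriv (c • φ) = c • deriv φ := by
    funext x; exact deriv_const_smul_field c φ
  funext x
  have h2 : deriv (c • deriv φ) x = c • deriv (deriv φ) x := deriv_const_smul_field c _
  simp only [diffExpr, Pi.smul_apply, h1, h2, smul_eq_mul]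
  ring

/-- The graph `{(φ, -φ'' - φ / (4 x²))}`, `φ` a test function, as a subspace of `L² × L²`. -/
def testGraph : Submodule ℂ (L2 × L2) where
  carrier := {p | ∃ φ : ℝ → ℂ, IsTestFunction φ ∧
    (p.1 : ℝ → ℂ) =ᵐ[halfLine] φ ∧ (p.2 : ℝ → ℂ) =ᵐ[halfLine] diffExpr φ}
  zero_mem' := by
    refine ⟨0, ⟨contDiff_const, HasCompactSupport.zero, ?_⟩, Lp.coeFn_zero _ _ _, ?_⟩
    · simp [tsupport]
    · refine (Lp.coeFn_zero _ _ _).trans (Eventually.of_forall fun x => ?_)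
      have : deriv (0 : ℝ → ℂ) = 0 := by funext y; exact deriv_const y 0
      simp [diffExpr, this]
  add_mem' := by
    rintro p q ⟨φ, hφ, h1, h2⟩ ⟨ψ, hψ, h3, h4⟩
    refine ⟨φ + ψ, hφ.add hψ, (Lp.coeFn_add _ _).trans (h1.add h3), ?_⟩
    rw [diffExpr_add hφ hψ]
    exact (Lp.coeFn_add _ _).trans (h2.add h4)
  smul_mem' := by
    rintro c p ⟨φ, hφ, h1, h2⟩
    refine ⟨c • φ, hφ.const_smul c, (Lp.coeFn_smul _ _).trans (h1.const_smul c), ?_⟩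
    rw [diffExpr_const_smul]
    exact (Lp.coeFn_smul _ _).trans (h2.const_smul c)

/-- The operator `Δ = -d²/dx² - 1/(4x²)` in `L²(0, ∞)` with domain `C₀^∞(0, ∞)`. -/
def delta0 : L2 →ₗ.[ℂ] L2 := testGraph.toLinearPMap

/-- `testGraph` is single-valued, so it is indeed the graph of `delta0`. -/
theorem graph_delta0 : delta0.graph = testGraph := by
  refine Submodule.toLinearPMap_graph_eq _ ?_
  rintro ⟨f, g⟩ ⟨φ, hφ, h1, h2⟩ hf
  simp only at hf h1 h2 ⊢
  subst hf
  have h0 : φ =ᵐ[halfLine] 0 := h1.symm.trans (Lp.coeFn_zero _ _ _)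
  have hE : EqOn φ 0 (Ioi 0) :=
    Measure.eqOn_open_of_ae_eq h0 isOpen_Ioi hφ.1.continuous.continuousOn continuousOn_const
  have hz : φ = 0 := by
    funext x
    by_cases hx : x ∈ Ioi (0 : ℝ)
    · exact hE hx
    · exact image_eq_zero_of_notMem_tsupport fun h => hx (hφ.2.2 h)
  subst hz
  rw [Lp.eq_zero_iff_ae_eq_zero]
  refine h2.trans (Eventually.of_forall fun x => ?_)
  have : deriv (0 : ℝ → ℂ) = 0 := by funext y; exact deriv_const y 0
  simp [diffExpr, this]

/-- The minimal extension: the graph closure of `delta0`. -/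
def deltaMin : L2 →ₗ.[ℂ] L2 := delta0.closure

/-- The maximal extension: the Hilbert space adjoint of the minimal one. -/
def deltaMax : L2 →ₗ.[ℂ] L2 := deltaMin.adjoint

/-! ### Boundary values and the self-adjoint realizations -/

/-- `a = c₊(f)` and `b = c₋(f)` are the coefficients in
`f(x) = a √x + b √x log x + r(x)`, where `r` is continuously differentiable on `(0, ∞)`,
`r(x) = O(x^{3/2} log x)` and `r'(x) = O(x^{1/2} log x)` as `x → 0+`. -/
def HasBoundaryCoeffs (f : L2) (a b : ℂ) : Prop :=
  ∃ r : ℝ → ℂ, ContDiffOn ℝ 1 r (Ioi 0) ∧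
    (∀ᵐ x ∂halfLine,
      f x = a * (Real.sqrt x : ℂ) + b * ((Real.sqrt x * Real.log x : ℝ) : ℂ) + r x) ∧
    r =O[𝓝[>] (0 : ℝ)] (fun x : ℝ => x ^ (3 / 2 : ℝ) * Real.log x) ∧
    deriv r =O[𝓝[>] (0 : ℝ)] (fun x : ℝ => x ^ (1 / 2 : ℝ) * Real.log x)

/-- The functions with `cos θ · c₊(f) + sin θ · c₋(f) = 0`. -/
def boundaryCondition (θ : ℝ) : Submodule ℂ L2 where
  carrier := {f | ∃ a b : ℂ, HasBoundaryCoeffs f a b ∧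
    (Real.cos θ : ℂ) * a + (Real.sin θ : ℂ) * b = 0}
  zero_mem' := by
    refine ⟨0, 0, ⟨0, contDiffOn_const, ?_, ?_, ?_⟩, by simp⟩
    · filter_upwards [Lp.coeFn_zero ℂ 2 halfLine] with x hx
      rw [hx]
      simp
    · exact Asymptotics.isBigO_zero _ _
    · have : deriv (0 : ℝ → ℂ) = 0 := by funext y; exact deriv_const y 0
      rw [this]
      exact Asymptotics.isBigO_zero _ _
  add_mem' := by
    rintro f g ⟨a, b, ⟨r, hr1, hr2, hr3, hr4⟩, h⟩ ⟨a', b', ⟨s, hs1, hs2, hs3, hs4⟩, h'⟩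
    refine ⟨a + a', b + b', ⟨r + s, hr1.add hs1, ?_, hr3.add hs3, ?_⟩, ?_⟩
    · filter_upwards [Lp.coeFn_add f g, hr2, hs2] with x h0 h1 h2
      rw [h0, Pi.add_apply, h1, h2, Pi.add_apply]
      ring
    · refine (hr4.add hs4).congr' ?_ EventuallyEq.rfl
      filter_upwards [self_mem_nhdsWithin] with x hx
      have hn : Ioi (0 : ℝ) ∈ 𝓝 x := isOpen_Ioi.mem_nhds hx
      exact (deriv_add ((hr1.differentiableOn (by simp)).differentiableAt hn)
        ((hs1.differentiableOn (by simp)).differentiableAt hn)).symm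
    · linear_combination h + h'
  smul_mem' := by
    rintro c f ⟨a, b, ⟨r, hr1, hr2, hr3, hr4⟩, h⟩
    refine ⟨c * a, c * b, ⟨c • r, contDiffOn_const.smul hr1, ?_, hr3.const_smul_left c, ?_⟩, ?_⟩
    · filter_upwards [Lp.coeFn_smul c f, hr2] with x h0 h1
      rw [h0, Pi.smul_apply, h1, Pi.smul_apply, smul_eq_mul, smul_eq_mul]
      ring
    · have : deriv (c • r) = c • deriv r := by funext x; exact deriv_const_smul_field c r
      rw [this]
      exact hr4.const_smul_left c
    · linear_combination c * h

/-- The realization `Δ(θ)`: the restriction of the maximal operator to the `f` in its domain with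
`cos θ · c₊(f) + sin θ · c₋(f) = 0`. -/
def delta (θ : ℝ) : L2 →ₗ.[ℂ] L2 := deltaMax.domRestrict (boundaryCondition θ)

/-! ### Heat semigroups and heat kernels -/

/-- `T` is the heat semigroup `(e^{-tA})_{t ≥ 0}` of the operator `A`: a strongly continuous
one-parameter semigroup of bounded operators whose infinitesimal generator is exactly `-A`
(values of `T` at negative times are irrelevant). -/
structure IsHeatSemigroup (A : L2 →ₗ.[ℂ] L2) (T : ℝ → L2 →L[ℂ] L2) : Prop where
  map_zero : T 0 = ContinuousLinearMap.id ℂ L2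
  map_add : ∀ s t : ℝ, 0 ≤ s → 0 ≤ t → T (s + t) = (T s).comp (T t)
  strong_continuity : ∀ f : L2, Tendsto (fun t => T t f) (𝓝[>] 0) (𝓝 f)
  generator : ∀ f g : L2, (f, g) ∈ A.graph ↔
    Tendsto (fun t : ℝ => ((t⁻¹ : ℝ) : ℂ) • (f - T t f)) (𝓝[>] 0) (𝓝 g)

/-- `E(x, y, t)` is the heat kernel of `A`: for every `t > 0`, `E(·, ·, t)` is a measurable
integral kernel on `(0, ∞)²` of the operator `e^{-tA}`. -/
def IsHeatKernel (A : L2 →ₗ.[ℂ] L2) (E : ℝ → ℝ → ℝ → ℂ) : Prop :=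
  ∃ T : ℝ → L2 →L[ℂ] L2, IsHeatSemigroup A T ∧
    ∀ t : ℝ, 0 < t →
      AEStronglyMeasurable (fun p : ℝ × ℝ => E p.1 p.2 t) (halfLine.prod halfLine) ∧
      ∀ φ : L2, ∀ᵐ x ∂halfLine,
        Integrable (fun y => E x y t * φ y) halfLine ∧
        T t φ x = ∫ y, E x y t * φ y ∂halfLine

/-! ### The explicit kernels -/

/-- The modified Bessel function `I₀(z) = ∑ (z/2)^{2k} / (k!)²`. -/
def besselI0 (z : ℝ) : ℝ := ∑' k : ℕ, (z / 2) ^ (2 * k) / (k.factorial : ℝ) ^ 2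

/-- `E₊(x, y, t) = √(xy) / (2t) · I₀(xy / (2t)) · exp(-(x² + y²) / (4t))`. -/
def friedrichsKernel (x y t : ℝ) : ℝ :=
  Real.sqrt (x * y) / (2 * t) * besselI0 (x * y / (2 * t)) *
    Real.exp (-(x ^ 2 + y ^ 2) / (4 * t))

/-- `N'E₊(x, t) = √x / (2t) · exp(-x² / (4t))`. -/
def traceKernel (x t : ℝ) : ℝ :=
  Real.sqrt x / (2 * t) * Real.exp (-x ^ 2 / (4 * t))

/-- `κ_θ = γ - log 2 + tan θ`, with `γ` the Euler-Mascheroni constant. -/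
def kappa (θ : ℝ) : ℝ := Real.eulerMascheroniConstant - Real.log 2 + Real.tan θ

/-- `ζ ↦ (log √ζ + κ_θ)⁻¹`, with principal branches. -/
def symbol (θ : ℝ) (ζ : ℂ) : ℂ := (Complex.log (ζ ^ (1 / 2 : ℂ)) + (kappa θ : ℂ))⁻¹

/-- `K` is, on `(0, ∞)`, the inverse Laplace transform of a function `L` that is analytic on
`Re ζ > σ`: for every `δ > σ` and `t > 0`,
`K(t) = (1 / 2πi) ∫_{δ + iℝ} e^{tζ} L(ζ) dζ`, the integral being the limit as `R → ∞` of the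
integrals over the segments from `δ - iR` to `δ + iR` (where `dζ = i ds` for `ζ = δ + is`). -/
def IsInverseLaplace (L : ℂ → ℂ) (σ : ℝ) (K : ℝ → ℂ) : Prop :=
  AnalyticOnNhd ℂ L {ζ | σ < ζ.re} ∧
  ∀ δ : ℝ, σ < δ → ∀ t : ℝ, 0 < t →
    Tendsto (fun R : ℝ => (1 / (2 * (Real.pi : ℂ))) *
        ∫ s in (-R)..R, Complex.exp ((t : ℂ) * ((δ : ℂ) + (s : ℂ) * Complex.I)) *
          L ((δ : ℂ) + (s : ℂ) * Complex.I))
      atTop (𝓝 (K t))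

/-- Convolution in time, `(f *_t g)(t) = ∫₀^t f(t - s) g(s) ds`. -/
def timeConv (f g : ℝ → ℂ) (t : ℝ) : ℂ := ∫ s in (0 : ℝ)..t, f (t - s) * g s

/-- `E₊ + N'E₊ *_t K *_t N'E₊`, that is,
`E₊(x, y, t) + (N'E₊(x, ·) *_t (K *_t N'E₊(y, ·)))(t)`. -/
def correctedKernel (K : ℝ → ℂ) (x y t : ℝ) : ℂ :=
  (friedrichsKernel x y t : ℂ) +
    timeConv (fun s => (traceKernel x s : ℂ)) (timeConv K (fun s => (traceKernel y s : ℂ))) t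

end RegSing

end

/-!
The heat semigroup of `Δ(θ)` is built from its kernel, and its generator is identified through the
Laplace transform in time.

The vectors `n_s = N'E₊(·, s)` are Gaussians times `√x`. They satisfy `T₊(t) n_s = n_{s+t}` for the
operator `T₊(t)` with kernel `E₊(·, ·, t)`, a contraction by Schur's test with the conserved weight
`√x`, and they span a dense subspace (`mem_of_traceVec_mem`). What is closed and linear about the
Friedrichs semigroup `T₊` can therefore be checked on them. The correction to `T₊` is the causal
convolution of `K` with `s ↦ ⟪n_s, ·⟫` and `s ↦ n_s`, so its Laplace transform at `l` is
`m(l) ⟪d, ·⟫ d`, where `m` is the Laplace transform of `K` and `d = ∫₀^∞ e^{-ls} n_s ds` is the square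
integrable solution of `Δ d = -l d` (`laplace_corrOp`).

By `isHeatSemigroup_of_laplace`, a strongly continuous family of operators with exponential bounds is
the heat semigroup of `A` as soon as its Laplace transform at `l` is a right inverse of `A + l` and
`A + l` is injective; the semigroup law comes for free from the resolvent identity. To verify this
for `A = Δ(θ)`, the equation `Δ f = -g` with boundary coefficients `a`, `b` is written in the
integrated form `f = √x (a + b log x + ∫₀ˣ s⁻¹ ∫₀ˢ √y g(y) dy ds)` (`HasTwofoldForm`). By Green's
identity and the lemma of du Bois-Reymond it is equivalent to membership of `(f, -g)` in the graph of
the maximal operator together with the boundary expansion of `f` (`mem_graph_delta_iff`). For the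
trace kernels the twofold integral is the exponential integral `Ein(x² / (4s)) / 2`, and the
asymptotics `Ein(z) = log z + γ + o(1)` yield the boundary coefficients `-c` and `-1` of `d`, with
`c = (log l) / 2 - log 2 + γ`, while the Friedrichs resolvent of `f` has coefficients `⟪d, f⟫` and
`0`. The corrected resolvent thus satisfies the boundary condition exactly when
`cos θ (1 - m(l) c) = sin θ m(l)`, that is, when `m(l) = ((log l) / 2 + κ_θ)⁻¹`, and `m = 0` for
`θ = π / 2`. Injectivity of `Δ(θ) + l` for large `l` holds because a solution without logarithmic term
grows (`HasTwofoldForm.eq_zero`), so that only multiples of `d` remain, and `d` violates the boundary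
condition.

The function with Laplace transform `((log ζ) / 2 + κ)⁻¹` is the Volterra function
`2 ∫₀^∞ e^{-2κu} t^{u-1} / Γ(u) du` (`volterraKernel`), by Tonelli's theorem for real `ζ` and by
analytic continuation in the half-plane. It is nonnegative, which gives integrability, and
differentiable for `t > 0`, which gives the inversion formula as a principal value: after
subtraction of a Gaussian, this is the Riemann-Lebesgue lemma applied to the difference quotient
(`tendsto_fourier_truncated`).
-/

noncomputable section

namespace RegSing

/-! ### Uniqueness of exponential moments -/

/-- An integrable function on the half-line whose integrals against all powers of `exp (-τ)`
vanish is zero almost everywhere, where `τ` is a coordinate on `(0, ∞)` with inverse `ρ`.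
By Weierstrass approximation, every test function is a uniform limit of polynomials in
`exp (-τ)`. -/
theorem ae_eq_zero_of_integral_exp_eq_zero {F : ℝ → ℂ} {τ ρ : ℝ → ℝ} (hτ : Continuous τ)
    (hτ0 : ∀ x, 0 < x → 0 < τ x) (hρ : Continuous ρ) (hρτ : ∀ x, 0 < x → ρ (τ x) = x)
    (hρtop : Tendsto ρ atTop atTop) (hρ0 : ρ 0 ≤ 0) (hF : Integrable F halfLine)
    (h : ∀ n : ℕ, ∫ x, F x * (Real.exp (-τ x) ^ n : ℝ) ∂halfLine = 0) :
    F =ᵐ[halfLine] 0 := by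
  have key : ∀ g : ℝ → ℝ, ContDiff ℝ ∞ g → HasCompactSupport g → tsupport g ⊆ Ioi 0 →
      ∫ x in Ioi 0, g x • F x = 0 := by
    intro g hg hgc hgs
    -- `g` in the variable `exp (-τ)`; it is continuous at `0` because `g` has bounded support
    set G : ℝ → ℝ := fun y => g (ρ (-Real.log y)) with hG
    have hg0 : ∀ x, x ≤ 0 → g x = 0 := fun x hx =>
      image_eq_zero_of_notMem_tsupport fun hx' => absurd (hgs hx') (by simpa using hx)
    obtain ⟨B, hB⟩ : ∃ B, ∀ x, B < x → g x = 0 := by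
      obtain ⟨B, hB⟩ := hgc.isCompact.bddAbove
      exact ⟨B, fun x hx => image_eq_zero_of_notMem_tsupport fun hx' =>
        absurd (hB hx') (by simpa using hx)⟩
    have hGc : Continuous G := by
      rw [continuous_iff_continuousAt]
      intro y
      by_cases hy : y = 0
      · subst hy
        have h1 : ∀ᶠ y in 𝓝[≠] (0 : ℝ), G y = 0 := by
          have := (hρtop.comp (tendsto_neg_atBot_atTop.comp Real.tendsto_log_nhdsNE_zero))
          filter_upwards [this.eventually_gt_atTop B] with y hy
          exact hB _ hy
        have h2 : G 0 = 0 := by simpa [hG] using hg0 _ hρ0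
        have h3 : ∀ᶠ y in 𝓝 (0 : ℝ), G y = 0 := by
          rw [eventually_nhdsWithin_iff] at h1
          filter_upwards [h1] with y hy
          by_cases hy0 : y = 0
          · rw [hy0, h2]
          · exact hy hy0
        exact (continuousAt_const (y := (0 : ℝ))).congr (h3.mono fun y hy => hy.symm)
      · exact (hg.continuous.comp hρ).continuousAt.comp (Real.continuousAt_log hy).neg
    have hGe : ∀ x, 0 < x → G (Real.exp (-τ x)) = g x := fun x hx => by
      simp [hG, hρτ x hx]
    have hpoly : ∀ p : Polynomial ℝ,
        ∫ x, F x * (p.eval (Real.exp (-τ x)) : ℝ) ∂halfLine = 0 := by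
      intro p
      have e1 : ∀ x, F x * ((p.eval (Real.exp (-τ x)) : ℝ) : ℂ) =
          ∑ n ∈ p.support, (p.coeff n : ℂ) * (F x * (Real.exp (-τ x) ^ n : ℝ)) := by
        intro x
        rw [Polynomial.eval_eq_sum, Polynomial.sum, Complex.ofReal_sum, Finset.mul_sum]
        refine Finset.sum_congr rfl fun n _ => ?_
        push_cast; ring
      simp_rw [e1]
      rw [integral_finsetSum]
      · refine Finset.sum_eq_zero fun n _ => ?_
        rw [integral_const_mul, h n, mul_zero]
      · intro n _
        refine Integrable.const_mul ?_ _
        refine hF.mul_bdd (c := 1) ?_ ?_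
        · exact (Complex.continuous_ofReal.comp
            ((Real.continuous_exp.comp hτ.neg).pow n)).aestronglyMeasurable
        · refine (ae_restrict_mem measurableSet_Ioi).mono fun x hx => ?_
          rw [Complex.norm_real, Real.norm_eq_abs, abs_of_nonneg (by positivity)]
          exact pow_le_one₀ (Real.exp_pos _).le (Real.exp_le_one_iff.2 (by
            have := hτ0 x hx; linarith))
    have hgF : Integrable (fun x => g x • F x) halfLine := by
      obtain ⟨C, hC⟩ := hgc.exists_bound_of_continuous hg.continuous
      exact hF.bdd_smul C hg.continuous.aestronglyMeasurable (ae_of_all _ hC)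
    have hle : ∀ ε > 0, ‖∫ x, g x • F x ∂halfLine‖ ≤ ε * ∫ x, ‖F x‖ ∂halfLine := by
      intro ε hε
      obtain ⟨p, hp⟩ := exists_polynomial_near_of_continuousOn 0 1 G hGc.continuousOn ε hε
      have e2 : ∫ x, g x • F x ∂halfLine =
          ∫ x, (g x • F x - F x * (p.eval (Real.exp (-τ x)) : ℝ)) ∂halfLine := by
        rw [integral_sub hgF, hpoly, sub_zero]
        refine hF.mul_bdd (c := ε + ‖hgc.exists_bound_of_continuous hg.continuous |>.choose‖) ?_ ?_
        · exact (Complex.continuous_ofReal.comp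
            (p.continuous.comp (Real.continuous_exp.comp hτ.neg))).aestronglyMeasurable
        · refine (ae_restrict_mem measurableSet_Ioi).mono fun x hx => ?_
          have hx' : Real.exp (-τ x) ∈ Icc (0 : ℝ) 1 :=
            ⟨(Real.exp_pos _).le, Real.exp_le_one_iff.2 (by have := hτ0 x hx; linarith)⟩
          have h1 := hp _ hx'
          rw [hGe x hx] at h1
          have h2 := (hgc.exists_bound_of_continuous hg.continuous).choose_spec x
          rw [Complex.norm_real]
          rw [← Real.norm_eq_abs] at h1
          have h3 := norm_add_le (p.eval (Real.exp (-τ x)) - g x) (g x)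
          rw [sub_add_cancel] at h3
          have h4 := Real.le_norm_self (hgc.exists_bound_of_continuous hg.continuous).choose
          linarith
      rw [e2, ← integral_const_mul]
      refine norm_integral_le_of_norm_le (hF.norm.const_mul ε) ?_
      refine (ae_restrict_mem measurableSet_Ioi).mono fun x hx => ?_
      have hx' : Real.exp (-τ x) ∈ Icc (0 : ℝ) 1 :=
        ⟨(Real.exp_pos _).le, Real.exp_le_one_iff.2 (by have := hτ0 x hx; linarith)⟩
      have h1 := hp _ hx'
      rw [hGe x hx, abs_sub_comm] at h1
      have e3 : g x • F x - F x * (p.eval (Real.exp (-τ x)) : ℝ) =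
          ((g x - p.eval (Real.exp (-τ x)) : ℝ) : ℂ) * F x := by
        rw [Complex.real_smul]; push_cast; ring
      rw [e3, norm_mul, Complex.norm_real, Real.norm_eq_abs]
      gcongr
    have hnn : 0 ≤ ∫ x, ‖F x‖ ∂halfLine := integral_nonneg fun x => norm_nonneg _
    refine norm_le_zero_iff.1 (le_of_forall_pos_le_add fun ε hε => ?_)
    have := hle (ε / (1 + ∫ x, ‖F x‖ ∂halfLine)) (by positivity)
    refine this.trans ?_
    rw [zero_add, div_mul_eq_mul_div, div_le_iff₀ (by positivity)]
    nlinarith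
  have := isOpen_Ioi.ae_eq_zero_of_integral_contDiff_smul_eq_zero (U := Ioi (0 : ℝ)) (f := F)
    (μ := volume) (IntegrableOn.locallyIntegrableOn hF) (fun g h1 h2 h3 => by
      rw [← key g h1 h2 h3, ← setIntegral_eq_integral_of_forall_compl_eq_zero (s := Ioi 0)]
      intro x hx
      rw [image_eq_zero_of_notMem_tsupport fun hx' => hx (h3 hx'), zero_smul])
  rw [EventuallyEq, ae_restrict_iff' measurableSet_Ioi]
  exact this

theorem continuous_exp_neg_mul (l : ℝ) :
    Continuous fun t : ℝ => ((Real.exp (-(l * t)) : ℝ) : ℂ) := by fun_prop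

theorem hasDerivAt_exp_mul (a s : ℝ) :
    HasDerivAt (fun t : ℝ => ((Real.exp (a * t) : ℝ) : ℂ)) ((a : ℂ) * (Real.exp (a * s) : ℝ)) s := by
  have h : HasDerivAt (fun t => Real.exp (a * t)) (a * Real.exp (a * s)) s := by
    simpa [mul_comm] using ((hasDerivAt_id s).const_mul a).exp
  exact_mod_cast h.ofReal_comp

/-- Injectivity of the Laplace transform on continuous `L²`-valued functions of exponential
growth. -/
theorem eq_zero_of_laplace_eq_zero {c : ℝ → L2} {M σ σ' : ℝ} (hc : ContinuousOn c (Ici 0))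
    (hb : ∀ t, 0 ≤ t → ‖c t‖ ≤ M * Real.exp (σ * t))
    (h : ∀ l, σ' < l → ∫ t in Ioi (0 : ℝ), ((Real.exp (-(l * t)) : ℝ) : ℂ) • c t = 0) :
    ∀ t, 0 ≤ t → c t = 0 := by
  set N : ℝ := max σ σ' + 1 with hN
  have hN1 : σ < N := by have := le_max_left σ σ'; linarith
  have hN2 : σ' < N := by have := le_max_right σ σ'; linarith
  have hint : ∀ l, σ < l →
      IntegrableOn (fun t => ((Real.exp (-(l * t)) : ℝ) : ℂ) • c t) (Ioi 0) := by
    intro l hl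
    have h1 : IntegrableOn (fun t : ℝ => M * Real.exp (-(l - σ) * t)) (Ioi 0) :=
      (exp_neg_integrableOn_Ioi 0 (by linarith)).const_mul M
    refine Integrable.mono' h1 ?_ ?_
    · refine ContinuousOn.aestronglyMeasurable ?_ measurableSet_Ioi
      exact ContinuousOn.smul (continuous_exp_neg_mul _).continuousOn (hc.mono Ioi_subset_Ici_self)
    · refine (ae_restrict_mem measurableSet_Ioi).mono fun t ht => ?_
      rw [norm_smul, Complex.norm_real, Real.norm_eq_abs, abs_of_pos (Real.exp_pos _)]
      calc _ ≤ Real.exp (-(l * t)) * (M * Real.exp (σ * t)) := by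
            gcongr; exact hb t (le_of_lt ht)
        _ = M * (Real.exp (-(l * t)) * Real.exp (σ * t)) := by ring
        _ = _ := by rw [← Real.exp_add]; ring_nf
  have key : ∀ t, 0 < t → c t = 0 := by
    intro t ht
    refine ext_inner_left ℂ fun g => ?_
    rw [inner_zero_right]
    set F : ℝ → ℂ := fun s => inner ℂ g (((Real.exp (-(N * s)) : ℝ) : ℂ) • c s) with hF
    have hFi : Integrable F halfLine := (hint N hN1).const_inner g
    have h0 := ae_eq_zero_of_integral_exp_eq_zero (F := F) (τ := id) (ρ := id) continuous_id
      (fun x hx => hx) continuous_id (fun x _ => rfl) tendsto_id le_rfl hFi (fun n => by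
        have e : ∀ s, F s * ((Real.exp (-id s) ^ n : ℝ) : ℂ) =
            inner ℂ g (((Real.exp (-((N + n) * s)) : ℝ) : ℂ) • c s) := by
          intro s
          simp only [hF, inner_smul_right, id]
          rw [← Real.exp_nat_mul, mul_right_comm, ← Complex.ofReal_mul, ← Real.exp_add]
          ring_nf
        simp_rw [e]
        have hn : (0 : ℝ) ≤ n := Nat.cast_nonneg n
        rw [integral_inner (hint _ (by linarith)), h _ (by linarith), inner_zero_right])
    have hFc : ContinuousOn F (Ioi 0) := by
      refine continuousOn_const.inner ?_
      exact ContinuousOn.smul (continuous_exp_neg_mul _).continuousOn (hc.mono Ioi_subset_Ici_self)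
    have := Measure.eqOn_open_of_ae_eq h0 isOpen_Ioi hFc continuousOn_const ht
    simp only [hF, inner_smul_right, Pi.zero_apply, mul_eq_zero] at this
    exact this.resolve_left (by simp)
  intro t ht
  rcases ht.eq_or_lt with rfl | ht
  · have h1 : Tendsto c (𝓝[>] 0) (𝓝 (c 0)) :=
      (hc 0 self_mem_Ici).mono_left (nhdsWithin_mono _ Ioi_subset_Ici_self)
    refine tendsto_nhds_unique h1 (tendsto_const_nhds.congr' ?_)
    filter_upwards [self_mem_nhdsWithin] with t ht using (key t ht).symm
  · exact key t ht

/-! ### Semigroups from their resolvents -/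

/-- A strongly continuous family of bounded operators of exponential growth whose Laplace
transform is the resolvent of `-A` is the heat semigroup of `A`. The semigroup law is the
resolvent identity, transported by uniqueness of Laplace transforms in both time variables. -/
theorem isHeatSemigroup_of_laplace {A : L2 →ₗ.[ℂ] L2} {T : ℝ → L2 →L[ℂ] L2} {M σ : ℝ}
    (h0 : T 0 = ContinuousLinearMap.id ℂ L2)
    (hc : ∀ f, ContinuousOn (fun t => T t f) (Ici 0))
    (hb : ∀ t, 0 ≤ t → ‖T t‖ ≤ M * Real.exp (σ * t))
    (hR : ∀ l, σ < l → ∀ f,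
      (∫ t in Ioi (0 : ℝ), ((Real.exp (-(l * t)) : ℝ) : ℂ) • T t f,
        f - (l : ℂ) • ∫ t in Ioi (0 : ℝ), ((Real.exp (-(l * t)) : ℝ) : ℂ) • T t f) ∈ A.graph)
    (hinj : ∀ l, σ < l → ∀ f, (f, -((l : ℂ) • f)) ∈ A.graph → f = 0) :
    IsHeatSemigroup A T := by
  have hM : 0 ≤ M := by
    have := (norm_nonneg _).trans (hb 0 le_rfl); simpa using this
  have hb' : ∀ t, 0 ≤ t → ∀ f, ‖T t f‖ ≤ M * ‖f‖ * Real.exp (σ * t) := fun t ht f =>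
    ((T t).le_opNorm f).trans ((mul_le_mul_of_nonneg_right (hb t ht) (norm_nonneg f)).trans_eq
      (by ring))
  -- Laplace integrals of continuous functions of exponential growth, with a bound
  have hgen : ∀ (c : ℝ → L2) (B l : ℝ), ContinuousOn c (Ici 0) →
      (∀ t, 0 ≤ t → ‖c t‖ ≤ B * Real.exp (σ * t)) → σ < l →
      IntegrableOn (fun t => ((Real.exp (-(l * t)) : ℝ) : ℂ) • c t) (Ioi 0) ∧
        ‖∫ t in Ioi (0 : ℝ), ((Real.exp (-(l * t)) : ℝ) : ℂ) • c t‖ ≤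
          B * ∫ t in Ioi (0 : ℝ), Real.exp (-(l - σ) * t) := by
    intro c B l hc hB hl
    have h1 : IntegrableOn (fun t : ℝ => B * Real.exp (-(l - σ) * t)) (Ioi 0) :=
      (exp_neg_integrableOn_Ioi 0 (by linarith)).const_mul B
    have h2 : ∀ᵐ t ∂(volume.restrict (Ioi (0 : ℝ))),
        ‖((Real.exp (-(l * t)) : ℝ) : ℂ) • c t‖ ≤ B * Real.exp (-(l - σ) * t) := by
      refine (ae_restrict_mem measurableSet_Ioi).mono fun t ht => ?_
      rw [norm_smul, Complex.norm_real, Real.norm_eq_abs, abs_of_pos (Real.exp_pos _)]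
      calc _ ≤ Real.exp (-(l * t)) * (B * Real.exp (σ * t)) := by
            gcongr; exact hB t (le_of_lt ht)
        _ = B * (Real.exp (-(l * t)) * Real.exp (σ * t)) := by ring
        _ = _ := by rw [← Real.exp_add]; ring_nf
    refine ⟨Integrable.mono' h1 ?_ h2, ?_⟩
    · refine ContinuousOn.aestronglyMeasurable ?_ measurableSet_Ioi
      exact ContinuousOn.smul (continuous_exp_neg_mul _).continuousOn (hc.mono Ioi_subset_Ici_self)
    · exact (norm_integral_le_of_norm_le h1 h2).trans_eq (integral_const_mul _ _)
  have hint : ∀ l, σ < l → ∀ f,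
      IntegrableOn (fun t => ((Real.exp (-(l * t)) : ℝ) : ℂ) • T t f) (Ioi 0) :=
    fun l hl f => (hgen _ _ l (hc f) (fun t ht => hb' t ht f) hl).1
  -- the Laplace transform as a bounded operator, the resolvent of `-A`
  have hRdef : ∀ l, σ < l → ∃ R : L2 →L[ℂ] L2, ∀ f,
      R f = ∫ t in Ioi (0 : ℝ), ((Real.exp (-(l * t)) : ℝ) : ℂ) • T t f := by
    intro l hl
    refine ⟨LinearMap.mkContinuous
      { toFun := fun f => ∫ t in Ioi (0 : ℝ), ((Real.exp (-(l * t)) : ℝ) : ℂ) • T t f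
        map_add' := fun f g => by
          rw [← integral_add (hint l hl f) (hint l hl g)]
          simp only [map_add, smul_add]
        map_smul' := fun a f => by
          rw [RingHom.id_apply, ← integral_smul]
          simp only [map_smul, smul_comm a] }
      (M * ∫ t in Ioi (0 : ℝ), Real.exp (-(l - σ) * t)) fun f => ?_, fun f => rfl⟩
    exact ((hgen _ _ l (hc f) (fun t ht => hb' t ht f) hl).2).trans_eq (by ring)
  choose! R hRf using hRdef
  have hRg : ∀ l, σ < l → ∀ f, (R l f, f - (l : ℂ) • R l f) ∈ A.graph := fun l hl f => by
    rw [hRf l hl]; exact hR l hl f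
  -- the resolvent identity, since both sides solve the same equation for `A + l`
  have hres : ∀ l m, σ < l → σ < m → ∀ f,
      R m f - R l f = ((l : ℂ) - m) • R l (R m f) := by
    intro l m hl hm f
    rw [← sub_eq_zero]
    refine hinj l hl _ ?_
    have := A.graph.sub_mem (A.graph.sub_mem (hRg m hm f) (hRg l hl f))
      (A.graph.smul_mem ((l : ℂ) - m) (hRg l hl (R m f)))
    convert this using 1
    simp only [Prod.mk_sub_mk, Prod.smul_mk, Prod.mk.injEq, true_and]
    module
  -- the shifted Laplace transform `∫₀^∞ e^{-lt} T(t + s) f dt`, in a form that is differentiable in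
  -- `s`; `T` is extended constantly to negative times
  set L : ℝ → L2 → ℝ → L2 := fun l f s => ((Real.exp (l * s) : ℝ) : ℂ) •
    (R l f - ∫ r in (0 : ℝ)..s, ((Real.exp (-(l * r)) : ℝ) : ℂ) • T (max r 0) f) with hL
  have hcc : ∀ f, Continuous fun r => T (max r 0) f := fun f =>
    (hc f).comp_continuous (by fun_prop) (fun r => le_max_right r 0)
  have hLs : ∀ l, σ < l → ∀ f s, 0 ≤ s →
      L l f s = ∫ t in Ioi (0 : ℝ), ((Real.exp (-(l * t)) : ℝ) : ℂ) • T (t + s) f := by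
    intro l hl f s hs
    have e1 : ∫ r in (0 : ℝ)..s, ((Real.exp (-(l * r)) : ℝ) : ℂ) • T (max r 0) f =
        ∫ r in Ioc 0 s, ((Real.exp (-(l * r)) : ℝ) : ℂ) • T r f := by
      rw [intervalIntegral.integral_of_le hs]
      refine setIntegral_congr_fun measurableSet_Ioc fun r hr => ?_
      simp only [max_eq_left hr.1.le]
    have e2 : R l f - ∫ r in (0 : ℝ)..s, ((Real.exp (-(l * r)) : ℝ) : ℂ) • T (max r 0) f =
        ∫ r in Ioi s, ((Real.exp (-(l * r)) : ℝ) : ℂ) • T r f := by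
      rw [e1, hRf l hl, sub_eq_iff_eq_add, ← Ioc_union_Ioi_eq_Ioi hs, setIntegral_union
        (Ioc_disjoint_Ioi le_rfl) measurableSet_Ioi ((hint l hl f).mono_set Ioc_subset_Ioi_self)
        ((hint l hl f).mono_set (Ioi_subset_Ioi hs)), add_comm]
    simp only [hL]
    rw [e2, ← integral_smul]
    have e3 := (measurePreserving_add_right volume s).setIntegral_preimage_emb
      (measurableEmbedding_addRight s)
      (fun r => ((Real.exp (l * s) : ℝ) : ℂ) • ((Real.exp (-(l * r)) : ℝ) : ℂ) • T r f) (Ioi s)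
    rw [preimage_add_const_Ioi, sub_self] at e3
    rw [← e3]
    refine setIntegral_congr_fun measurableSet_Ioi fun t _ => ?_
    rw [smul_smul, ← Complex.ofReal_mul, ← Real.exp_add]
    ring_nf
  have hLd : ∀ l f s, HasDerivAt (L l f) ((l : ℂ) • L l f s - T (max s 0) f) s := by
    intro l f s
    have h1 := hasDerivAt_exp_mul l s
    have h2 : HasDerivAt (fun s => R l f -
        ∫ r in (0 : ℝ)..s, ((Real.exp (-(l * r)) : ℝ) : ℂ) • T (max r 0) f)
        (-(((Real.exp (-(l * s)) : ℝ) : ℂ) • T (max s 0) f)) s := by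
      have hcont : Continuous fun r => ((Real.exp (-(l * r)) : ℝ) : ℂ) • T (max r 0) f :=
        Continuous.smul (continuous_exp_neg_mul _) (hcc f)
      exact (intervalIntegral.integral_hasDerivAt_right (hcont.intervalIntegrable _ _)
        (hcont.stronglyMeasurableAtFilter _ _) hcont.continuousAt).const_sub _
    refine (h1.smul h2).congr_deriv ?_
    simp only [hL]
    rw [smul_neg, smul_smul, ← Complex.ofReal_mul, ← Real.exp_add]
    simp only [add_neg_cancel, Real.exp_zero, Complex.ofReal_one, one_smul, smul_smul]
    abel
  have hLb : ∀ l, σ < l → ∀ f s, 0 ≤ s → ‖L l f s‖ ≤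
      (M * ‖f‖ * ∫ t in Ioi (0 : ℝ), Real.exp (-(l - σ) * t)) * Real.exp (σ * s) := by
    intro l hl f s hs
    rw [hLs l hl f s hs]
    refine ((hgen (fun t => T (t + s) f) (M * ‖f‖ * Real.exp (σ * s)) l ?_ ?_ hl).2).trans_eq
      (by ring)
    · exact (hc f).comp (by fun_prop) fun t ht => add_nonneg ht hs
    · intro t ht
      refine (hb' (t + s) (add_nonneg ht hs) f).trans_eq ?_
      rw [mul_add, Real.exp_add]; ring
  have hL0 : ∀ l f, L l f 0 = R l f := fun l f => by simp [hL]
  -- its Laplace transform in `s` is the difference quotient of the resolvent, which by the resolvent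
  -- identity is the Laplace transform of `s ↦ R l (T s f)`
  have hLL : ∀ l m, σ < l → l < m → ∀ f,
      ((m : ℂ) - l) • ∫ s in Ioi (0 : ℝ), ((Real.exp (-(m * s)) : ℝ) : ℂ) • L l f s =
        R l f - R m f := by
    intro l m hl hm f
    have hσm := hl.trans hm
    have hLc : ContinuousOn (L l f) (Ici 0) := fun s _ =>
      (hLd l f s).continuousAt.continuousWithinAt
    have hi := (hgen (L l f) _ m hLc (hLb l hl f) hσm).1
    have hd : ∀ s ∈ Ici (0 : ℝ), HasDerivAt (fun s => ((Real.exp (-(m * s)) : ℝ) : ℂ) • L l f s)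
        (-(((m : ℂ) - l) • ((Real.exp (-(m * s)) : ℝ) : ℂ) • L l f s) -
          ((Real.exp (-(m * s)) : ℝ) : ℂ) • T s f) s := by
      intro s hs
      have h1 := hasDerivAt_exp_mul (-m) s
      simp only [neg_mul, Complex.ofReal_neg] at h1
      refine (h1.smul (hLd l f s)).congr_deriv ?_
      rw [max_eq_left hs]
      module
    have hlim : Tendsto (fun s => ((Real.exp (-(m * s)) : ℝ) : ℂ) • L l f s) atTop (𝓝 0) := by
      obtain ⟨B, hB⟩ : ∃ B, ∀ s, 0 ≤ s → ‖L l f s‖ ≤ B * Real.exp (σ * s) := ⟨_, hLb l hl f⟩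
      have h1 : Tendsto (fun s => B * Real.exp (-((m - σ) * s))) atTop (𝓝 (B * 0)) := by
        refine Tendsto.const_mul _ (Real.tendsto_exp_neg_atTop_nhds_zero.comp ?_)
        exact tendsto_id.const_mul_atTop (by linarith)
      rw [mul_zero] at h1
      refine squeeze_zero_norm' ?_ h1
      filter_upwards [eventually_ge_atTop 0] with s hs
      rw [norm_smul, Complex.norm_real, Real.norm_eq_abs, abs_of_pos (Real.exp_pos _)]
      calc _ ≤ Real.exp (-(m * s)) * (B * Real.exp (σ * s)) := by gcongr; exact hB s hs
        _ = B * (Real.exp (-(m * s)) * Real.exp (σ * s)) := by ring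
        _ = _ := by rw [← Real.exp_add]; ring_nf
    have hi' : IntegrableOn (fun s => -(((m : ℂ) - l) • ((Real.exp (-(m * s)) : ℝ) : ℂ) • L l f s))
        (Ioi 0) := (hi.smul ((m : ℂ) - l)).neg
    have := integral_Ioi_of_hasDerivAt_of_tendsto' hd (hi'.sub (hint m hσm f)) hlim
    rw [integral_sub hi' (hint m hσm f), ← hRf m hσm, integral_neg, integral_smul] at this
    simp only [mul_zero, neg_zero, Real.exp_zero, Complex.ofReal_one, one_smul, hL0,
      zero_sub] at this
    linear_combination (norm := module) (-1 : ℂ) • this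
  have hcomm : ∀ l, σ < l → ∀ f s, 0 ≤ s → L l f s = R l (T s f) := by
    intro l hl f s hs
    rw [← sub_eq_zero]
    refine eq_zero_of_laplace_eq_zero (c := fun s => L l f s - R l (T s f)) (σ' := l) (σ := σ)
      (M := (M * ‖f‖ * ∫ t in Ioi (0 : ℝ), Real.exp (-(l - σ) * t)) + ‖R l‖ * (M * ‖f‖))
      ?_ ?_ ?_ s hs
    · exact ContinuousOn.sub (fun s _ => (hLd l f s).continuousAt.continuousWithinAt)
        ((R l).continuous.comp_continuousOn (hc f))
    · intro t ht
      rw [add_mul]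
      refine (norm_sub_le _ _).trans (add_le_add (hLb l hl f t ht) ?_)
      refine ((R l).le_opNorm _).trans ?_
      rw [mul_assoc]
      exact mul_le_mul_of_nonneg_left (hb' t ht f) (norm_nonneg _)
    · intro m hm
      have hσm := hl.trans hm
      have hLc : ContinuousOn (L l f) (Ici 0) := fun s _ =>
        (hLd l f s).continuousAt.continuousWithinAt
      have hi := (hgen (L l f) _ m hLc (hLb l hl f) hσm).1
      have hne : (m : ℂ) - l ≠ 0 := by
        rw [sub_ne_zero]; exact_mod_cast hm.ne'
      have e1 : ∀ s, ((Real.exp (-(m * s)) : ℝ) : ℂ) • R l (T s f) =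
          R l (((Real.exp (-(m * s)) : ℝ) : ℂ) • T s f) := fun s => by rw [map_smul]
      have e2 : ∫ s in Ioi (0 : ℝ), ((Real.exp (-(m * s)) : ℝ) : ℂ) • R l (T s f) =
          R l (R m f) := by
        simp_rw [e1]
        rw [(R l).integral_comp_comm (hint m hσm f), hRf m hσm]
      simp_rw [smul_sub]
      rw [integral_sub hi (by simp_rw [e1]; exact (R l).integrable_comp (hint m hσm f)), e2,
        sub_eq_zero]
      refine smul_right_injective _ hne ?_
      simp only
      rw [hLL l m hl hm f, ← neg_sub, hres l m hl hσm f, ← neg_smul, neg_sub]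
  -- hence `t ↦ T (t + s) f` and `t ↦ T t (T s f)` have the same Laplace transform
  have hsemi : ∀ s t : ℝ, 0 ≤ s → 0 ≤ t → ∀ f, T (t + s) f = T t (T s f) := by
    intro s t hs ht f
    rw [← sub_eq_zero]
    refine eq_zero_of_laplace_eq_zero (c := fun t => T (t + s) f - T t (T s f)) (σ' := σ) (σ := σ)
      (M := M * ‖f‖ * Real.exp (σ * s) + M * ‖T s f‖) ?_ ?_ ?_ t ht
    · exact ((hc f).comp (by fun_prop) fun t ht => add_nonneg ht hs).sub (hc _)
    · intro t ht
      rw [add_mul]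
      refine (norm_sub_le _ _).trans (add_le_add ?_ (hb' t ht _))
      refine (hb' (t + s) (add_nonneg ht hs) f).trans_eq ?_
      rw [mul_add, Real.exp_add]; ring
    · intro l hl
      have h1 := hcomm l hl f s hs
      rw [hLs l hl f s hs, hRf l hl] at h1
      simp only [smul_sub]
      rw [integral_sub _ (hint l hl _), h1, sub_self]
      refine (hgen (fun t => T (t + s) f) (M * ‖f‖ * Real.exp (σ * s)) l ?_ ?_ hl).1
      · exact (hc f).comp (by fun_prop) fun t ht => add_nonneg ht hs
      · intro t ht
        refine (hb' (t + s) (add_nonneg ht hs) f).trans_eq ?_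
        rw [mul_add, Real.exp_add]; ring
  have hTR : ∀ l, σ < l → ∀ f s, 0 ≤ s → T s (R l f) = L l f s := by
    intro l hl f s hs
    rw [hLs l hl f s hs, hRf l hl, ← (T s).integral_comp_comm (hint l hl f)]
    refine setIntegral_congr_fun measurableSet_Ioi fun t ht => ?_
    rw [map_smul, add_comm, hsemi t s (le_of_lt ht) hs]
  have hgenR : ∀ l, σ < l → ∀ f,
      Tendsto (fun t : ℝ => ((t⁻¹ : ℝ) : ℂ) • (R l f - T t (R l f))) (𝓝[>] 0)
        (𝓝 (f - (l : ℂ) • R l f)) := by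
    intro l hl f
    have h1 := (hasDerivAt_iff_tendsto_slope.1 (hLd l f 0)).mono_left
      (nhdsWithin_mono 0 (fun x (hx : 0 < x) => hx.ne'))
    rw [hL0, max_self, h0, ContinuousLinearMap.id_apply] at h1
    have h2 := h1.neg
    rw [neg_sub] at h2
    refine h2.congr' ?_
    filter_upwards [self_mem_nhdsWithin] with t ht
    rw [slope_def_module, sub_zero, hL0, hTR l hl f t (le_of_lt ht), ← smul_neg, neg_sub,
      Complex.coe_smul]
    rfl
  refine ⟨h0, fun s t hs ht => ?_, fun f => ?_, fun f g => ⟨fun hfg => ?_, fun hlim => ?_⟩⟩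
  · ext1 f
    exact hsemi t s ht hs f
  · have : Tendsto (fun t => T t f) (𝓝[>] 0) (𝓝 (T 0 f)) :=
      (hc f 0 self_mem_Ici).mono_left (nhdsWithin_mono _ Ioi_subset_Ici_self)
    rwa [h0] at this
  · have hl : σ < σ + 1 := by linarith
    set l := σ + 1
    have hf : f = R l (g + (l : ℂ) • f) := by
      rw [← sub_eq_zero]
      refine hinj l hl _ ?_
      have := A.graph.sub_mem hfg (hRg l hl (g + (l : ℂ) • f))
      convert this using 1
      simp only [Prod.mk_sub_mk, Prod.mk.injEq, true_and]
      module
    have := hgenR l hl (g + (l : ℂ) • f)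
    rw [← hf] at this
    simpa using this
  · have hl : σ < σ + 1 := by linarith
    set l := σ + 1
    -- applying the resolvent to the difference quotients shows that `f` is in its range
    have h1 : Tendsto (fun t : ℝ => R l (((t⁻¹ : ℝ) : ℂ) • (f - T t f))) (𝓝[>] 0)
        (𝓝 (R l g)) := ((R l).continuous.tendsto g).comp hlim
    have h2 := tendsto_nhds_unique (h1.congr' ?_) (hgenR l hl f)
    · have hf : f = R l (g + (l : ℂ) • f) := by
        rw [map_add, h2, map_smul]; abel
      have := hRg l hl (g + (l : ℂ) • f)
      rw [← hf] at this
      simpa using this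
    · filter_upwards [self_mem_nhdsWithin] with t ht
      rw [map_smul, map_sub, ← hcomm l hl f t (le_of_lt ht), hTR l hl f t (le_of_lt ht)]

/-! ### Bochner integrals in `L²` -/

/-- The Bochner integral of an `L²`-valued function with jointly measurable representatives is
represented by the pointwise integral: on sets of finite measure `L²` embeds into `L¹`, and both
sides have the same integrals over such sets by Fubini's theorem. -/
theorem coeFn_integral_L2 {μ : Measure ℝ} [SFinite μ] {N : ℝ → L2} {k : ℝ → ℝ → ℂ}
    (hk : AEStronglyMeasurable (fun p : ℝ × ℝ => k p.1 p.2) (halfLine.prod μ))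
    (hN : Integrable N μ) (hNk : ∀ᵐ u ∂μ, N u =ᵐ[halfLine] fun x => k x u) :
    (∀ᵐ x ∂halfLine, Integrable (k x) μ) ∧
      ((∫ u, N u ∂μ : L2) : ℝ → ℂ) =ᵐ[halfLine] fun x => ∫ u, k x u ∂μ := by
  have hint : ∀ s, MeasurableSet s → halfLine s < ⊤ →
      Integrable (fun p : ℝ × ℝ => k p.1 p.2) ((halfLine.restrict s).prod μ) := by
    intro s hs hsf
    have hm : AEStronglyMeasurable (fun p : ℝ × ℝ => k p.1 p.2) ((halfLine.restrict s).prod μ) :=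
      hk.mono_ac (Measure.AbsolutelyContinuous.prod Measure.restrict_le_self.absolutelyContinuous
        Measure.AbsolutelyContinuous.rfl)
    refine ⟨hm, ?_⟩
    rw [HasFiniteIntegral, lintegral_prod_symm _ hm.enorm]
    have h1 : ∀ᵐ u ∂μ, ∫⁻ x in s, ‖k x u‖ₑ ∂halfLine ≤ halfLine s ^ (1 / 2 : ℝ) * ‖N u‖ₑ := by
      filter_upwards [hNk] with u hu
      have h2 : ∫⁻ x in s, ‖k x u‖ₑ ∂halfLine = eLpNorm (N u) 1 (halfLine.restrict s) := by
        rw [eLpNorm_one_eq_lintegral_enorm]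
        refine lintegral_congr_ae ?_
        filter_upwards [ae_restrict_of_ae hu] with x hx
        rw [hx]
      rw [h2]
      have h3 := eLpNorm_le_eLpNorm_mul_rpow_measure_univ (μ := halfLine.restrict s)
        (f := N u) (p := 1) (q := 2) (by norm_num) (Lp.aestronglyMeasurable _).restrict
      have h4 : eLpNorm (N u) 2 (halfLine.restrict s) ≤ ‖N u‖ₑ := by
        rw [Lp.enorm_def]
        exact eLpNorm_mono_measure _ Measure.restrict_le_self
      refine h3.trans ?_
      rw [mul_comm, Measure.restrict_apply_univ]
      have h5 : (1 / (1 : ENNReal).toReal - 1 / (2 : ENNReal).toReal) = (1 / 2 : ℝ) := by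
        norm_num
      rw [h5]
      gcongr
    refine (lintegral_mono_ae h1).trans_lt ?_
    rw [lintegral_const_mul' _ _ (ENNReal.rpow_ne_top_of_nonneg (by norm_num) hsf.ne)]
    exact ENNReal.mul_lt_top (ENNReal.rpow_lt_top_of_nonneg (by norm_num) hsf.ne) hN.2
  refine ⟨ae_of_forall_measure_lt_top_ae_restrict _ fun s hs hsf =>
    (hint s hs hsf).prod_right_ae, ?_⟩
  refine ae_eq_of_forall_setIntegral_eq_of_sigmaFinite (fun s hs hsf => ?_) (fun s hs hsf => ?_)
    fun s hs hsf => ?_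
  · exact integrableOn_Lp_of_measure_ne_top _ (by norm_num : (1 : ENNReal) ≤ 2) hsf.ne
  · exact (hint s hs hsf).integral_prod_left
  · rw [integral_integral_swap (hint s hs hsf), ← L2.inner_indicatorConstLp_one (𝕜 := ℂ) hs hsf.ne,
      ← integral_inner hN]
    refine integral_congr_ae ?_
    filter_upwards [hNk] with u hu
    rw [L2.inner_indicatorConstLp_one hs hsf.ne]
    exact integral_congr_ae (ae_restrict_of_ae hu)

/-! ### The Gaussian vectors -/

/-- The trace kernel `N'E₊(x, s)`, set to zero at times `s ≤ 0`. -/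
def causalTrace (x s : ℝ) : ℝ := if 0 < s then traceKernel x s else 0

theorem causalTrace_of_pos {s : ℝ} (hs : 0 < s) (x : ℝ) : causalTrace x s = traceKernel x s :=
  if_pos hs

theorem causalTrace_of_nonpos {s : ℝ} (hs : s ≤ 0) (x : ℝ) : causalTrace x s = 0 :=
  if_neg hs.not_gt

theorem causalTrace_nonneg (x s : ℝ) : 0 ≤ causalTrace x s := by
  unfold causalTrace traceKernel
  split_ifs with h
  · positivity
  · rfl

theorem measurable_causalTrace : Measurable fun p : ℝ × ℝ => causalTrace p.1 p.2 := by
  unfold causalTrace traceKernel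
  refine Measurable.ite (measurableSet_lt measurable_const measurable_snd) ?_ measurable_const
  fun_prop

theorem integral_mul_exp_neg_mul_sq_Ioi {b : ℝ} (hb : 0 < b) :
    ∫ x in Ioi (0 : ℝ), x * Real.exp (-b * x ^ 2) = 1 / (2 * b) := by
  have h := integral_rpow_mul_exp_neg_mul_rpow (p := 2) (q := 1) (b := b) (by norm_num)
    (by norm_num) hb
  norm_num [Real.rpow_neg_one] at h
  simp only [neg_mul]
  rw [h]
  ring

theorem integrableOn_mul_exp_neg_mul_sq_Ioi {b : ℝ} (hb : 0 < b) :
    IntegrableOn (fun x : ℝ => x * Real.exp (-b * x ^ 2)) (Ioi 0) :=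
  (integrable_mul_exp_neg_mul_sq hb).integrableOn

theorem traceKernel_mul_traceKernel {r s x : ℝ} (hr : 0 < r) (hs : 0 < s) (hx : 0 < x) :
    traceKernel x r * traceKernel x s =
      1 / (4 * r * s) * (x * Real.exp (-((r + s) / (4 * r * s)) * x ^ 2)) := by
  unfold traceKernel
  have h1 : Real.exp (-((r + s) / (4 * r * s)) * x ^ 2) =
      Real.exp (-x ^ 2 / (4 * r)) * Real.exp (-x ^ 2 / (4 * s)) := by
    rw [← Real.exp_add]; congr 1; field_simp; ring
  rw [h1]
  have h2 : x = Real.sqrt x * Real.sqrt x := (Real.mul_self_sqrt hx.le).symm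
  rw [show (1 / (4 * r * s) * (x * (Real.exp (-x ^ 2 / (4 * r)) * Real.exp (-x ^ 2 / (4 * s))))) =
    1 / (4 * r * s) * ((Real.sqrt x * Real.sqrt x) *
      (Real.exp (-x ^ 2 / (4 * r)) * Real.exp (-x ^ 2 / (4 * s)))) by rw [← h2]]
  field_simp
  ring

theorem integrable_traceKernel_mul {r s : ℝ} (hr : 0 < r) (hs : 0 < s) :
    Integrable (fun x => traceKernel x r * traceKernel x s) halfLine := by
  have h : IntegrableOn (fun x : ℝ => 1 / (4 * r * s) *
      (x * Real.exp (-((r + s) / (4 * r * s)) * x ^ 2))) (Ioi 0) := (integrableOn_mul_exp_neg_mul_sq_Ioi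
    (b := (r + s) / (4 * r * s)) (by positivity)).const_mul (1 / (4 * r * s))
  exact h.congr_fun (fun x hx => (traceKernel_mul_traceKernel hr hs hx).symm) measurableSet_Ioi

theorem integral_traceKernel_mul {r s : ℝ} (hr : 0 < r) (hs : 0 < s) :
    ∫ x, traceKernel x r * traceKernel x s ∂halfLine = 1 / (2 * (r + s)) := by
  rw [setIntegral_congr_fun measurableSet_Ioi
    (fun x hx => traceKernel_mul_traceKernel hr hs hx), integral_const_mul,
    integral_mul_exp_neg_mul_sq_Ioi (by positivity)]
  field_simp

theorem memLp_traceKernel {s : ℝ} (hs : 0 < s) :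
    MemLp (fun x => (traceKernel x s : ℂ)) 2 halfLine := by
  have hm : Measurable fun x => traceKernel x s := by unfold traceKernel; fun_prop
  have h : MemLp (fun x => traceKernel x s) 2 halfLine := by
    rw [memLp_two_iff_integrable_sq hm.aestronglyMeasurable]
    simpa only [sq] using integrable_traceKernel_mul hs hs
  exact h.ofReal

/-- The trace kernel at time `s` as a vector of `L²(0, ∞)`, zero for `s ≤ 0`. -/
def traceVec (s : ℝ) : L2 := if h : 0 < s then (memLp_traceKernel h).toLp else 0

theorem coeFn_traceVec (s : ℝ) : traceVec s =ᵐ[halfLine] fun x => (causalTrace x s : ℂ) := by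
  unfold traceVec causalTrace
  split_ifs with h
  · exact MemLp.coeFn_toLp _
  · simp only [Complex.ofReal_zero]
    exact Lp.coeFn_zero ℂ 2 halfLine

theorem traceVec_of_nonpos {s : ℝ} (hs : s ≤ 0) : traceVec s = 0 := dif_neg hs.not_gt

theorem inner_traceVec_eq (s : ℝ) (f : L2) :
    inner ℂ (traceVec s) f = ∫ x, (causalTrace x s : ℂ) * f x ∂halfLine := by
  rw [L2.inner_def]
  refine integral_congr_ae ?_
  filter_upwards [coeFn_traceVec s] with x hx
  rw [hx, RCLike.inner_apply, Complex.conj_ofReal, mul_comm]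

theorem inner_traceVec {r s : ℝ} (hr : 0 < r) (hs : 0 < s) :
    inner ℂ (traceVec r) (traceVec s) = ((1 / (2 * (r + s)) : ℝ) : ℂ) := by
  rw [inner_traceVec_eq, ← integral_traceKernel_mul hr hs, ← integral_complex_ofReal]
  refine integral_congr_ae ?_
  filter_upwards [coeFn_traceVec s] with x hx
  rw [hx, causalTrace_of_pos hr, causalTrace_of_pos hs]
  push_cast; rfl

theorem norm_traceVec (s : ℝ) : ‖traceVec s‖ = 1 / (2 * Real.sqrt s) := by
  rcases le_or_gt s 0 with hs | hs
  · simp [traceVec_of_nonpos hs, Real.sqrt_eq_zero_of_nonpos hs]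
  · have h := inner_self_eq_norm_sq_to_K (𝕜 := ℂ) (traceVec s)
    rw [inner_traceVec hs hs] at h
    have h1 : ‖traceVec s‖ ^ 2 = 1 / (2 * (s + s)) := by
      apply Complex.ofReal_injective; rw [h]; simp
    rw [← Real.sqrt_sq (norm_nonneg (traceVec s)), h1, Real.sqrt_div (by norm_num),
      show 2 * (s + s) = 2 ^ 2 * s by ring, Real.sqrt_mul (by norm_num),
      Real.sqrt_sq (by norm_num), Real.sqrt_one]

theorem norm_sub_traceVec_sq {r s : ℝ} (hr : 0 < r) (hs : 0 < s) :
    ‖traceVec r - traceVec s‖ ^ 2 = 1 / (4 * r) + 1 / (4 * s) - 1 / (r + s) := by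
  have h := norm_sub_sq (𝕜 := ℂ) (traceVec r) (traceVec s)
  rw [inner_traceVec hr hs, norm_traceVec, norm_traceVec] at h
  rw [h, div_pow, div_pow, mul_pow, mul_pow, Real.sq_sqrt hr.le, Real.sq_sqrt hs.le]
  simp only [RCLike.re_to_complex, Complex.ofReal_re]
  field_simp
  ring

theorem continuousOn_traceVec : ContinuousOn traceVec (Ioi 0) := by
  intro s hs
  have hs : 0 < s := hs
  refine ContinuousAt.continuousWithinAt ?_
  rw [ContinuousAt, tendsto_iff_norm_sub_tendsto_zero]
  have h1 : Tendsto (fun r => Real.sqrt (1 / (4 * r) + 1 / (4 * s) - 1 / (r + s))) (𝓝 s)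
      (𝓝 (Real.sqrt (1 / (4 * s) + 1 / (4 * s) - 1 / (s + s)))) := by
    have : ContinuousAt (fun r => Real.sqrt (1 / (4 * r) + 1 / (4 * s) - 1 / (r + s))) s := by
      have h2 : 4 * s ≠ 0 := by positivity
      have h3 : s + s ≠ 0 := by positivity
      fun_prop (disch := assumption)
    exact this
  rw [show 1 / (4 * s) + 1 / (4 * s) - 1 / (s + s) = 0 by field_simp; ring, Real.sqrt_zero] at h1
  refine h1.congr' ?_
  filter_upwards [lt_mem_nhds hs] with r hr
  rw [← norm_sub_traceVec_sq hr hs, Real.sqrt_sq (norm_nonneg _)]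

theorem aestronglyMeasurable_traceVec : AEStronglyMeasurable traceVec volume := by
  have h1 : traceVec = (Ioi 0).indicator traceVec := by
    funext s
    by_cases hs : 0 < s
    · rw [indicator_of_mem (show s ∈ Ioi 0 from hs)]
    · rw [indicator_of_notMem (show s ∉ Ioi 0 from hs), traceVec_of_nonpos (not_lt.1 hs)]
  rw [h1]
  exact (aestronglyMeasurable_indicator_iff measurableSet_Ioi).2
    (continuousOn_traceVec.aestronglyMeasurable measurableSet_Ioi)

/-- The Gaussian vectors are total: in the variable `x²` this is the injectivity of the Laplace
transform. -/
theorem eq_zero_of_inner_traceVec {f : L2} (h : ∀ s, 0 < s → inner ℂ (traceVec s) f = 0) :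
    f = 0 := by
  -- times `s = 1 / (4 (n + 1))` give the weights `√x e^{-x²} (e^{-x²})ⁿ`
  set F : ℝ → ℂ := fun x => (Real.sqrt x * Real.exp (-x ^ 2) : ℝ) * f x with hF
  have hrep : ∀ n : ℕ, ∀ x, F x * ((Real.exp (-(fun y : ℝ => y ^ 2) x) ^ n : ℝ) : ℂ) =
      (1 / (2 * (n + 1) : ℝ) : ℝ) * ((causalTrace x (1 / (4 * (n + 1))) : ℂ) * f x) := by
    intro n x
    have hn : (0 : ℝ) < 1 / (4 * (n + 1)) := by positivity
    rw [causalTrace_of_pos hn]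
    simp only [hF, traceKernel]
    rw [mul_right_comm, ← mul_assoc, ← Complex.ofReal_mul, ← Complex.ofReal_mul]
    congr 2
    rw [← Real.exp_nat_mul, mul_assoc, ← Real.exp_add]
    have e : -x ^ 2 / (4 * (1 / (4 * ((n : ℝ) + 1)))) = -x ^ 2 + n * -x ^ 2 := by
      field_simp; ring
    rw [e]
    field_simp
    ring
  have hint : ∀ s, Integrable (fun x => (causalTrace x s : ℂ) * f x) halfLine := by
    intro s
    refine (L2.integrable_inner (𝕜 := ℂ) (traceVec s) f).congr ?_
    filter_upwards [coeFn_traceVec s] with x hx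
    rw [hx, RCLike.inner_apply, Complex.conj_ofReal, mul_comm]
  have h0 := ae_eq_zero_of_integral_exp_eq_zero (F := F) (τ := fun x => x ^ 2) (ρ := Real.sqrt)
    (by fun_prop) (fun x hx => by positivity) Real.continuous_sqrt
    (fun x hx => Real.sqrt_sq hx.le) Real.tendsto_sqrt_atTop (by simp) (by
      have := (hint (1 / (4 * ((0 : ℕ) + 1)))).const_mul ((1 / (2 * ((0 : ℕ) + 1) : ℝ) : ℝ) : ℂ)
      refine this.congr (ae_of_all _ fun x => ?_)
      simp only
      rw [← hrep 0 x]; simp) (fun n => by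
      simp_rw [hrep n]
      rw [integral_const_mul, ← inner_traceVec_eq, h _ (by positivity), mul_zero])
  rw [Lp.eq_zero_iff_ae_eq_zero]
  filter_upwards [h0, ae_restrict_mem measurableSet_Ioi] with x hx hx0
  have hx0 : 0 < x := hx0
  simp only [hF, Pi.zero_apply, mul_eq_zero, Complex.ofReal_eq_zero] at hx
  refine hx.resolve_left ?_
  have := Real.sqrt_pos.2 hx0
  have := Real.exp_pos (-x ^ 2)
  rintro (h | h) <;> linarith

/-- A closed subspace containing all Gaussian vectors is everything. -/
theorem mem_of_traceVec_mem {V : Submodule ℂ L2} (hV : IsClosed (V : Set L2))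
    (h : ∀ s, 0 < s → traceVec s ∈ V) (f : L2) : f ∈ V := by
  have : CompleteSpace V := hV.completeSpace_coe
  have : Vᗮ = ⊥ := by
    rw [eq_bot_iff]
    intro g hg
    exact eq_zero_of_inner_traceVec fun s hs => (Submodule.mem_orthogonal V g).1 hg _ (h s hs)
  rw [(Submodule.orthogonal_eq_bot_iff).1 this]
  exact Submodule.mem_top

/-! ### The Friedrichs heat kernel -/

theorem besselI0_term_le {R z : ℝ} (hz : |z| ≤ R) (k : ℕ) :
    ‖(z / 2) ^ (2 * k) / (k.factorial : ℝ) ^ 2‖ ≤ ((R / 2) ^ 2) ^ k / k.factorial := by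
  have h1 : (1 : ℝ) ≤ k.factorial := by exact_mod_cast k.factorial_pos
  have h2 : ‖z / 2‖ ≤ R / 2 := by
    rw [norm_div, Real.norm_eq_abs]; norm_num; linarith
  rw [norm_div, norm_pow, pow_mul, norm_pow, Real.norm_natCast]
  gcongr
  exact le_self_pow₀ h1 (by norm_num)

theorem continuous_besselI0 : Continuous besselI0 := by
  rw [continuous_iff_continuousAt]
  intro z
  have h1 : ContinuousOn besselI0 (Icc (-(|z| + 1)) (|z| + 1)) :=
    continuousOn_tsum (fun k => by fun_prop)
      (Real.summable_pow_div_factorial (((|z| + 1) / 2) ^ 2))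
      fun k y hy => besselI0_term_le (abs_le.2 hy) k
  refine h1.continuousAt (Icc_mem_nhds ?_ ?_)
  · have := neg_abs_le z; linarith
  · have := le_abs_self z; linarith

theorem besselI0_zero : besselI0 0 = 1 := by
  unfold besselI0
  rw [tsum_eq_single 0]
  · simp
  · intro k hk
    simp [hk]

theorem besselI0_nonneg (z : ℝ) : 0 ≤ besselI0 z :=
  tsum_nonneg fun k => by rw [pow_mul]; positivity

theorem friedrichsKernel_nonneg {t : ℝ} (ht : 0 < t) (x y : ℝ) : 0 ≤ friedrichsKernel x y t := by
  have := besselI0_nonneg (x * y / (2 * t))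
  unfold friedrichsKernel
  positivity

theorem friedrichsKernel_symm (x y t : ℝ) : friedrichsKernel x y t = friedrichsKernel y x t := by
  unfold friedrichsKernel
  rw [mul_comm x y, add_comm (x ^ 2)]

theorem continuous_friedrichsKernel (t : ℝ) :
    Continuous fun p : ℝ × ℝ => friedrichsKernel p.1 p.2 t := by
  have := continuous_besselI0
  unfold friedrichsKernel
  fun_prop

theorem tendsto_friedrichsKernel {x t : ℝ} (hx : 0 < x) (ht : 0 < t) :
    Tendsto (fun y : ℝ => y ^ (-(1 / 2) : ℝ) * friedrichsKernel x y t)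
      (𝓝[>] 0) (𝓝 (traceKernel x t)) := by
  have h1 : Continuous fun y => Real.sqrt x / (2 * t) * besselI0 (x * y / (2 * t)) *
      Real.exp (-(x ^ 2 + y ^ 2) / (4 * t)) := by
    have := continuous_besselI0
    fun_prop
  have h2 := (h1.tendsto 0).mono_left (nhdsWithin_le_nhds (s := Ioi 0))
  simp only [mul_zero, zero_div, besselI0_zero, mul_one, ne_eq, OfNat.ofNat_ne_zero,
    not_false_eq_true, zero_pow, add_zero] at h2
  refine h2.congr' ?_
  filter_upwards [self_mem_nhdsWithin] with y hy
  have hy : 0 < y := hy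
  unfold friedrichsKernel
  rw [Real.sqrt_mul hx.le, Real.rpow_neg hy.le, ← Real.sqrt_eq_rpow]
  have := Real.sqrt_pos.2 hy
  field_simp

theorem integral_pow_mul_exp_neg_mul_sq {b : ℝ} (hb : 0 < b) (k : ℕ) :
    ∫ y in Ioi (0 : ℝ), y ^ (2 * k + 1) * Real.exp (-b * y ^ 2) =
      k.factorial / (2 * b ^ (k + 1)) := by
  have h := integral_rpow_mul_exp_neg_mul_rpow (p := 2) (q := 2 * k + 1) (b := b) (by norm_num)
    (by have : (0 : ℝ) ≤ k := Nat.cast_nonneg k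
        linarith) hb
  rw [show ((2 : ℝ) * k + 1 + 1) / 2 = k + 1 by ring, Real.Gamma_nat_eq_factorial,
    show -((2 : ℝ) * k + 1 + 1) / 2 = -((k + 1 : ℕ) : ℝ) by push_cast; ring,
    Real.rpow_neg hb.le, Real.rpow_natCast] at h
  have e : ∀ y : ℝ, y ^ ((2 : ℝ) * k + 1) = y ^ (2 * k + 1) := fun y => by
    rw [← Real.rpow_natCast]; push_cast; rfl
  simp only [e, Real.rpow_two] at h
  rw [h]
  field_simp

/-- The Friedrichs heat kernel maps Gaussians to Gaussians; `a = 0` is conservation of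
`√x`. Integrated term by term, the series of `I₀` becomes an exponential series. -/
theorem integral_friedrichsKernel_mul {a x t : ℝ} (ha : 0 ≤ a) (hx : 0 < x) (ht : 0 < t) :
    ∫ y, friedrichsKernel x y t * (Real.sqrt y * Real.exp (-a * y ^ 2)) ∂halfLine =
      Real.sqrt x / (1 + 4 * a * t) * Real.exp (-(a / (1 + 4 * a * t)) * x ^ 2) := by
  set p : ℝ := a + 1 / (4 * t) with hp
  have hp0 : 0 < p := by positivity
  set F : ℕ → ℝ → ℝ := fun k y => Real.sqrt x / (2 * t) * Real.exp (-x ^ 2 / (4 * t)) *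
    ((x / (4 * t)) ^ (2 * k) / (k.factorial : ℝ) ^ 2) *
      (y ^ (2 * k + 1) * Real.exp (-p * y ^ 2)) with hF
  have hFint : ∀ k, ∫ y in Ioi (0 : ℝ), F k y = Real.sqrt x / (2 * t) *
      Real.exp (-x ^ 2 / (4 * t)) * (1 / (2 * p)) *
        ((x ^ 2 / (16 * t ^ 2 * p)) ^ k / k.factorial) := by
    intro k
    simp only [hF]
    rw [integral_const_mul, integral_pow_mul_exp_neg_mul_sq hp0]
    have : (k.factorial : ℝ) ≠ 0 := by exact_mod_cast k.factorial_ne_zero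
    rw [pow_mul, div_pow, div_pow, div_pow, mul_pow, mul_pow, pow_succ]
    field_simp
    rw [show t ^ 2 * p * 16 = (16 * t ^ 2) * p by ring, mul_pow (16 * t ^ 2) p]
    ring
  have hpos : ∀ k, ∀ y ∈ Ioi (0 : ℝ), 0 ≤ F k y := by
    intro k y hy
    have : 0 < y := hy
    simp only [hF]
    rw [pow_mul (x / (4 * t))]
    positivity
  have hFi : ∀ k, IntegrableOn (F k) (Ioi 0) := by
    intro k
    refine Integrable.of_integral_ne_zero ?_
    rw [hFint k]
    positivity
  have hs := hasSum_integral_of_summable_integral_norm (μ := halfLine) hFi (by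
    have : ∀ k, ∫ y in Ioi (0 : ℝ), ‖F k y‖ = ∫ y in Ioi (0 : ℝ), F k y := fun k =>
      setIntegral_congr_fun measurableSet_Ioi fun y hy =>
        (Real.norm_of_nonneg (hpos k y hy))
    simp_rw [this, hFint]
    exact (Real.summable_pow_div_factorial _).mul_left _)
  have hval : ∑' k, ∫ y in Ioi (0 : ℝ), F k y =
      Real.sqrt x / (1 + 4 * a * t) * Real.exp (-(a / (1 + 4 * a * t)) * x ^ 2) := by
    simp_rw [hFint]
    have e1 : ∑' k : ℕ, (x ^ 2 / (16 * t ^ 2 * p)) ^ k / k.factorial =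
        Real.exp (x ^ 2 / (16 * t ^ 2 * p)) := by
      rw [Real.exp_eq_exp_ℝ, NormedSpace.exp_eq_tsum_div]
    have e2 : -(a / (1 + 4 * a * t)) * x ^ 2 =
        -x ^ 2 / (4 * t) + x ^ 2 / (16 * t ^ 2 * p) := by
      have : p = (1 + 4 * a * t) / (4 * t) := by rw [hp]; field_simp; ring
      rw [this]; field_simp; ring
    have e3 : (1 : ℝ) / (2 * p) = 2 * t / (1 + 4 * a * t) := by
      rw [hp]; field_simp; ring
    rw [tsum_mul_left, e1, e2, e3, Real.exp_add]
    field_simp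
  rw [← hval, hs.tsum_eq]
  refine setIntegral_congr_fun measurableSet_Ioi fun y hy => ?_
  have hy : 0 < y := hy
  simp only [hF]
  have e : ∀ k : ℕ, Real.sqrt x / (2 * t) * Real.exp (-x ^ 2 / (4 * t)) *
    ((x / (4 * t)) ^ (2 * k) / (k.factorial : ℝ) ^ 2) *
      (y ^ (2 * k + 1) * Real.exp (-p * y ^ 2)) =
      (Real.sqrt x / (2 * t) * Real.exp (-x ^ 2 / (4 * t)) * (y * Real.exp (-p * y ^ 2))) *
        ((x * y / (2 * t) / 2) ^ (2 * k) / (k.factorial : ℝ) ^ 2) := by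
    intro k
    rw [show x * y / (2 * t) / 2 = x / (4 * t) * y by field_simp; norm_num, mul_pow, pow_succ]
    ring
  simp_rw [e]
  rw [tsum_mul_left]
  unfold friedrichsKernel
  rw [← besselI0, Real.sqrt_mul hx.le]
  have e2 : Real.exp (-(x ^ 2 + y ^ 2) / (4 * t)) * Real.exp (-a * y ^ 2) =
      Real.exp (-x ^ 2 / (4 * t)) * Real.exp (-p * y ^ 2) := by
    rw [← Real.exp_add, ← Real.exp_add]; congr 1; rw [hp]; field_simp; ring
  have e3 : Real.sqrt y * Real.sqrt y = y := Real.mul_self_sqrt hy.le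
  linear_combination (Real.sqrt x * (Real.sqrt y * Real.sqrt y) / (2 * t) *
    besselI0 (x * y / (2 * t))) * e2 + (Real.sqrt x / (2 * t) * besselI0 (x * y / (2 * t)) *
      Real.exp (-x ^ 2 / (4 * t)) * Real.exp (-p * y ^ 2)) * e3

theorem integrable_friedrichsKernel_mul {a x t : ℝ} (ha : 0 ≤ a) (hx : 0 < x) (ht : 0 < t) :
    Integrable (fun y => friedrichsKernel x y t * (Real.sqrt y * Real.exp (-a * y ^ 2)))
      halfLine := by
  refine Integrable.of_integral_ne_zero ?_
  rw [integral_friedrichsKernel_mul ha hx ht]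
  have := Real.sqrt_pos.2 hx
  positivity

theorem lintegral_friedrichsKernel_mul_sqrt {x t : ℝ} (hx : 0 < x) (ht : 0 < t) :
    ∫⁻ y, ENNReal.ofReal (friedrichsKernel x y t) * ENNReal.ofReal (Real.sqrt y) ∂halfLine =
      ENNReal.ofReal (Real.sqrt x) := by
  have h1 := integral_friedrichsKernel_mul le_rfl hx ht
  have h2 := integrable_friedrichsKernel_mul le_rfl hx ht
  simp only [neg_zero, zero_mul, Real.exp_zero, mul_one, mul_zero, add_zero, div_one] at h1 h2
  rw [← h1, ofReal_integral_eq_lintegral_ofReal h2 (ae_of_all _ fun y =>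
    mul_nonneg (friedrichsKernel_nonneg ht x y) (Real.sqrt_nonneg y))]
  simp_rw [ENNReal.ofReal_mul (friedrichsKernel_nonneg ht x _)]

/-- Schur's test for the Friedrichs heat kernel, with the conserved weight `√x`. -/
theorem lintegral_friedrichsKernel_sq_le {t : ℝ} (ht : 0 < t) {u : ℝ → ENNReal}
    (hu : Measurable u) :
    ∫⁻ x, (∫⁻ y, ENNReal.ofReal (friedrichsKernel x y t) * u y ∂halfLine) ^ 2 ∂halfLine ≤
      ∫⁻ y, u y ^ 2 ∂halfLine := by
  set k : ℝ → ℝ → ENNReal := fun x y => ENNReal.ofReal (friedrichsKernel x y t) with hk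
  set w : ℝ → ENNReal := fun y => ENNReal.ofReal (Real.sqrt y) with hw
  have hkm : Measurable fun p : ℝ × ℝ => k p.1 p.2 :=
    ENNReal.measurable_ofReal.comp (continuous_friedrichsKernel t).measurable
  have hwm : Measurable w := by fun_prop
  have hw0 : ∀ y ∈ Ioi (0 : ℝ), w y ≠ 0 := fun y hy => by
    simpa [hw] using Real.sqrt_pos.2 hy
  have hwt : ∀ y, w y ≠ ⊤ := fun y => ENNReal.ofReal_ne_top
  have h1 : ∀ x ∈ Ioi (0 : ℝ), (∫⁻ y, k x y * u y ∂halfLine) ^ 2 ≤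
      w x * ∫⁻ y, k x y * (u y ^ 2 * (w y)⁻¹) ∂halfLine := by
    intro x hx
    have hkx : Measurable (k x) := hkm.comp measurable_prodMk_left
    have h2 := ENNReal.lintegral_mul_le_Lp_mul_Lq halfLine Real.HolderConjugate.two_two
      (f := fun y => (k x y * w y) ^ (1 / 2 : ℝ))
      (g := fun y => (k x y * (u y ^ 2 * (w y)⁻¹)) ^ (1 / 2 : ℝ))
      ((hkx.mul hwm).pow_const _).aemeasurable
      (by fun_prop)
    have h3 : ∫⁻ y, k x y * u y ∂halfLine = ∫⁻ y, ((fun y => (k x y * w y) ^ (1 / 2 : ℝ)) *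
        fun y => (k x y * (u y ^ 2 * (w y)⁻¹)) ^ (1 / 2 : ℝ)) y ∂halfLine := by
      refine setLIntegral_congr_fun measurableSet_Ioi fun y hy => ?_
      simp only [Pi.mul_apply]
      rw [← ENNReal.mul_rpow_of_nonneg _ _ (by norm_num)]
      have : k x y * w y * (k x y * (u y ^ 2 * (w y)⁻¹)) = (k x y * u y) ^ (2 : ℝ) := by
        rw [ENNReal.rpow_two]
        calc _ = (k x y * u y) ^ 2 * (w y * (w y)⁻¹) := by ring
          _ = _ := by rw [ENNReal.mul_inv_cancel (hw0 y hy) (hwt y), mul_one]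
      rw [this, ← ENNReal.rpow_mul]
      norm_num
    rw [← h3] at h2
    simp only [← ENNReal.rpow_mul] at h2
    norm_num at h2
    rw [lintegral_friedrichsKernel_mul_sqrt hx ht] at h2
    calc _ ≤ (w x ^ (1 / 2 : ℝ) *
          (∫⁻ y, k x y * (u y ^ 2 * (w y)⁻¹) ∂halfLine) ^ (1 / 2 : ℝ)) ^ 2 := by gcongr
      _ = _ := by
        rw [← ENNReal.mul_rpow_of_nonneg _ _ (by norm_num), ← ENNReal.rpow_two,
          ← ENNReal.rpow_mul]
        norm_num
  calc _ ≤ ∫⁻ x, w x * ∫⁻ y, k x y * (u y ^ 2 * (w y)⁻¹) ∂halfLine ∂halfLine :=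
        setLIntegral_mono' measurableSet_Ioi h1
    _ = ∫⁻ x, ∫⁻ y, w x * (k x y * (u y ^ 2 * (w y)⁻¹)) ∂halfLine ∂halfLine := by
        refine lintegral_congr fun x => (lintegral_const_mul' _ _ (hwt x)).symm
    _ = ∫⁻ y, ∫⁻ x, w x * (k x y * (u y ^ 2 * (w y)⁻¹)) ∂halfLine ∂halfLine := by
        refine lintegral_lintegral_swap (Measurable.aemeasurable ?_)
        exact (hwm.comp measurable_fst).mul (hkm.mul (((hu.pow_const 2).mul hwm.inv).comp
          measurable_snd))
    _ = ∫⁻ y, u y ^ 2 ∂halfLine := by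
        refine setLIntegral_congr_fun measurableSet_Ioi fun y hy => ?_
        have e : ∀ x, w x * (k x y * (u y ^ 2 * (w y)⁻¹)) =
            (k y x * w x) * (u y ^ 2 * (w y)⁻¹) := by
          intro x
          simp only [hk]
          rw [friedrichsKernel_symm x y]; ring
        simp_rw [e]
        have hky : Measurable fun x => k y x * w x := (hkm.comp measurable_prodMk_left).mul hwm
        rw [lintegral_mul_const _ hky, lintegral_friedrichsKernel_mul_sqrt hy ht]
        calc _ = u y ^ 2 * (w y * (w y)⁻¹) := by ring
          _ = _ := by rw [ENNReal.mul_inv_cancel (hw0 y hy) (hwt y), mul_one]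

/-- `E₊(·, ·, t)` is the kernel of a contraction of `L²(0, ∞)`. -/
theorem exists_friedrichsOp {t : ℝ} (ht : 0 < t) :
    ∃ T : L2 →L[ℂ] L2, ‖T‖ ≤ 1 ∧ ∀ f : L2, ∀ᵐ x ∂halfLine,
      Integrable (fun y => (friedrichsKernel x y t : ℂ) * f y) halfLine ∧
        T f x = ∫ y, (friedrichsKernel x y t : ℂ) * f y ∂halfLine := by
  have hkm : StronglyMeasurable fun p : ℝ × ℝ => (friedrichsKernel p.1 p.2 t : ℂ) :=
    (Complex.continuous_ofReal.comp (continuous_friedrichsKernel t)).stronglyMeasurable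
  have hm : ∀ f : L2, StronglyMeasurable
      (fun p : ℝ × ℝ => (friedrichsKernel p.1 p.2 t : ℂ) * f p.2) := fun f =>
    hkm.mul ((Lp.stronglyMeasurable f).comp_measurable measurable_snd)
  have hen : ∀ (f : L2) (x y : ℝ), ‖(friedrichsKernel x y t : ℂ) * f y‖ₑ =
      ENNReal.ofReal (friedrichsKernel x y t) * ‖f y‖ₑ := by
    intro f x y
    rw [enorm_mul, ← ofReal_norm (friedrichsKernel x y t : ℂ), Complex.norm_real,
      Real.norm_of_nonneg (friedrichsKernel_nonneg ht x y)]
  have hnorm : ∀ f : L2, ∫⁻ y, ‖f y‖ₑ ^ 2 ∂halfLine = ‖f‖ₑ ^ 2 := by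
    intro f
    rw [Lp.enorm_def, eLpNorm_eq_lintegral_rpow_enorm_toReal (by norm_num) (by norm_num),
      ← ENNReal.rpow_two, ← ENNReal.rpow_mul]
    simp
  have hS : ∀ f : L2, ∫⁻ x, (∫⁻ y, ‖(friedrichsKernel x y t : ℂ) * f y‖ₑ ∂halfLine) ^ 2
      ∂halfLine ≤ ‖f‖ₑ ^ 2 := by
    intro f
    simp_rw [hen, ← hnorm]
    exact lintegral_friedrichsKernel_sq_le ht (Lp.stronglyMeasurable f).measurable.enorm
  have hint : ∀ f : L2, ∀ᵐ x ∂halfLine,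
      Integrable (fun y => (friedrichsKernel x y t : ℂ) * f y) halfLine := by
    intro f
    have h1 := ae_lt_top' (μ := halfLine)
      (f := fun x => (∫⁻ y, ‖(friedrichsKernel x y t : ℂ) * f y‖ₑ ∂halfLine) ^ 2)
      (((hm f).enorm.lintegral_prod_right').pow_const 2).aemeasurable
      ((hS f).trans_lt (by simp)).ne
    filter_upwards [h1] with x hx
    refine ⟨((hm f).comp_measurable measurable_prodMk_left).aestronglyMeasurable, ?_⟩
    rw [HasFiniteIntegral]
    by_contra h
    rw [not_lt, top_le_iff] at h
    rw [h] at hx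
    simp at hx
  have hFm : ∀ f : L2, StronglyMeasurable
      fun x => ∫ y, (friedrichsKernel x y t : ℂ) * f y ∂halfLine := fun f =>
    (hm f).integral_prod_right'
  have hFn : ∀ f : L2, eLpNorm (fun x => ∫ y, (friedrichsKernel x y t : ℂ) * f y ∂halfLine) 2
      halfLine ≤ ‖f‖ₑ := by
    intro f
    rw [eLpNorm_eq_lintegral_rpow_enorm_toReal (by norm_num) (by norm_num)]
    simp only [ENNReal.toReal_ofNat, ENNReal.rpow_two]
    have h1 : ∫⁻ x, ‖∫ y, (friedrichsKernel x y t : ℂ) * f y ∂halfLine‖ₑ ^ 2 ∂halfLine ≤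
        ‖f‖ₑ ^ 2 := by
      refine (lintegral_mono fun x => ?_).trans (hS f)
      gcongr
      exact enorm_integral_le_lintegral_enorm _
    calc _ ≤ (‖f‖ₑ ^ 2) ^ (1 / 2 : ℝ) := by gcongr
      _ = _ := by rw [← ENNReal.rpow_two, ← ENNReal.rpow_mul]; norm_num
  have hF : ∀ f : L2, MemLp (fun x => ∫ y, (friedrichsKernel x y t : ℂ) * f y ∂halfLine) 2
      halfLine := fun f => ⟨(hFm f).aestronglyMeasurable, (hFn f).trans_lt (by simp)⟩
  refine ⟨LinearMap.mkContinuous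
    { toFun := fun f => (hF f).toLp
      map_add' := fun f g => ?_
      map_smul' := fun c f => ?_ } 1 fun f => ?_, ?_, fun f => ?_⟩
  · rw [← MemLp.toLp_add, MemLp.toLp_eq_toLp_iff]
    filter_upwards [hint f, hint g] with x hfx hgx
    rw [Pi.add_apply, ← integral_add hfx hgx]
    refine integral_congr_ae ?_
    filter_upwards [Lp.coeFn_add f g] with y hy
    rw [hy, Pi.add_apply, mul_add]
  · rw [RingHom.id_apply, ← MemLp.toLp_const_smul, MemLp.toLp_eq_toLp_iff]
    refine ae_of_all _ fun x => ?_
    rw [Pi.smul_apply, ← integral_smul]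
    refine integral_congr_ae ?_
    filter_upwards [Lp.coeFn_smul c f] with y hy
    rw [hy, Pi.smul_apply, smul_eq_mul, smul_eq_mul]; ring
  · rw [one_mul, LinearMap.coe_mk, AddHom.coe_mk, Lp.norm_toLp]
    exact ENNReal.toReal_le_of_le_ofReal (norm_nonneg _) (by
      rw [ofReal_norm]; exact hFn f)
  · exact LinearMap.mkContinuous_norm_le _ zero_le_one _
  · filter_upwards [hint f, (hF f).coeFn_toLp] with x h1 h2
    exact ⟨h1, h2⟩

/-- The operator on `L²(0, ∞)` with kernel `E₊(x, y, t)`, and the identity for `t ≤ 0`. -/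
def friedrichsOp (t : ℝ) : L2 →L[ℂ] L2 :=
  if ht : 0 < t then (exists_friedrichsOp ht).choose else ContinuousLinearMap.id ℂ L2

theorem friedrichsOp_of_nonpos {t : ℝ} (ht : t ≤ 0) :
    friedrichsOp t = ContinuousLinearMap.id ℂ L2 := dif_neg ht.not_gt

theorem norm_friedrichsOp_le (t : ℝ) : ‖friedrichsOp t‖ ≤ 1 := by
  unfold friedrichsOp
  split_ifs with ht
  · exact (exists_friedrichsOp ht).choose_spec.1
  · exact ContinuousLinearMap.norm_id_le

theorem friedrichsOp_ae {t : ℝ} (ht : 0 < t) (f : L2) : ∀ᵐ x ∂halfLine,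
    Integrable (fun y => (friedrichsKernel x y t : ℂ) * f y) halfLine ∧
      friedrichsOp t f x = ∫ y, (friedrichsKernel x y t : ℂ) * f y ∂halfLine := by
  unfold friedrichsOp
  rw [dif_pos ht]
  exact (exists_friedrichsOp ht).choose_spec.2 f

/-- The trace kernels are carried into each other by the Friedrichs semigroup. -/
theorem friedrichsOp_traceVec {s t : ℝ} (hs : 0 < s) (ht : 0 ≤ t) :
    friedrichsOp t (traceVec s) = traceVec (s + t) := by
  rcases ht.eq_or_lt with rfl | ht
  · rw [friedrichsOp_of_nonpos le_rfl, add_zero]; rfl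
  refine Lp.ext ?_
  filter_upwards [friedrichsOp_ae ht (traceVec s), coeFn_traceVec (s + t),
    ae_restrict_mem measurableSet_Ioi] with x h1 h2 hx
  have hx : 0 < x := hx
  rw [h1.2, h2, causalTrace_of_pos (add_pos hs ht)]
  have h3 := integral_friedrichsKernel_mul (a := 1 / (4 * s)) (by positivity) hx ht
  have h4 : ∫ y, (friedrichsKernel x y t : ℂ) * traceVec s y ∂halfLine =
      ((1 / (2 * s) * ∫ y, friedrichsKernel x y t *
        (Real.sqrt y * Real.exp (-(1 / (4 * s)) * y ^ 2)) ∂halfLine : ℝ) : ℂ) := by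
    rw [← integral_const_mul, ← integral_complex_ofReal]
    refine integral_congr_ae ?_
    filter_upwards [coeFn_traceVec s] with y hy
    rw [hy, causalTrace_of_pos hs, ← Complex.ofReal_mul]
    congr 1
    unfold traceKernel
    rw [show -y ^ 2 / (4 * s) = -(1 / (4 * s)) * y ^ 2 by field_simp]
    field_simp
  rw [h4, h3]
  congr 1
  unfold traceKernel
  have e1 : 1 + 4 * (1 / (4 * s)) * t = (s + t) / s := by field_simp
  rw [e1, show -(1 / (4 * s) / ((s + t) / s)) * x ^ 2 = -x ^ 2 / (4 * (s + t)) by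
    field_simp]
  field_simp

/-- Strong continuity of a bounded family of operators can be tested on Gaussian vectors. -/
theorem continuousOn_of_traceVec {T : ℝ → L2 →L[ℂ] L2} {S : Set ℝ} {C : ℝ}
    (hb : ∀ t ∈ S, ‖T t‖ ≤ C)
    (h : ∀ s, 0 < s → ContinuousOn (fun t => T t (traceVec s)) S) (f : L2) :
    ContinuousOn (fun t => T t f) S := by
  let V : Submodule ℂ L2 :=
    { carrier := {f | ContinuousOn (fun t => T t f) S}
      zero_mem' := by simpa using continuousOn_const
      add_mem' := fun {f g} hf hg => by
        show ContinuousOn (fun t => T t (f + g)) S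
        simp_rw [map_add]
        exact ContinuousOn.add hf hg
      smul_mem' := fun c f hf => by
        show ContinuousOn (fun t => T t (c • f)) S
        simp_rw [map_smul]
        exact ContinuousOn.const_smul hf c }
  refine mem_of_traceVec_mem (V := V) ?_ h f
  refine isClosed_of_closure_subset fun g hg => ?_
  refine continuousOn_of_uniform_approx_of_continuousOn fun u hu => ?_
  obtain ⟨ε, hε, hu⟩ := Metric.mem_uniformity_dist.1 hu
  obtain ⟨g', hg', hd⟩ := Metric.mem_closure_iff.1 hg (ε / (|C| + 1)) (by positivity)
  refine ⟨fun t => T t g', hg', fun t ht => hu ?_⟩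
  rw [dist_eq_norm, ← map_sub]
  rw [dist_eq_norm, lt_div_iff₀ (by positivity)] at hd
  have h1 := (T t).le_opNorm (g - g')
  have h2 := hb t ht
  have h3 := le_abs_self C
  nlinarith [norm_nonneg (g - g')]

theorem continuousOn_friedrichsOp (f : L2) : ContinuousOn (fun t => friedrichsOp t f) (Ici 0) := by
  refine continuousOn_of_traceVec (C := 1) (fun t _ => norm_friedrichsOp_le t) (fun s hs => ?_) f
  refine (continuousOn_traceVec.comp (f := fun t => s + t) (s := Ici 0) (by fun_prop)
    fun t ht => add_pos_of_pos_of_nonneg hs ht).congr fun t ht => ?_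
  exact friedrichsOp_traceVec hs ht

/-! ### The correction to the Friedrichs semigroup -/

/-- The product of the norms of `N'E₊(·, 1 - u)` and `N'E₊(·, u)`. It vanishes outside `(0, 1)`, as
one of the square roots does, and by scaling its integral bounds `∫₀^τ ‖N'E₊(·, τ - s)‖
‖N'E₊(·, s)‖ ds` for every `τ`. -/
def pairWeight (u : ℝ) : ℝ := 1 / (2 * Real.sqrt (1 - u)) * (1 / (2 * Real.sqrt u))

theorem pairWeight_nonneg (u : ℝ) : 0 ≤ pairWeight u := by unfold pairWeight; positivity

theorem integral_pairWeight_nonneg : 0 ≤ ∫ u, pairWeight u := integral_nonneg pairWeight_nonneg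

theorem integrable_pairWeight : Integrable pairWeight := by
  have h1 : IntervalIntegrable (fun u : ℝ => u ^ (-(1 / 2) : ℝ)) volume 0 1 :=
    intervalIntegral.intervalIntegrable_rpow' (by norm_num)
  have h2 : IntervalIntegrable (fun u : ℝ => (1 - u) ^ (-(1 / 2) : ℝ)) volume 0 1 := by
    have := (h1.comp_sub_left 1).symm
    simpa using this
  have h3 : IntegrableOn (fun u : ℝ => u ^ (-(1 / 2) : ℝ) + (1 - u) ^ (-(1 / 2) : ℝ)) (Ioc 0 1) :=
    (intervalIntegrable_iff_integrableOn_Ioc_of_le zero_le_one).1 (h1.add h2)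
  have hm : Measurable pairWeight := by unfold pairWeight; fun_prop
  have h4 : IntegrableOn pairWeight (Ioo 0 1) := by
    refine Integrable.mono' (h3.mono_set Ioo_subset_Ioc_self) hm.aestronglyMeasurable ?_
    refine (ae_restrict_mem measurableSet_Ioo).mono fun u hu => ?_
    rw [Real.norm_of_nonneg (pairWeight_nonneg u)]
    have hu1 : 0 < u := hu.1
    have hu2 : 0 < 1 - u := by linarith [hu.2]
    rw [Real.rpow_neg hu1.le, Real.rpow_neg hu2.le, ← Real.sqrt_eq_rpow, ← Real.sqrt_eq_rpow]
    have p1 := Real.sqrt_pos.2 hu1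
    have p2 := Real.sqrt_pos.2 hu2
    have q1 := Real.sq_sqrt hu1.le
    have q2 := Real.sq_sqrt hu2.le
    unfold pairWeight
    rw [← sub_nonneg]
    have : (Real.sqrt u)⁻¹ + (Real.sqrt (1 - u))⁻¹ -
        1 / (2 * Real.sqrt (1 - u)) * (1 / (2 * Real.sqrt u)) =
        (Real.sqrt u + Real.sqrt (1 - u) - 1 / 4) / (Real.sqrt u * Real.sqrt (1 - u)) := by
      field_simp; ring
    rw [this]
    refine div_nonneg ?_ (by positivity)
    nlinarith [mul_pos p1 p2]
  have h5 : pairWeight = (Ioo 0 1).indicator pairWeight := by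
    funext u
    by_cases hu : u ∈ Ioo (0 : ℝ) 1
    · rw [indicator_of_mem hu]
    · rw [indicator_of_notMem hu]
      unfold pairWeight
      rw [mem_Ioo, not_and_or, not_lt, not_lt] at hu
      rcases hu with hu | hu
      · rw [Real.sqrt_eq_zero_of_nonpos hu]; simp
      · rw [Real.sqrt_eq_zero_of_nonpos (by linarith : 1 - u ≤ 0)]; simp
  rw [h5, integrable_indicator_iff measurableSet_Ioo]
  exact h4

/-- The rank-one operator `φ ↦ ⟪N'E₊(·, s), φ⟫ N'E₊(·, r)`. -/
def traceRankOne (r s : ℝ) : L2 →L[ℂ] L2 :=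
  InnerProductSpace.rankOne ℂ (traceVec r) (traceVec s)

theorem traceRankOne_apply (r s : ℝ) (f : L2) :
    traceRankOne r s f = inner ℂ (traceVec s) f • traceVec r :=
  InnerProductSpace.rankOne_apply _ _ _

theorem norm_traceRankOne (r s : ℝ) :
    ‖traceRankOne r s‖ = 1 / (2 * Real.sqrt r) * (1 / (2 * Real.sqrt s)) := by
  rw [traceRankOne, InnerProductSpace.norm_rankOne, norm_traceVec, norm_traceVec]

theorem traceRankOne_eq_zero {r s : ℝ} (h : r ≤ 0 ∨ s ≤ 0) : traceRankOne r s = 0 := by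
  rw [← norm_eq_zero, norm_traceRankOne]
  rcases h with h | h <;> rw [Real.sqrt_eq_zero_of_nonpos h] <;> simp

theorem continuousAt_traceRankOne {r s : ℝ → ℝ} {a : ℝ} (hr : ContinuousAt r a)
    (hs : ContinuousAt s a) (hr0 : 0 < r a) (hs0 : 0 < s a) :
    ContinuousAt (fun t => traceRankOne (r t) (s t)) a := by
  have h1 : ContinuousAt (fun t => traceVec (r t)) a :=
    ContinuousAt.comp (continuousOn_traceVec.continuousAt (Ioi_mem_nhds hr0)) hr
  have h2 : ContinuousAt (fun t => traceVec (s t)) a :=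
    ContinuousAt.comp (continuousOn_traceVec.continuousAt (Ioi_mem_nhds hs0)) hs
  have h3 : ∀ x y, traceRankOne x y =
      ((ContinuousLinearMap.lsmul ℂ ℂ).flip (traceVec x)).comp (innerSL ℂ (traceVec y)) := by
    intro x y
    ext1 f
    simp [traceRankOne_apply]
  simp_rw [h3]
  exact ContinuousAt.clm_comp
    (((ContinuousLinearMap.lsmul ℂ ℂ (E := L2)).flip).continuous.continuousAt.comp h1)
    ((innerSL ℂ (E := L2)).continuous.continuousAt.comp h2)

theorem aestronglyMeasurable_traceRankOne (τ : ℝ) :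
    AEStronglyMeasurable (fun s => traceRankOne (τ - s) s) volume := by
  have h1 : (fun s => traceRankOne (τ - s) s) =
      (Ioo 0 τ).indicator fun s => traceRankOne (τ - s) s := by
    funext s
    by_cases hs : s ∈ Ioo 0 τ
    · rw [indicator_of_mem hs]
    · rw [indicator_of_notMem hs]
      rw [mem_Ioo, not_and_or, not_lt, not_lt] at hs
      exact traceRankOne_eq_zero (hs.symm.imp (fun h => by linarith) id)
  rw [h1, aestronglyMeasurable_indicator_iff measurableSet_Ioo]
  refine ContinuousOn.aestronglyMeasurable (fun s hs => ?_) measurableSet_Ioo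
  exact (continuousAt_traceRankOne (by fun_prop) continuousAt_id (by simpa using hs.2)
    hs.1).continuousWithinAt

theorem norm_traceRankOne_scaled {τ : ℝ} (hτ : 0 < τ) (u : ℝ) :
    ‖traceRankOne (τ - τ * u) (τ * u)‖ = τ⁻¹ * pairWeight u := by
  rw [norm_traceRankOne, show τ - τ * u = τ * (1 - u) by ring, Real.sqrt_mul hτ.le,
    Real.sqrt_mul hτ.le]
  unfold pairWeight
  nth_rewrite 3 [← Real.mul_self_sqrt hτ.le]
  rw [mul_inv]
  ring

theorem integrable_traceRankOne (τ : ℝ) : Integrable fun s => traceRankOne (τ - s) s := by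
  rcases le_or_gt τ 0 with hτ | hτ
  · have : (fun s => traceRankOne (τ - s) s) = 0 := by
      funext s
      refine traceRankOne_eq_zero ?_
      rcases le_or_gt s 0 with h | h
      · exact Or.inr h
      · exact Or.inl (by linarith)
    rw [this]
    exact integrable_zero ℝ (L2 →L[ℂ] L2) volume
  · rw [← integrable_norm_iff (aestronglyMeasurable_traceRankOne τ),
      ← integrable_comp_mul_left_iff _ hτ.ne']
    simp_rw [norm_traceRankOne_scaled hτ]
    exact integrable_pairWeight.const_mul _

/-- The time convolution `∫₀^τ ⟪N'E₊(·, s), φ⟫ N'E₊(·, τ - s) ds` of the trace kernel with itself,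
as a bounded operator. -/
def pairOp (τ : ℝ) : L2 →L[ℂ] L2 := ∫ s, traceRankOne (τ - s) s

theorem pairOp_of_nonpos {τ : ℝ} (hτ : τ ≤ 0) : pairOp τ = 0 := by
  unfold pairOp
  rw [← integral_zero ℝ (L2 →L[ℂ] L2)]
  congr 1
  funext s
  refine traceRankOne_eq_zero ?_
  rcases le_or_gt s 0 with h | h
  · exact Or.inr h
  · exact Or.inl (by linarith)

theorem pairOp_eq_scaled {τ : ℝ} (hτ : 0 < τ) :
    pairOp τ = τ • ∫ u, traceRankOne (τ - τ * u) (τ * u) := by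
  rw [Measure.integral_comp_mul_left (fun s => traceRankOne (τ - s) s) τ, abs_of_pos (by positivity),
    smul_smul, mul_inv_cancel₀ hτ.ne', one_smul]
  rfl

theorem norm_pairOp_le (τ : ℝ) : ‖pairOp τ‖ ≤ ∫ u, pairWeight u := by
  rcases le_or_gt τ 0 with hτ | hτ
  · rw [pairOp_of_nonpos hτ, norm_zero]
    exact integral_nonneg pairWeight_nonneg
  · rw [pairOp_eq_scaled hτ, norm_smul, Real.norm_of_nonneg hτ.le]
    calc _ ≤ τ * ∫ u, τ⁻¹ * pairWeight u := by
          gcongr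
          exact norm_integral_le_of_norm_le (integrable_pairWeight.const_mul _)
            (ae_of_all _ fun u => (norm_traceRankOne_scaled hτ u).le)
      _ = _ := by rw [integral_const_mul, ← mul_assoc, mul_inv_cancel₀ hτ.ne', one_mul]

theorem continuousAt_pairOp {τ : ℝ} (hτ : τ ≠ 0) : ContinuousAt pairOp τ := by
  rcases hτ.lt_or_gt with hτ | hτ
  · refine (continuousAt_const (y := (0 : L2 →L[ℂ] L2))).congr ?_
    filter_upwards [gt_mem_nhds hτ] with s hs using (pairOp_of_nonpos hs.le).symm
  · have h1 : ContinuousAt (fun t => t • ∫ u, traceRankOne (t - t * u) (t * u)) τ := by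
      refine continuousAt_id.smul ?_
      refine continuousAt_of_dominated (bound := fun u => (τ / 2)⁻¹ * pairWeight u) ?_ ?_
        (integrable_pairWeight.const_mul _) ?_
      · filter_upwards [lt_mem_nhds hτ] with t ht
        exact ((integrable_comp_mul_left_iff (fun s => traceRankOne (t - s) s) ht.ne').2
          (integrable_traceRankOne t)).aestronglyMeasurable
      · filter_upwards [lt_mem_nhds (show τ / 2 < τ by linarith)] with t ht
        refine ae_of_all _ fun u => ?_
        have ht0 : 0 < τ / 2 := by linarith
        rw [norm_traceRankOne_scaled (ht0.trans ht)]
        have := pairWeight_nonneg u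
        gcongr
      · refine ae_of_all _ fun u => ?_
        by_cases hu : u ∈ Ioo (0 : ℝ) 1
        · refine continuousAt_traceRankOne (by fun_prop) (by fun_prop) ?_ (mul_pos hτ hu.1)
          have := hu.2
          nlinarith
        · refine (continuousAt_const (y := (0 : L2 →L[ℂ] L2))).congr ?_
          filter_upwards [lt_mem_nhds hτ] with t ht
          rw [mem_Ioo, not_and_or, not_lt, not_lt] at hu
          refine (traceRankOne_eq_zero (hu.symm.imp (fun h => ?_) fun h => ?_)).symm <;> nlinarith
    refine h1.congr ?_
    filter_upwards [lt_mem_nhds hτ] with t ht using (pairOp_eq_scaled ht).symm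

theorem pairOp_apply (τ : ℝ) (f : L2) :
    pairOp τ f = ∫ s, inner ℂ (traceVec s) f • traceVec (τ - s) := by
  unfold pairOp
  rw [ContinuousLinearMap.integral_apply (integrable_traceRankOne τ)]
  simp_rw [traceRankOne_apply]

theorem aestronglyMeasurable_pairOp : AEStronglyMeasurable pairOp volume := by
  have h1 : pairOp = (Ioi 0).indicator pairOp := by
    funext s
    by_cases hs : 0 < s
    · rw [indicator_of_mem (show s ∈ Ioi 0 from hs)]
    · rw [indicator_of_notMem (show s ∉ Ioi 0 from hs), pairOp_of_nonpos (not_lt.1 hs)]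
  rw [h1]
  refine (aestronglyMeasurable_indicator_iff measurableSet_Ioi).2
    (ContinuousOn.aestronglyMeasurable (fun s hs => ?_) measurableSet_Ioi)
  exact (continuousAt_pairOp (ne_of_gt hs)).continuousWithinAt

/-- A function on the line supported in `(0, ∞)` whose Laplace transform converges absolutely
to the right of `σ`. -/
structure IsCausal (K : ℝ → ℂ) (σ : ℝ) : Prop where
  measurable : Measurable K
  eq_zero : ∀ t, t ≤ 0 → K t = 0
  integrable : ∀ l, σ < l → Integrable fun t => ((Real.exp (-(l * t)) : ℝ) : ℂ) * K t

namespace IsCausal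

variable {K : ℝ → ℂ} {σ : ℝ}

theorem integrable_indicator (hK : IsCausal K σ) (t : ℝ) :
    Integrable ((Iio t).indicator K) := by
  have hl : σ < |σ| + 1 := by have := le_abs_self σ; linarith
  have h1 := (hK.integrable _ hl).norm.const_mul (Real.exp ((|σ| + 1) * t))
  refine h1.mono' (hK.measurable.indicator measurableSet_Iio).aestronglyMeasurable
    (ae_of_all _ fun u => ?_)
  by_cases hu : u < t
  · rw [indicator_of_mem (show u ∈ Iio t from hu), norm_mul, Complex.norm_real,
      Real.norm_of_nonneg (Real.exp_pos _).le, ← mul_assoc, ← Real.exp_add]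
    have h2 : (1 : ℝ) ≤ Real.exp ((|σ| + 1) * t + -((|σ| + 1) * u)) := by
      refine Real.one_le_exp ?_
      have := abs_nonneg σ
      nlinarith
    nlinarith [norm_nonneg (K u)]
  · rw [indicator_of_notMem (show u ∉ Iio t from hu), norm_zero]
    positivity

theorem intervalIntegrable (hK : IsCausal K σ) (b : ℝ) : IntervalIntegrable K volume 0 b := by
  have h : IntegrableOn K (Iio (|b| + 1)) :=
    (integrable_indicator_iff measurableSet_Iio).1 (hK.integrable_indicator _)
  refine ⟨h.mono_set fun x hx => ?_, h.mono_set fun x hx => ?_⟩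
  · have := le_abs_self b
    exact show x < |b| + 1 by linarith [hx.2]
  · have := abs_nonneg b
    exact show x < |b| + 1 by linarith [hx.2]

end IsCausal

/-- The correction operator `φ ↦ ∫₀^t K(u) (N'E₊ *_t ⟪N'E₊, φ⟫)(t - u) du`. -/
def corrOp (K : ℝ → ℂ) (t : ℝ) : L2 →L[ℂ] L2 := ∫ u, K u • pairOp (t - u)

section

variable {K : ℝ → ℂ} {σ : ℝ}

theorem norm_smul_pairOp_le (K : ℝ → ℂ) {t T : ℝ} (h : t ≤ T) (u : ℝ) :
    ‖K u • pairOp (t - u)‖ ≤ ‖(Iio T).indicator K u‖ * ∫ u, pairWeight u := by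
  by_cases hu : u < T
  · rw [norm_smul, indicator_of_mem (show u ∈ Iio T from hu)]
    gcongr
    exact norm_pairOp_le _
  · rw [pairOp_of_nonpos (by linarith), smul_zero, norm_zero]
    have := integral_pairWeight_nonneg
    positivity

theorem aestronglyMeasurable_pairOp_sub (t : ℝ) :
    AEStronglyMeasurable (fun u => pairOp (t - u)) volume :=
  aestronglyMeasurable_pairOp.comp_quasiMeasurePreserving
    (Measure.measurePreserving_sub_left volume t).quasiMeasurePreserving

theorem integrable_smul_pairOp (hK : IsCausal K σ) (t : ℝ) :
    Integrable fun u => K u • pairOp (t - u) :=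
  ((hK.integrable_indicator t).norm.mul_const _).mono'
    (hK.measurable.aestronglyMeasurable.smul (aestronglyMeasurable_pairOp_sub t))
    (ae_of_all _ (norm_smul_pairOp_le K le_rfl))

/-- The jump of `pairOp` at time zero is smoothed by the integrable kernel. -/
theorem continuous_corrOp (hK : IsCausal K σ) : Continuous (corrOp K) := by
  rw [continuous_iff_continuousAt]
  intro t
  refine continuousAt_of_dominated
    (bound := fun u => ‖(Iio (t + 1)).indicator K u‖ * ∫ u, pairWeight u) ?_ ?_
    ((hK.integrable_indicator _).norm.mul_const _) ?_
  · exact Eventually.of_forall fun s => (integrable_smul_pairOp hK s).aestronglyMeasurable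
  · filter_upwards [gt_mem_nhds (show t < t + 1 by linarith)] with s hs
    exact ae_of_all _ (norm_smul_pairOp_le K hs.le)
  · have : ∀ᵐ u : ℝ, u ≠ t := compl_mem_ae_iff.2 (measure_singleton t)
    filter_upwards [this] with u hu
    have h1 : ContinuousAt (fun s => pairOp (s - u)) t :=
      ContinuousAt.comp (f := fun s => s - u)
        (continuousAt_pairOp (sub_ne_zero.2 hu.symm)) (by fun_prop)
    exact h1.const_smul (K u)

theorem corrOp_zero (hK : IsCausal K σ) : corrOp K 0 = 0 := by
  unfold corrOp
  rw [← integral_zero ℝ (L2 →L[ℂ] L2)]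
  congr 1
  funext u
  rcases le_or_gt u 0 with h | h
  · rw [hK.eq_zero u h, zero_smul]
  · rw [pairOp_of_nonpos (by linarith), smul_zero]

theorem norm_corrOp_le (hK : IsCausal K σ) {l : ℝ} (hl : σ < l) (hl0 : 0 ≤ l) (t : ℝ) :
    ‖corrOp K t‖ ≤ ((∫ u, ‖((Real.exp (-(l * u)) : ℝ) : ℂ) * K u‖) * ∫ u, pairWeight u) *
      Real.exp (l * t) := by
  have h1 : ∀ u, ‖K u • pairOp (t - u)‖ ≤ Real.exp (l * t) *
      (‖((Real.exp (-(l * u)) : ℝ) : ℂ) * K u‖ * ∫ u, pairWeight u) := by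
    intro u
    have hw := integral_pairWeight_nonneg
    refine (norm_smul_pairOp_le K le_rfl u).trans ?_
    rw [← mul_assoc]
    refine mul_le_mul_of_nonneg_right ?_ hw
    by_cases hu : u < t
    · rw [indicator_of_mem (show u ∈ Iio t from hu), norm_mul, Complex.norm_real,
        Real.norm_of_nonneg (Real.exp_pos _).le, ← mul_assoc, ← Real.exp_add]
      have h2 : (1 : ℝ) ≤ Real.exp (l * t + -(l * u)) := by
        exact Real.one_le_exp (by nlinarith)
      nlinarith [norm_nonneg (K u)]
    · rw [indicator_of_notMem (show u ∉ Iio t from hu), norm_zero]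
      positivity
  refine (norm_integral_le_of_norm_le (((hK.integrable l hl).norm.mul_const _).const_mul _)
    (ae_of_all _ h1)).trans_eq ?_
  rw [integral_const_mul, integral_mul_const]
  ring

theorem corrOp_apply (hK : IsCausal K σ) (t : ℝ) (f : L2) :
    corrOp K t f = ∫ u, K u • pairOp (t - u) f := by
  unfold corrOp
  rw [ContinuousLinearMap.integral_apply (integrable_smul_pairOp hK t)]
  rfl

end

/-! ### The Laplace transform of the correction -/

theorem integrable_exp_smul_traceVec {l : ℝ} (hl : 0 < l) :
    Integrable fun s => ((Real.exp (-(l * s)) : ℝ) : ℂ) • traceVec s := by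
  have hm : AEStronglyMeasurable (fun s => ((Real.exp (-(l * s)) : ℝ) : ℂ) • traceVec s) volume :=
    (continuous_exp_neg_mul l).aestronglyMeasurable.smul aestronglyMeasurable_traceVec
  have h1 : IntegrableOn (fun s => ((Real.exp (-(l * s)) : ℝ) : ℂ) • traceVec s) (Ioi 0) := by
    have h2 := (integrableOn_rpow_mul_exp_neg_mul_rpow (p := 1) (s := -(1 / 2)) (b := l)
      (by norm_num) one_pos hl)
    refine Integrable.mono' h2 hm.restrict ?_
    refine (ae_restrict_mem measurableSet_Ioi).mono fun s hs => ?_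
    have hs : 0 < s := hs
    have hss := Real.sqrt_pos.2 hs
    rw [norm_smul, norm_traceVec, Complex.norm_real, Real.norm_of_nonneg (Real.exp_pos _).le,
      Real.rpow_neg hs.le, ← Real.sqrt_eq_rpow, Real.rpow_one, neg_mul, mul_comm]
    refine mul_le_mul_of_nonneg_right ?_ (Real.exp_pos _).le
    rw [one_div, mul_inv]
    have : 0 < (Real.sqrt s)⁻¹ := by positivity
    linarith
  have h3 : (fun s => ((Real.exp (-(l * s)) : ℝ) : ℂ) • traceVec s) =
      (Ioi 0).indicator fun s => ((Real.exp (-(l * s)) : ℝ) : ℂ) • traceVec s := by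
    funext s
    by_cases hs : 0 < s
    · rw [indicator_of_mem (show s ∈ Ioi 0 from hs)]
    · rw [indicator_of_notMem (show s ∉ Ioi 0 from hs), traceVec_of_nonpos (not_lt.1 hs),
        smul_zero]
  rw [h3, integrable_indicator_iff measurableSet_Ioi]
  exact h1

/-- The decaying solution `√x K₀(√l x)` of the resolvent equation, as the Laplace transform of the
trace kernel. -/
def decayVec (l : ℝ) : L2 := ∫ s, ((Real.exp (-(l * s)) : ℝ) : ℂ) • traceVec s

theorem inner_decayVec {l : ℝ} (hl : 0 < l) (f : L2) :
    ∫ s, ((Real.exp (-(l * s)) : ℝ) : ℂ) * inner ℂ (traceVec s) f = inner ℂ (decayVec l) f := by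
  rw [← inner_conj_symm (decayVec l) f, decayVec, ← integral_inner (integrable_exp_smul_traceVec hl),
    ← integral_conj]
  refine integral_congr_ae (ae_of_all _ fun s => ?_)
  simp only
  rw [inner_conj_symm, inner_smul_left, Complex.conj_ofReal]

theorem exp_smul_pairOp_apply (l τ : ℝ) (f : L2) :
    ((Real.exp (-(l * τ)) : ℝ) : ℂ) • pairOp τ f =
      convolution (fun s => ((Real.exp (-(l * s)) : ℝ) : ℂ) * inner ℂ (traceVec s) f)
        (fun s => ((Real.exp (-(l * s)) : ℝ) : ℂ) • traceVec s)
        (ContinuousLinearMap.lsmul ℂ ℂ) volume τ := by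
  rw [convolution_def, pairOp_apply, ← integral_smul]
  refine integral_congr_ae (ae_of_all _ fun s => ?_)
  simp only [ContinuousLinearMap.lsmul_apply, smul_smul]
  congr 1
  rw [show -(l * τ) = -(l * s) + -(l * (τ - s)) by ring, Real.exp_add, Complex.ofReal_mul]
  ring

theorem integrable_exp_mul_inner {l : ℝ} (hl : 0 < l) (f : L2) :
    Integrable fun s => ((Real.exp (-(l * s)) : ℝ) : ℂ) * inner ℂ (traceVec s) f := by
  have h := (integrable_exp_smul_traceVec hl).inner_const (𝕜 := ℂ) f
  refine h.congr (ae_of_all _ fun s => ?_)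
  simp only
  rw [inner_smul_left, Complex.conj_ofReal]

theorem exp_smul_corrOp_apply {K : ℝ → ℂ} {σ : ℝ} (hK : IsCausal K σ) (l t : ℝ) (f : L2) :
    ((Real.exp (-(l * t)) : ℝ) : ℂ) • corrOp K t f =
      convolution (fun s => ((Real.exp (-(l * s)) : ℝ) : ℂ) * K s)
        (fun s => ((Real.exp (-(l * s)) : ℝ) : ℂ) • pairOp s f)
        (ContinuousLinearMap.lsmul ℂ ℂ) volume t := by
  rw [convolution_def, corrOp_apply hK, ← integral_smul]
  refine integral_congr_ae (ae_of_all _ fun s => ?_)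
  simp only [ContinuousLinearMap.lsmul_apply, smul_smul]
  congr 1
  rw [show -(l * t) = -(l * s) + -(l * (t - s)) by ring, Real.exp_add, Complex.ofReal_mul]
  ring

/-- The Laplace transform turns the correction into a multiple of the rank-one operator
`φ ↦ ⟪d, φ⟫ d`, where `d` is the decaying solution. -/
theorem laplace_corrOp {K : ℝ → ℂ} {σ : ℝ} (hK : IsCausal K σ) {l : ℝ} (hl : σ < l) (hl0 : 0 < l)
    (f : L2) :
    ∫ t in Ioi (0 : ℝ), ((Real.exp (-(l * t)) : ℝ) : ℂ) • corrOp K t f =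
      ((∫ t, ((Real.exp (-(l * t)) : ℝ) : ℂ) * K t) * inner ℂ (decayVec l) f) • decayVec l := by
  have h1 : ∀ t, t ∉ Ioi (0 : ℝ) → ((Real.exp (-(l * t)) : ℝ) : ℂ) • corrOp K t f = 0 := by
    intro t ht
    have ht : t ≤ 0 := not_lt.1 ht
    rw [corrOp_apply hK]
    have : ∀ u, K u • pairOp (t - u) f = 0 := by
      intro u
      rcases le_or_gt u 0 with h | h
      · rw [hK.eq_zero u h, zero_smul]
      · rw [pairOp_of_nonpos (by linarith)]; simp
    simp [this]
  rw [setIntegral_eq_integral_of_forall_compl_eq_zero h1]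
  simp_rw [exp_smul_corrOp_apply hK l]
  have h2 : Integrable fun s => ((Real.exp (-(l * s)) : ℝ) : ℂ) • pairOp s f := by
    simp_rw [exp_smul_pairOp_apply]
    exact (integrable_exp_mul_inner hl0 f).integrable_convolution _
      (integrable_exp_smul_traceVec hl0)
  rw [integral_convolution _ (hK.integrable l hl) h2]
  simp_rw [exp_smul_pairOp_apply]
  rw [integral_convolution _ (integrable_exp_mul_inner hl0 f) (integrable_exp_smul_traceVec hl0),
    inner_decayVec hl0]
  simp only [ContinuousLinearMap.lsmul_apply, smul_smul]
  rfl

/-! ### The integral kernel of the correction -/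

/-- Away from the origin the trace kernel is bounded in time. -/
theorem causalTrace_le {x : ℝ} (hx : 0 < x) (s : ℝ) :
    causalTrace x s ≤ 2 * Real.sqrt x / x ^ 2 := by
  rcases le_or_gt s 0 with hs | hs
  · rw [causalTrace_of_nonpos hs]; positivity
  · rw [causalTrace_of_pos hs]
    unfold traceKernel
    have h1 : Real.exp (-x ^ 2 / (4 * s)) ≤ 4 * s / x ^ 2 := by
      have h2 := Real.add_one_le_exp (x ^ 2 / (4 * s))
      rw [show -x ^ 2 / (4 * s) = -(x ^ 2 / (4 * s)) by ring, Real.exp_neg,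
        show 4 * s / x ^ 2 = (x ^ 2 / (4 * s))⁻¹ by rw [inv_div]]
      have : 0 < x ^ 2 / (4 * s) := by positivity
      exact inv_anti₀ this (by linarith)
    calc _ ≤ Real.sqrt x / (2 * s) * (4 * s / x ^ 2) := by gcongr
      _ = _ := by field_simp; norm_num

section

variable {K : ℝ → ℂ} {σ : ℝ}

/-- The causal convolution `K *_t N'E₊(x, ·)`. -/
def causalConv (K : ℝ → ℂ) (x τ : ℝ) : ℂ := ∫ u, K u * (causalTrace x (τ - u) : ℂ)

theorem causalConv_of_nonpos (hK : IsCausal K σ) (x : ℝ) {τ : ℝ} (hτ : τ ≤ 0) :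
    causalConv K x τ = 0 := by
  unfold causalConv
  rw [← integral_zero ℝ ℂ]
  congr 1
  funext u
  rcases le_or_gt u 0 with h | h
  · rw [hK.eq_zero u h, zero_mul]
  · rw [causalTrace_of_nonpos (by linarith), Complex.ofReal_zero, mul_zero]

theorem measurable_causalTrace_right (x : ℝ) : Measurable (causalTrace x) :=
  measurable_causalTrace.comp measurable_prodMk_left

theorem stronglyMeasurable_causalConv (hK : IsCausal K σ) :
    StronglyMeasurable fun p : ℝ × ℝ => causalConv K p.1 p.2 := by
  have h1 : Measurable fun q : (ℝ × ℝ) × ℝ => K q.2 * (causalTrace q.1.1 (q.1.2 - q.2) : ℂ) := by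
    refine (hK.measurable.comp measurable_snd).mul (Complex.measurable_ofReal.comp ?_)
    exact measurable_causalTrace.comp (Measurable.prodMk (by fun_prop) (by fun_prop))
  exact h1.stronglyMeasurable.integral_prod_right'

theorem norm_causalConv_le (hK : IsCausal K σ) {x : ℝ} (hx : 0 < x) {τ t : ℝ} (h : τ ≤ t) :
    ‖causalConv K x τ‖ ≤ (∫ u, ‖(Iio t).indicator K u‖) * (2 * Real.sqrt x / x ^ 2) := by
  unfold causalConv
  rw [← integral_mul_const]
  refine norm_integral_le_of_norm_le ((hK.integrable_indicator t).norm.mul_const _)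
    (ae_of_all _ fun u => ?_)
  by_cases hu : u < t
  · rw [indicator_of_mem (show u ∈ Iio t from hu), norm_mul, Complex.norm_real,
      Real.norm_of_nonneg (causalTrace_nonneg _ _)]
    gcongr
    exact causalTrace_le hx _
  · rw [causalTrace_of_nonpos (by linarith)]
    simp only [Complex.ofReal_zero, mul_zero, norm_zero]
    positivity

theorem integrable_indicator_causalTrace {y : ℝ} (hy : 0 < y) (t : ℝ) :
    Integrable ((Iio t).indicator fun r => (causalTrace y r : ℂ)) := by
  have h1 : Integrable ((Ioo 0 t).indicator fun _ : ℝ => 2 * Real.sqrt y / y ^ 2) :=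
    (integrable_indicator_iff measurableSet_Ioo).2 (by simp)
  refine h1.mono' ((Complex.measurable_ofReal.comp
    (measurable_causalTrace_right y)).indicator measurableSet_Iio).aestronglyMeasurable
    (ae_of_all _ fun r => ?_)
  by_cases hr : r ∈ Ioo 0 t
  · rw [indicator_of_mem hr, indicator_of_mem (show r ∈ Iio t from hr.2), Complex.norm_real,
      Real.norm_of_nonneg (causalTrace_nonneg _ _)]
    exact causalTrace_le hy r
  · rw [indicator_of_notMem hr]
    rw [mem_Ioo, not_and_or, not_lt, not_lt] at hr
    by_cases hr2 : r < t
    · rw [indicator_of_mem (show r ∈ Iio t from hr2),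
        causalTrace_of_nonpos (hr.resolve_right (not_le.2 hr2))]
      simp
    · rw [indicator_of_notMem (show r ∉ Iio t from hr2), norm_zero]

/-- The correction kernel in causal form, with the two inner convolutions interchanged. -/
theorem timeConv_eq_integral (hK : IsCausal K σ) {x y t : ℝ} (hx : 0 < x) (hy : 0 < y)
    (ht : 0 < t) :
    timeConv (fun s => (traceKernel x s : ℂ)) (timeConv K (fun s => (traceKernel y s : ℂ))) t =
      ∫ r, (causalTrace y r : ℂ) * causalConv K x (t - r) := by
  have h1 : ∀ s, 0 < s → timeConv K (fun s => (traceKernel y s : ℂ)) s =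
      ∫ r, K (s - r) * (causalTrace y r : ℂ) := by
    intro s hs
    unfold timeConv
    rw [intervalIntegral.integral_of_le hs.le]
    refine Eq.trans ?_ (setIntegral_eq_integral_of_forall_compl_eq_zero (s := Ioc 0 s) ?_)
    · refine setIntegral_congr_fun measurableSet_Ioc fun r hr => ?_
      simp only [causalTrace_of_pos hr.1]
    · intro r hr
      rw [mem_Ioc, not_and_or, not_lt, not_le] at hr
      rcases hr with hr | hr
      · rw [causalTrace_of_nonpos hr]; simp
      · rw [hK.eq_zero _ (by linarith), zero_mul]
  have h2 : timeConv (fun s => (traceKernel x s : ℂ))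
      (timeConv K (fun s => (traceKernel y s : ℂ))) t =
      ∫ s, ∫ r, (causalTrace x (t - s) : ℂ) * (K (s - r) * (causalTrace y r : ℂ)) := by
    rw [timeConv, intervalIntegral.integral_of_le ht.le]
    refine Eq.trans ?_ (setIntegral_eq_integral_of_forall_compl_eq_zero (s := Ioc 0 t) ?_)
    · refine setIntegral_congr_fun measurableSet_Ioc fun s hs => ?_
      rw [h1 s hs.1, integral_const_mul]
      rcases hs.2.eq_or_lt with rfl | h
      · simp [traceKernel, causalTrace]
      · rw [causalTrace_of_pos (by linarith)]
    · intro s hs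
      rw [← integral_zero ℝ ℂ]
      congr 1
      funext r
      rw [mem_Ioc, not_and_or, not_lt, not_le] at hs
      rcases hs with hs | hs
      · rcases le_or_gt r 0 with hr | hr
        · rw [causalTrace_of_nonpos hr]; simp
        · rw [hK.eq_zero _ (by linarith)]; simp
      · rw [causalTrace_of_nonpos (by linarith : t - s ≤ 0)]; simp
  rw [h2, integral_integral_swap]
  · refine integral_congr_ae (ae_of_all _ fun r => ?_)
    simp only
    unfold causalConv
    rw [← integral_const_mul, ← integral_sub_right_eq_self
      (fun u => (causalTrace y r : ℂ) * (K u * (causalTrace x (t - r - u) : ℂ))) r]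
    refine integral_congr_ae (ae_of_all _ fun s => ?_)
    simp only
    rw [show t - r - (s - r) = t - s by ring]
    ring
  · have h3 := (integrable_indicator_causalTrace hy t).convolution_integrand
      (ContinuousLinearMap.mul ℂ ℂ) (hK.integrable_indicator t) (μ := volume)
    have h4 : Measurable fun p : ℝ × ℝ => (causalTrace x (t - p.1) : ℂ) :=
      Complex.measurable_ofReal.comp
        ((measurable_causalTrace_right x).comp (measurable_const.sub measurable_fst))
    refine (h3.bdd_mul (c := 2 * Real.sqrt x / x ^ 2) h4.aestronglyMeasurable
      (ae_of_all _ fun p => ?_)).congr (ae_of_all _ fun p => ?_)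
    · rw [Complex.norm_real, Real.norm_of_nonneg (causalTrace_nonneg _ _)]
      exact causalTrace_le hx _
    · obtain ⟨s, r⟩ := p
      simp only [Function.uncurry, ContinuousLinearMap.mul_apply']
      rcases le_or_gt t s with hs | hs
      · rw [causalTrace_of_nonpos (by linarith : t - s ≤ 0)]; simp
      rcases le_or_gt r 0 with hr | hr
      · simp only [indicator_apply, causalTrace_of_nonpos hr]; simp
      rcases le_or_gt s r with hsr | hsr
      · simp only [indicator_apply, hK.eq_zero _ (by linarith : s - r ≤ 0)]; simp
      rw [indicator_of_mem (show r ∈ Iio t from by simp only [mem_Iio]; linarith),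
        indicator_of_mem (show s - r ∈ Iio t from by simp only [mem_Iio]; linarith)]
      ring

theorem stronglyMeasurable_inner_traceVec (f : L2) :
    StronglyMeasurable fun s => inner ℂ (traceVec s) f := by
  simp_rw [inner_traceVec_eq]
  have h1 : StronglyMeasurable fun p : ℝ × ℝ => (causalTrace p.2 p.1 : ℂ) * f p.2 :=
    (Complex.measurable_ofReal.comp (measurable_causalTrace.comp
      measurable_swap)).stronglyMeasurable.mul
      ((Lp.stronglyMeasurable f).comp_measurable measurable_snd)
  exact h1.integral_prod_right'

theorem integrableOn_inv_sqrt (t : ℝ) : IntegrableOn (fun s => 1 / (2 * Real.sqrt s)) (Iio t) := by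
  have h1 := (integrable_exp_smul_traceVec one_pos).norm.const_mul (Real.exp t)
  have hm : Measurable fun s : ℝ => 1 / (2 * Real.sqrt s) := by fun_prop
  refine Integrable.mono' h1.integrableOn hm.aestronglyMeasurable ?_
  refine (ae_restrict_mem measurableSet_Iio).mono fun s hs => ?_
  have hs : s < t := hs
  rw [norm_smul, norm_traceVec, Complex.norm_real, Real.norm_of_nonneg (Real.exp_pos _).le,
    Real.norm_of_nonneg (by positivity), ← mul_assoc, ← Real.exp_add]
  have h2 : (1 : ℝ) ≤ Real.exp (t + -(1 * s)) := Real.one_le_exp (by linarith)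
  have h3 : 0 ≤ 1 / (2 * Real.sqrt s) := by positivity
  nlinarith

theorem integrable_indicator_inner (f : L2) (t : ℝ) :
    Integrable ((Iio t).indicator fun s => inner ℂ (traceVec s) f) := by
  rw [integrable_indicator_iff measurableSet_Iio]
  refine ((integrableOn_inv_sqrt t).mul_const ‖f‖).mono'
    (stronglyMeasurable_inner_traceVec f).aestronglyMeasurable (ae_of_all _ fun s => ?_)
  rw [← norm_traceVec]
  exact norm_inner_le_norm _ _

theorem pairOp_ae (τ : ℝ) (f : L2) : pairOp τ f =ᵐ[halfLine]
    fun x => ∫ s, inner ℂ (traceVec s) f * (causalTrace x (τ - s) : ℂ) := by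
  rw [pairOp_apply]
  refine (coeFn_integral_L2 (k := fun x s => inner ℂ (traceVec s) f *
    (causalTrace x (τ - s) : ℂ)) ?_ ?_ ?_).2
  · refine (((stronglyMeasurable_inner_traceVec f).comp_measurable measurable_snd).mul
      (Complex.measurable_ofReal.comp (measurable_causalTrace.comp
        (Measurable.prodMk ?_ ?_))).stronglyMeasurable).aestronglyMeasurable <;> fun_prop
  · have := (integrable_traceRankOne τ).apply_continuousLinearMap f
    simpa only [traceRankOne_apply] using this
  · refine ae_of_all _ fun s => ?_
    filter_upwards [Lp.coeFn_smul (inner ℂ (traceVec s) f) (traceVec (τ - s)),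
      coeFn_traceVec (τ - s)] with x h1 h2
    rw [h1, Pi.smul_apply, h2, smul_eq_mul]

theorem corrOp_ae (hK : IsCausal K σ) (t : ℝ) (f : L2) : corrOp K t f =ᵐ[halfLine]
    fun x => ∫ u, K u * ∫ s, inner ℂ (traceVec s) f * (causalTrace x (t - u - s) : ℂ) := by
  rw [corrOp_apply hK]
  refine (coeFn_integral_L2 (k := fun x u => K u * ∫ s, inner ℂ (traceVec s) f *
    (causalTrace x (t - u - s) : ℂ)) ?_ ?_ ?_).2
  · have h1 : StronglyMeasurable fun q : (ℝ × ℝ) × ℝ => inner ℂ (traceVec q.2) f *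
        (causalTrace q.1.1 (t - q.1.2 - q.2) : ℂ) := by
      refine ((stronglyMeasurable_inner_traceVec f).comp_measurable measurable_snd).mul
        (Complex.measurable_ofReal.comp (measurable_causalTrace.comp
          (Measurable.prodMk ?_ ?_))).stronglyMeasurable <;> fun_prop
    exact ((hK.measurable.comp measurable_snd).stronglyMeasurable.mul
      h1.integral_prod_right').aestronglyMeasurable
  · exact (integrable_smul_pairOp hK t).apply_continuousLinearMap f
  · refine ae_of_all _ fun u => ?_
    filter_upwards [Lp.coeFn_smul (K u) (pairOp (t - u) f), pairOp_ae (t - u) f] with x h1 h2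
    rw [h1, Pi.smul_apply, h2, smul_eq_mul]

/-- The correction operator is an integral operator with the convolution kernel
`N'E₊ *_t K *_t N'E₊`. -/
theorem corrOp_kernel (hK : IsCausal K σ) {t : ℝ} (ht : 0 < t) (f : L2) :
    ∀ᵐ x ∂halfLine, Integrable (fun y => timeConv (fun s => (traceKernel x s : ℂ))
        (timeConv K (fun s => (traceKernel y s : ℂ))) t * f y) halfLine ∧
      corrOp K t f x = ∫ y, timeConv (fun s => (traceKernel x s : ℂ))
        (timeConv K (fun s => (traceKernel y s : ℂ))) t * f y ∂halfLine := by
  filter_upwards [corrOp_ae hK t f, ae_restrict_mem measurableSet_Ioi] with x hx hx0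
  have hx0 : 0 < x := hx0
  -- interchange of the two time integrals in the value of the operator
  have h1 : corrOp K t f x = ∫ s, inner ℂ (traceVec s) f * causalConv K x (t - s) := by
    rw [hx]
    simp_rw [← integral_const_mul]
    rw [integral_integral_swap]
    · refine integral_congr_ae (ae_of_all _ fun s => ?_)
      simp only
      unfold causalConv
      rw [← integral_const_mul]
      refine integral_congr_ae (ae_of_all _ fun u => ?_)
      simp only
      rw [sub_right_comm]
      ring
    · have h2 := (hK.integrable_indicator t).mul_prod (integrable_indicator_inner f t)
      have h3 : Measurable fun p : ℝ × ℝ => (causalTrace x (t - p.1 - p.2) : ℂ) :=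
        Complex.measurable_ofReal.comp ((measurable_causalTrace_right x).comp (by fun_prop))
      refine (h2.bdd_mul (c := 2 * Real.sqrt x / x ^ 2) h3.aestronglyMeasurable
        (ae_of_all _ fun p => ?_)).congr (ae_of_all _ fun p => ?_)
      · rw [Complex.norm_real, Real.norm_of_nonneg (causalTrace_nonneg _ _)]
        exact causalTrace_le hx0 _
      · obtain ⟨u, s⟩ := p
        simp only [Function.uncurry]
        rcases le_or_gt u 0 with hu | hu
        · simp only [indicator_apply, hK.eq_zero _ hu]; simp
        rcases le_or_gt s 0 with hs | hs
        · simp only [indicator_apply, traceVec_of_nonpos hs]; simp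
        rcases le_or_gt (t - u - s) 0 with hus | hus
        · rw [causalTrace_of_nonpos hus]; simp
        rw [indicator_of_mem (show u ∈ Iio t from by simp only [mem_Iio]; linarith),
          indicator_of_mem (show s ∈ Iio t from by simp only [mem_Iio]; linarith)]
        ring
  have hD : StronglyMeasurable fun r => causalConv K x (t - r) :=
    (stronglyMeasurable_causalConv hK).comp_measurable
      (g := fun r => (x, t - r)) (by fun_prop)
  have hm : AEStronglyMeasurable (fun p : ℝ × ℝ =>
      (causalTrace p.1 p.2 : ℂ) * causalConv K x (t - p.2) * f p.1) (halfLine.prod volume) :=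
    (((Complex.measurable_ofReal.comp measurable_causalTrace).stronglyMeasurable.mul
      (hD.comp_measurable measurable_snd)).mul
      ((Lp.stronglyMeasurable f).comp_measurable measurable_fst)).aestronglyMeasurable
  set D : ℝ := (∫ u, ‖(Iio t).indicator K u‖) * (2 * Real.sqrt x / x ^ 2) with hDdef
  have hD0 : 0 ≤ D := (norm_nonneg _).trans (norm_causalConv_le hK hx0 le_rfl)
  have hprod : ∀ r, Integrable (fun y => (causalTrace y r : ℂ) * f y) halfLine := by
    intro r
    refine (L2.integrable_inner (𝕜 := ℂ) (traceVec r) f).congr ?_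
    filter_upwards [coeFn_traceVec r] with y hy
    rw [hy, RCLike.inner_apply, Complex.conj_ofReal, mul_comm]
  have hnorm : ∀ r, ∫ y, ‖(causalTrace y r : ℂ) * f y‖ ∂halfLine ≤
      1 / (2 * Real.sqrt r) * ‖f‖ := by
    intro r
    have hg : MemLp (fun y => ((‖f y‖ : ℝ) : ℂ)) 2 halfLine := (Lp.memLp f).norm.ofReal
    have h2 := norm_inner_le_norm (𝕜 := ℂ) (traceVec r) (hg.toLp _)
    rw [inner_traceVec_eq, norm_traceVec, Lp.norm_toLp] at h2
    have h3 : eLpNorm (fun y => ((‖f y‖ : ℝ) : ℂ)) 2 halfLine = eLpNorm f 2 halfLine :=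
      eLpNorm_congr_norm_ae (ae_of_all _ fun y => by simp)
    have h4 : ∫ y, (causalTrace y r : ℂ) * (hg.toLp _ : L2) y ∂halfLine =
        ((∫ y, ‖(causalTrace y r : ℂ) * f y‖ ∂halfLine : ℝ) : ℂ) := by
      rw [← integral_complex_ofReal]
      refine integral_congr_ae ?_
      filter_upwards [hg.coeFn_toLp] with y hy
      rw [hy, norm_mul, Complex.norm_real, Real.norm_of_nonneg (causalTrace_nonneg _ _)]
      push_cast; rfl
    rw [h4, Complex.norm_real, Real.norm_of_nonneg (integral_nonneg fun y => norm_nonneg _)] at h2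
    refine h2.trans_eq ?_
    congr 1
    rw [Lp.norm_def]
    exact congrArg _ h3
  -- Cauchy-Schwarz in `y` leaves the integrable singularity `r^{-1/2}` in time
  have hI : Integrable (fun p : ℝ × ℝ =>
      (causalTrace p.1 p.2 : ℂ) * causalConv K x (t - p.2) * f p.1) (halfLine.prod volume) := by
    rw [integrable_prod_iff' hm]
    refine ⟨ae_of_all _ fun r => ?_, ?_⟩
    · refine ((hprod r).mul_const (causalConv K x (t - r))).congr (ae_of_all _ fun y => ?_)
      simp only; ring
    · have h5 : Integrable ((Iio t).indicator fun r => 1 / (2 * Real.sqrt r) * (‖f‖ * D)) :=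
        (integrable_indicator_iff measurableSet_Iio).2 ((integrableOn_inv_sqrt t).mul_const _)
      refine h5.mono' hm.norm.prod_swap.integral_prod_right' (ae_of_all _ fun r => ?_)
      rw [Real.norm_of_nonneg (integral_nonneg fun y => norm_nonneg _)]
      have h6 : ∀ y, ‖(causalTrace y r : ℂ) * causalConv K x (t - r) * f y‖ =
          ‖(causalTrace y r : ℂ) * f y‖ * ‖causalConv K x (t - r)‖ := fun y => by
        simp only [norm_mul]; ring
      simp_rw [h6]
      rw [integral_mul_const]
      rcases le_or_gt r 0 with hr | hr
      · simp only [causalTrace_of_nonpos hr]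
        simp only [Complex.ofReal_zero, zero_mul, norm_zero, integral_zero]
        exact indicator_nonneg (fun r _ => by positivity) _
      rcases le_or_gt t r with hr2 | hr2
      · rw [causalConv_of_nonpos hK x (by linarith : t - r ≤ 0), norm_zero, mul_zero]
        exact indicator_nonneg (fun r _ => by positivity) _
      rw [indicator_of_mem (show r ∈ Iio t from hr2), ← mul_assoc]
      have h7 := norm_causalConv_le hK hx0 (by linarith : t - r ≤ t)
      have h8 := hnorm r
      gcongr
  have h9 : ∀ y ∈ Ioi (0 : ℝ), timeConv (fun s => (traceKernel x s : ℂ))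
        (timeConv K (fun s => (traceKernel y s : ℂ))) t * f y =
      ∫ r, (causalTrace y r : ℂ) * causalConv K x (t - r) * f y := by
    intro y hy
    rw [timeConv_eq_integral hK hx0 hy ht, integral_mul_const]
  constructor
  · exact (IntegrableOn.congr_fun hI.integral_prod_left (fun y hy => (h9 y hy).symm)
      measurableSet_Ioi)
  · rw [setIntegral_congr_fun measurableSet_Ioi h9, integral_integral_swap hI, h1]
    refine integral_congr_ae (ae_of_all _ fun r => ?_)
    simp only
    rw [inner_traceVec_eq, ← integral_mul_const]
    refine integral_congr_ae (ae_of_all _ fun y => ?_)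
    simp only
    ring

theorem aestronglyMeasurable_correctedKernel (hK : IsCausal K σ) {t : ℝ} (ht : 0 < t) :
    AEStronglyMeasurable (fun p : ℝ × ℝ => correctedKernel K p.1 p.2 t)
      (halfLine.prod halfLine) := by
  have h1 : StronglyMeasurable fun q : (ℝ × ℝ) × ℝ =>
      (causalTrace q.1.2 q.2 : ℂ) * causalConv K q.1.1 (t - q.2) := by
    refine (Complex.measurable_ofReal.comp (measurable_causalTrace.comp
      (Measurable.prodMk ?_ ?_))).stronglyMeasurable.mul
      ((stronglyMeasurable_causalConv hK).comp_measurable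
        (g := fun q : (ℝ × ℝ) × ℝ => (q.1.1, t - q.2)) ?_) <;> fun_prop
  have h2 : StronglyMeasurable fun p : ℝ × ℝ => (friedrichsKernel p.1 p.2 t : ℂ) :=
    (Complex.continuous_ofReal.comp (continuous_friedrichsKernel t)).stronglyMeasurable
  have h4 : StronglyMeasurable fun p : ℝ × ℝ =>
      ∫ r, (causalTrace p.2 r : ℂ) * causalConv K p.1 (t - r) := h1.integral_prod_right'
  refine (h2.add h4).aestronglyMeasurable.congr ?_
  have h3 : halfLine.prod halfLine = (volume.prod volume).restrict (Ioi 0 ×ˢ Ioi 0) :=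
    Measure.prod_restrict _ _
  rw [h3]
  filter_upwards [ae_restrict_mem (measurableSet_Ioi.prod measurableSet_Ioi)] with p hp
  rw [correctedKernel, timeConv_eq_integral hK hp.1 hp.2 ht]
  rfl

/-- The family of operators with kernels `E₊ + N'E₊ *_t K *_t N'E₊`. -/
def heatOp (K : ℝ → ℂ) (t : ℝ) : L2 →L[ℂ] L2 := friedrichsOp t + corrOp K t

theorem heatOp_kernel (hK : IsCausal K σ) {t : ℝ} (ht : 0 < t) (f : L2) :
    ∀ᵐ x ∂halfLine, Integrable (fun y => correctedKernel K x y t * f y) halfLine ∧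
      heatOp K t f x = ∫ y, correctedKernel K x y t * f y ∂halfLine := by
  filter_upwards [friedrichsOp_ae ht f, corrOp_kernel hK ht f,
    Lp.coeFn_add (friedrichsOp t f) (corrOp K t f)] with x h1 h2 h3
  simp_rw [correctedKernel, add_mul]
  refine ⟨h1.1.add h2.1, ?_⟩
  rw [integral_add h1.1 h2.1, ← h1.2, ← h2.2]
  exact h3

end

/-! ### Pointwise inversion of Fourier integrals -/

/-- The truncated inverse Fourier integral of an integrable function vanishes in the limit when
the difference quotient at the point is integrable, by the Riemann-Lebesgue lemma. -/
theorem tendsto_fourier_truncated_zero {h : ℝ → ℂ} {t : ℝ} (hh : Integrable h)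
    (hq : Integrable fun x => h x / ((t - x : ℝ) : ℂ)) :
    Tendsto (fun R : ℝ => ∫ s in (-R)..R, Complex.exp (s * t * Complex.I) *
      ∫ x : ℝ, Complex.exp (-(s * x * Complex.I)) * h x) atTop (𝓝 0) := by
  set H : ℝ → ℂ := fun x => h x / ((t - x : ℝ) : ℂ) with hH
  -- integrating first in `s` produces the factor `1 / (t - x)`
  have hswap : ∀ R : ℝ, 0 < R → ∫ s in (-R)..R, Complex.exp (s * t * Complex.I) *
      ∫ x : ℝ, Complex.exp (-(s * x * Complex.I)) * h x =
      (Complex.exp (R * t * Complex.I) / Complex.I) *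
        (∫ x : ℝ, Complex.exp (-(R * x * Complex.I)) * H x) -
      (Complex.exp (-(R * t * Complex.I)) / Complex.I) *
        ∫ x : ℝ, Complex.exp (R * x * Complex.I) * H x := by
    intro R hR
    have hi : ∀ (f : ℝ → ℂ), Integrable f → ∀ r : ℝ,
        Integrable fun x : ℝ => Complex.exp (r * x * Complex.I) * f x := by
      intro f hf r
      refine hf.bdd_mul (c := 1) (by fun_prop) (ae_of_all _ fun x => ?_)
      rw [← Complex.ofReal_mul, Complex.norm_exp_ofReal_mul_I]
    simp_rw [← integral_const_mul]
    rw [intervalIntegral_integral_swap, ← integral_sub]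
    · have h1 : ∀ᵐ x : ℝ, x ≠ t := compl_mem_ae_iff.2 (measure_singleton t)
      refine integral_congr_ae ?_
      filter_upwards [h1] with x hx
      have hne : ((t - x : ℝ) : ℂ) * Complex.I ≠ 0 := by
        refine mul_ne_zero ?_ Complex.I_ne_zero
        exact_mod_cast sub_ne_zero.2 hx.symm
      have h2 : ∀ s : ℝ, Complex.exp (s * t * Complex.I) *
          (Complex.exp (-(s * x * Complex.I)) * h x) =
          Complex.exp ((((t - x : ℝ) : ℂ) * Complex.I) * s) * h x := by
        intro s
        rw [← mul_assoc, ← Complex.exp_add]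
        congr 2
        push_cast; ring
      simp_rw [h2]
      rw [intervalIntegral.integral_mul_const, integral_exp_mul_complex hne]
      simp only [hH]
      have e1 : Complex.exp (((t - x : ℝ) : ℂ) * Complex.I * (R : ℝ)) =
          Complex.exp (R * t * Complex.I) * Complex.exp (-(R * x * Complex.I)) := by
        rw [← Complex.exp_add]; congr 1; push_cast; ring
      have e2 : Complex.exp (((t - x : ℝ) : ℂ) * Complex.I * ((-R : ℝ) : ℂ)) =
          Complex.exp (-(R * t * Complex.I)) * Complex.exp (R * x * Complex.I) := by
        rw [← Complex.exp_add]; congr 1; push_cast; ring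
      rw [e1, e2]
      have h3 : ((t - x : ℝ) : ℂ) ≠ 0 := left_ne_zero_of_mul hne
      have := Complex.I_ne_zero
      field_simp
    · have := (hi H hq (-R)).const_mul (Complex.exp (R * t * Complex.I) / Complex.I)
      refine this.congr (ae_of_all _ fun x => ?_)
      simp only; congr 3; push_cast; ring
    · exact (hi H hq R).const_mul _
    · have h1 : Integrable (fun p : ℝ × ℝ => h p.2)
          ((volume.restrict (uIoc (-R) R)).prod volume) := by
        have : IsFiniteMeasure (volume.restrict (uIoc (-R) R)) :=
          ⟨by simp [uIoc]⟩
        exact hh.comp_snd _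
      have h2 : Continuous fun p : ℝ × ℝ => Complex.exp (p.1 * t * Complex.I) *
        Complex.exp (-(p.1 * p.2 * Complex.I)) := by fun_prop
      refine (h1.bdd_mul (c := 1) h2.aestronglyMeasurable (ae_of_all _ fun p => ?_)).congr
        (ae_of_all _ fun p => ?_)
      · rw [norm_mul, ← Complex.ofReal_mul, Complex.norm_exp_ofReal_mul_I, one_mul,
          ← Complex.ofReal_mul, ← neg_mul, ← Complex.ofReal_neg, Complex.norm_exp_ofReal_mul_I]
      · simp only [Function.uncurry]; ring
  have hRL := Real.tendsto_integral_exp_smul_cocompact H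
  have hRL' : ∀ w : ℝ, ∫ v : ℝ, Real.fourierChar (-(v * w)) • H v =
      ∫ x : ℝ, Complex.exp (-(((2 * Real.pi * w : ℝ) : ℂ) * x * Complex.I)) * H x := by
    intro w
    refine integral_congr_ae (ae_of_all _ fun x => ?_)
    simp only [Circle.smul_def, Real.fourierChar_apply, smul_eq_mul]
    congr 2
    push_cast; ring
  simp_rw [hRL'] at hRL
  have hA : Tendsto (fun R : ℝ => ∫ x : ℝ, Complex.exp (-(R * x * Complex.I)) * H x) atTop (𝓝 0) := by
    have h1 : Tendsto (fun R : ℝ => R / (2 * Real.pi)) atTop (cocompact ℝ) :=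
      (tendsto_id.atTop_div_const (by positivity)).mono_right atTop_le_cocompact
    refine (hRL.comp h1).congr fun R => ?_
    simp only [Function.comp]
    rw [mul_div_cancel₀ _ (by positivity)]
  have hB : Tendsto (fun R : ℝ => ∫ x : ℝ, Complex.exp (R * x * Complex.I) * H x) atTop (𝓝 0) := by
    have h1 : Tendsto (fun R : ℝ => -R / (2 * Real.pi)) atTop (cocompact ℝ) :=
      (tendsto_neg_atTop_atBot.atBot_div_const (by positivity)).mono_right atBot_le_cocompact
    refine (hRL.comp h1).congr fun R => ?_
    simp only [Function.comp]
    rw [mul_div_cancel₀ _ (by positivity)]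
    push_cast
    simp only [neg_mul, neg_neg]
  have hbd : ∀ {u v : ℝ → ℂ}, (∀ R, ‖u R‖ ≤ 1) → Tendsto v atTop (𝓝 0) →
      Tendsto (fun R => u R * v R) atTop (𝓝 0) := by
    intro u v hu hv
    refine squeeze_zero_norm (fun R => ?_) (tendsto_zero_iff_norm_tendsto_zero.1 hv)
    rw [norm_mul]
    exact mul_le_of_le_one_left (norm_nonneg _) (hu R)
  have hfin := (hbd (u := fun R => Complex.exp (R * t * Complex.I) / Complex.I) (fun R => by
      rw [norm_div, Complex.norm_I, ← Complex.ofReal_mul, Complex.norm_exp_ofReal_mul_I]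
      norm_num) hA).sub
    (hbd (u := fun R => Complex.exp (-(R * t * Complex.I)) / Complex.I) (fun R => by
      rw [norm_div, Complex.norm_I, ← Complex.ofReal_mul, ← neg_mul, ← Complex.ofReal_neg,
        Complex.norm_exp_ofReal_mul_I]
      norm_num) hB)
  rw [sub_zero] at hfin
  refine hfin.congr' ?_
  filter_upwards [eventually_gt_atTop 0] with R hR
  exact (hswap R hR).symm

/-- Fourier inversion, as a principal value, at a point of differentiability of an integrable
function. Subtracting a Gaussian with the same value reduces to the case of value zero. -/
theorem tendsto_fourier_truncated {f : ℝ → ℂ} {t : ℝ} (hf : Integrable f)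
    (hd : DifferentiableAt ℝ f t) :
    Tendsto (fun R : ℝ => (1 / (2 * (Real.pi : ℂ))) * ∫ s in (-R)..R,
      Complex.exp (s * t * Complex.I) * ∫ x : ℝ, Complex.exp (-(s * x * Complex.I)) * f x)
      atTop (𝓝 (f t)) := by
  set g : ℝ → ℂ := fun x => f t * ((Real.exp (-(1 / 2) * (x - t) ^ 2) : ℝ) : ℂ) with hg
  have hgi : Integrable g :=
    (((integrable_exp_neg_mul_sq (b := 1 / 2) (by norm_num)).comp_sub_right t).ofReal).const_mul _
  have hgd : DifferentiableAt ℝ g t := by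
    have : Differentiable ℝ fun x : ℝ => Real.exp (-(1 / 2) * (x - t) ^ 2) := by fun_prop
    exact (((this t).hasDerivAt.ofReal_comp).const_mul (f t)).differentiableAt
  have hgt : g t = f t := by simp [hg]
  -- the quotient is bounded near `t` by differentiability and dominated by `f - g` away from `t`
  have hzero : Integrable fun x => (f x - g x) / ((t - x : ℝ) : ℂ) := by
    have hd' : DifferentiableAt ℝ (fun x => f x - g x) t := hd.sub hgd
    have hO := hd'.isBigO_sub
    simp only [hgt, sub_self, sub_zero] at hO
    obtain ⟨C, hC⟩ := hO.bound
    obtain ⟨ε, hε, hball⟩ := Metric.eventually_nhds_iff.1 hC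
    have hC0 : 0 ≤ |C| := abs_nonneg C
    have hm : AEStronglyMeasurable (fun x => (f x - g x) / ((t - x : ℝ) : ℂ)) volume :=
      ((hf.sub hgi).aestronglyMeasurable.aemeasurable.div (Complex.measurable_ofReal.comp
        (measurable_const.sub measurable_id)).aemeasurable).aestronglyMeasurable
    have hb : Integrable (fun x => ε⁻¹ * ‖f x - g x‖ +
        (Metric.ball t ε).indicator (fun _ => |C|) x) :=
      ((hf.sub hgi).norm.const_mul _).add
        ((integrable_indicator_iff measurableSet_ball).2
          (integrableOn_const measure_ball_lt_top.ne))
    refine hb.mono' hm (ae_of_all _ fun x => ?_)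
    rw [norm_div, Complex.norm_real]
    by_cases hx : x ∈ Metric.ball t ε
    · rw [indicator_of_mem hx]
      have h1 := hball (Metric.mem_ball.1 hx)
      have h2 : ‖f x - g x‖ / ‖t - x‖ ≤ |C| := by
        refine div_le_of_le_mul₀ (norm_nonneg _) hC0 ?_
        rw [norm_sub_rev t x]
        exact h1.trans (mul_le_mul_of_nonneg_right (le_abs_self C) (norm_nonneg _))
      have : 0 ≤ ε⁻¹ * ‖f x - g x‖ := by positivity
      linarith
    · rw [indicator_of_notMem hx, add_zero, div_eq_inv_mul]
      rw [Metric.mem_ball, not_lt, dist_comm, Real.dist_eq] at hx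
      gcongr
      exact hx
  have h1 := tendsto_fourier_truncated_zero (hf.sub hgi) hzero
  have hgF : ∀ s : ℝ, Complex.exp (s * t * Complex.I) *
      ∫ x : ℝ, Complex.exp (-(s * x * Complex.I)) * g x =
      f t * ((Real.sqrt (2 * Real.pi) : ℝ) : ℂ) * ((Real.exp (-(1 / 2) * s ^ 2) : ℝ) : ℂ) := by
    intro s
    have h2 := fourierIntegral_gaussian (b := 1 / 2) (by norm_num) (-(s : ℂ))
    have h3 : ∫ x : ℝ, Complex.exp (-(s * x * Complex.I)) * g x =
        ∫ x : ℝ, (f t * Complex.exp (-(s * t * Complex.I))) *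
          (Complex.exp (Complex.I * (-(s : ℂ)) * x) * Complex.exp (-(1 / 2) * (x : ℂ) ^ 2)) := by
      rw [← integral_sub_right_eq_self (fun x : ℝ => (f t * Complex.exp (-(s * t * Complex.I))) *
          (Complex.exp (Complex.I * (-(s : ℂ)) * x) * Complex.exp (-(1 / 2) * (x : ℂ) ^ 2))) t]
      refine integral_congr_ae (ae_of_all _ fun x => ?_)
      simp only [hg]
      have e1 : Complex.exp (-(s * x * Complex.I)) = Complex.exp (-(s * t * Complex.I)) *
          Complex.exp (Complex.I * (-(s : ℂ)) * ((x - t : ℝ) : ℂ)) := by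
        rw [← Complex.exp_add]; congr 1; push_cast; ring
      rw [e1]; push_cast; ring
    rw [h3, integral_const_mul, h2]
    have e2 : ((Real.pi : ℂ) / (1 / 2)) ^ (1 / 2 : ℂ) = ((Real.sqrt (2 * Real.pi) : ℝ) : ℂ) := by
      rw [Real.sqrt_eq_rpow, Complex.ofReal_cpow (by positivity)]
      congr 1
      · push_cast; ring
      · push_cast; ring
    have e3 : Complex.exp (s * t * Complex.I) * Complex.exp (-(s * t * Complex.I)) = 1 := by
      rw [← Complex.exp_add, add_neg_cancel, Complex.exp_zero]
    rw [e2]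
    have e4 : -(-(s : ℂ)) ^ 2 / (4 * (1 / 2)) = ((-(1 / 2) * s ^ 2 : ℝ) : ℂ) := by
      push_cast; ring
    rw [e4, ← Complex.ofReal_exp]
    linear_combination (f t * ((Real.sqrt (2 * Real.pi) : ℝ) : ℂ) *
      ((Real.exp (-(1 / 2) * s ^ 2) : ℝ) : ℂ)) * e3
  have h2 : Tendsto (fun R : ℝ => ∫ s in (-R)..R, Complex.exp (s * t * Complex.I) *
      ∫ x : ℝ, Complex.exp (-(s * x * Complex.I)) * g x) atTop (𝓝 (f t * (2 * Real.pi))) := by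
    simp_rw [hgF]
    have h3 : Integrable fun s : ℝ => f t * ((Real.sqrt (2 * Real.pi) : ℝ) : ℂ) *
        ((Real.exp (-(1 / 2) * s ^ 2) : ℝ) : ℂ) :=
      ((integrable_exp_neg_mul_sq (b := 1 / 2) (by norm_num)).ofReal).const_mul _
    have h4 := intervalIntegral_tendsto_integral h3 tendsto_neg_atTop_atBot tendsto_id
    rw [integral_const_mul, integral_complex_ofReal, integral_gaussian] at h4
    rw [mul_assoc, ← Complex.ofReal_mul, show Real.pi / (1 / 2) = 2 * Real.pi by ring,
      Real.mul_self_sqrt (by positivity)] at h4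
    push_cast at h4
    push_cast
    exact h4
  have hcont : ∀ (u : ℝ → ℂ), Integrable u → Continuous fun s : ℝ =>
      Complex.exp (s * t * Complex.I) * ∫ x : ℝ, Complex.exp (-(s * x * Complex.I)) * u x := by
    intro u hu
    refine Continuous.mul (by fun_prop) (continuous_iff_continuousAt.2 fun s => ?_)
    refine continuousAt_of_dominated (bound := fun x => ‖u x‖) ?_ ?_ hu.norm ?_
    · exact Eventually.of_forall fun s => AEStronglyMeasurable.mul (by fun_prop)
        hu.aestronglyMeasurable
    · refine Eventually.of_forall fun s => ae_of_all _ fun x => ?_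
      rw [norm_mul, ← Complex.ofReal_mul, ← neg_mul, ← Complex.ofReal_neg,
        Complex.norm_exp_ofReal_mul_I, one_mul]
    · exact ae_of_all _ fun x => by fun_prop
  have h5 := ((h1.add h2).const_mul (1 / (2 * (Real.pi : ℂ))))
  have hpi : (Real.pi : ℂ) ≠ 0 := by exact_mod_cast Real.pi_ne_zero
  rw [zero_add, show 1 / (2 * (Real.pi : ℂ)) * (f t * (2 * Real.pi)) = f t by field_simp] at h5
  refine h5.congr fun R => ?_
  congr 1
  rw [← intervalIntegral.integral_add ((hcont _ (hf.sub hgi)).intervalIntegrable _ _)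
    ((hcont _ hgi).intervalIntegrable _ _)]
  refine intervalIntegral.integral_congr fun s _ => ?_
  rw [← mul_add, ← integral_add]
  · congr 1
    refine integral_congr_ae (ae_of_all _ fun x => ?_)
    simp only [Pi.sub_apply]; ring
  all_goals
    refine Integrable.bdd_mul (c := 1) ?_ (by fun_prop) (ae_of_all _ fun x => ?_)
    · first | exact hf.sub hgi | exact hgi
    · rw [← Complex.ofReal_mul, ← neg_mul, ← Complex.ofReal_neg, Complex.norm_exp_ofReal_mul_I]

/-! ### Laplace transforms in the complex domain -/

theorem IsCausal.integrable_cexp {K : ℝ → ℂ} {σ : ℝ} (hK : IsCausal K σ) {ζ : ℂ} (hζ : σ < ζ.re) :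
    Integrable fun t : ℝ => Complex.exp (-(ζ * t)) * K t := by
  refine (hK.integrable _ hζ).mono ?_ (ae_of_all _ fun t => ?_)
  · exact AEStronglyMeasurable.mul (by fun_prop) hK.measurable.aestronglyMeasurable
  · rw [norm_mul, norm_mul, Complex.norm_exp, Complex.norm_real,
      Real.norm_of_nonneg (Real.exp_pos _).le]
    simp

theorem IsCausal.differentiableOn_laplace {K : ℝ → ℂ} {σ : ℝ} (hK : IsCausal K σ) :
    DifferentiableOn ℂ (fun ζ : ℂ => ∫ t : ℝ, Complex.exp (-(ζ * t)) * K t) {ζ | σ < ζ.re} := by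
  intro ζ hζ
  have hζ : σ < ζ.re := hζ
  refine DifferentiableAt.differentiableWithinAt ?_
  set d : ℝ := (ζ.re - σ) / 4 with hd
  have hd0 : 0 < d := by rw [hd]; linarith
  have hs : {z : ℂ | σ + 2 * d < z.re} ∈ 𝓝 ζ :=
    (isOpen_lt continuous_const Complex.continuous_re).mem_nhds (by
      simp only [mem_ofPred_eq]; rw [hd]; linarith)
  refine (hasDerivAt_integral_of_dominated_loc_of_deriv_le (𝕜 := ℂ)
    (F' := fun z t => -(t : ℂ) * Complex.exp (-(z * t)) * K t)
    (bound := fun t => d⁻¹ * ‖((Real.exp (-((σ + d) * t)) : ℝ) : ℂ) * K t‖) hs ?_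
    (hK.integrable_cexp hζ) ?_ ?_ ?_ ?_).2.differentiableAt
  · exact Eventually.of_forall fun z =>
      AEStronglyMeasurable.mul (by fun_prop) hK.measurable.aestronglyMeasurable
  · exact AEStronglyMeasurable.mul (by fun_prop) hK.measurable.aestronglyMeasurable
  · refine ae_of_all _ fun t z hz => ?_
    have hz : σ + 2 * d < z.re := hz
    rcases le_or_gt t 0 with ht | ht
    · rw [hK.eq_zero t ht]; simp
    rw [norm_mul, norm_mul, norm_mul, norm_neg, Complex.norm_real, Complex.norm_real,
      Complex.norm_exp, Real.norm_of_nonneg ht.le, Real.norm_of_nonneg (Real.exp_pos _).le,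
      ← mul_assoc]
    refine mul_le_mul_of_nonneg_right ?_ (norm_nonneg _)
    have h1 : (-(z * (t : ℂ))).re = -(z.re * t) := by simp
    rw [h1]
    have h2 : d * t ≤ Real.exp (d * t) := by have := Real.add_one_le_exp (d * t); linarith
    have h3 : Real.exp (d * t) * Real.exp (-(z.re * t)) ≤ Real.exp (-((σ + d) * t)) := by
      rw [← Real.exp_add]
      exact Real.exp_le_exp.2 (by nlinarith)
    rw [← div_eq_inv_mul, le_div_iff₀ hd0]
    calc _ = d * t * Real.exp (-(z.re * t)) := by ring
      _ ≤ Real.exp (d * t) * Real.exp (-(z.re * t)) := by gcongr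
      _ ≤ _ := h3
  · exact ((hK.integrable _ (by linarith)).norm.const_mul _)
  · refine ae_of_all _ fun t z _ => ?_
    have h1 : HasDerivAt (fun z : ℂ => -(z * (t : ℂ))) (-(t : ℂ)) z := by
      simpa using ((hasDerivAt_id z).mul_const (t : ℂ)).fun_neg
    refine (h1.cexp.mul_const (K t)).congr_deriv ?_
    ring

/-- Inversion of absolutely convergent Laplace transforms at points of differentiability. -/
theorem IsCausal.tendsto_inverse_laplace {K : ℝ → ℂ} {σ : ℝ} (hK : IsCausal K σ) {d t : ℝ}
    (hd : σ < d) (ht : DifferentiableAt ℝ K t) :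
    Tendsto (fun R : ℝ => (1 / (2 * (Real.pi : ℂ))) * ∫ s in (-R)..R,
      Complex.exp ((t : ℂ) * ((d : ℂ) + (s : ℂ) * Complex.I)) *
        ∫ x : ℝ, Complex.exp (-(((d : ℂ) + (s : ℂ) * Complex.I) * x)) * K x)
      atTop (𝓝 (K t)) := by
  have h1 := tendsto_fourier_truncated (t := t) (hK.integrable d hd) (by
    have h2 : DifferentiableAt ℝ (fun t : ℝ => ((Real.exp (-(d * t)) : ℝ) : ℂ)) t := by
      have := (hasDerivAt_exp_mul (-d) t).differentiableAt
      simpa only [neg_mul] using this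
    exact h2.mul ht)
  have h2 := h1.const_mul ((Real.exp (d * t) : ℝ) : ℂ)
  have e0 : ((Real.exp (d * t) : ℝ) : ℂ) * (((Real.exp (-(d * t)) : ℝ) : ℂ) * K t) = K t := by
    rw [← mul_assoc, ← Complex.ofReal_mul, ← Real.exp_add]; simp
  rw [e0] at h2
  refine h2.congr fun R => ?_
  rw [mul_left_comm, ← intervalIntegral.integral_const_mul]
  congr 1
  refine intervalIntegral.integral_congr fun s _ => ?_
  rw [← mul_assoc]
  congr 1
  · rw [Complex.ofReal_exp, ← Complex.exp_add]; congr 1; push_cast; ring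
  · refine integral_congr_ae (ae_of_all _ fun x => ?_)
    simp only
    rw [← mul_assoc, Complex.ofReal_exp, ← Complex.exp_add]; congr 2; push_cast; ring

/-! ### The inverse Laplace transform of the symbol -/

/-- The Gamma function grows faster than every exponential: estimate its integral from below over
`[A, A + 1]`. -/
theorem inv_Gamma_le {A u : ℝ} (hA : 1 ≤ A) (hu : 0 < u) :
    (Real.Gamma u)⁻¹ ≤ (A + 1) * Real.exp (A + 1) * Real.exp (-(Real.log A * u)) := by
  have hA0 : 0 < A := by linarith
  have hlow : Real.exp (Real.log A * u) * ((A + 1)⁻¹ * Real.exp (-(A + 1))) ≤ Real.Gamma u := by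
    rw [Real.Gamma_eq_integral hu]
    have hi := Real.GammaIntegral_convergent hu
    have hsub : Icc A (A + 1) ⊆ Ioi 0 := fun x hx => lt_of_lt_of_le hA0 hx.1
    calc _ = ∫ _ in Icc A (A + 1), Real.exp (Real.log A * u) *
          ((A + 1)⁻¹ * Real.exp (-(A + 1))) := by simp
      _ ≤ ∫ x in Icc A (A + 1), Real.exp (-x) * x ^ (u - 1) := by
        refine setIntegral_mono_on (integrableOn_const measure_Icc_lt_top.ne) (hi.mono_set hsub)
          measurableSet_Icc fun x hx => ?_
        have hx0 : 0 < x := hsub hx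
        have h1 : Real.exp (Real.log A * u) ≤ x ^ u := by
          rw [← Real.rpow_def_of_pos hA0]
          exact Real.rpow_le_rpow hA0.le hx.1 hu.le
        have h2 : (A + 1)⁻¹ ≤ x⁻¹ := inv_anti₀ hx0 hx.2
        have h3 : Real.exp (-(A + 1)) ≤ Real.exp (-x) := Real.exp_le_exp.2 (by linarith [hx.2])
        rw [Real.rpow_sub_one hx0.ne', div_eq_mul_inv]
        calc _ ≤ x ^ u * (x⁻¹ * Real.exp (-x)) := by gcongr
          _ = _ := by ring
      _ ≤ _ := setIntegral_mono_set hi (by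
          filter_upwards [ae_restrict_mem measurableSet_Ioi] with x hx
          exact mul_nonneg (Real.exp_pos _).le (Real.rpow_nonneg (le_of_lt hx) _))
          hsub.eventuallyLE
  have hpos : 0 < Real.exp (Real.log A * u) * ((A + 1)⁻¹ * Real.exp (-(A + 1))) := by positivity
  refine (inv_anti₀ hpos hlow).trans (le_of_eq ?_)
  rw [mul_inv, mul_inv, inv_inv, ← Real.exp_neg, ← Real.exp_neg, neg_neg]
  ring

/-- The integrand `e^{-2κu} t^{u-1} / Γ(u)`. -/
def volterraIntegrand (κ t u : ℝ) : ℝ := Real.exp (-(2 * κ * u)) * t ^ (u - 1) * (Real.Gamma u)⁻¹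

/-- The function `2 ∫₀^∞ e^{-2κu} t^{u-1} / Γ(u) du` on `t > 0`, extended by zero. Since the
Laplace transform of `t^{u-1} / Γ(u)` is `ζ^{-u}`, its Laplace transform is
`2 / (log ζ + 2κ)`. -/
def volterraKernel (κ t : ℝ) : ℝ :=
  if 0 < t then 2 * ∫ u in Ioi 0, volterraIntegrand κ t u else 0

theorem continuousOn_volterraIntegrand (κ : ℝ) :
    ContinuousOn (fun p : ℝ × ℝ => volterraIntegrand κ p.1 p.2) (Ioi 0 ×ˢ Ioi 0) := by
  unfold volterraIntegrand
  refine ContinuousOn.mul (ContinuousOn.mul (by fun_prop) ?_) ?_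
  · exact ContinuousOn.rpow (by fun_prop) (by fun_prop) fun p hp => Or.inl (ne_of_gt hp.1)
  · refine ContinuousOn.inv₀ (fun p hp => ?_) fun p hp => (Real.Gamma_pos_of_pos hp.2).ne'
    have h1 : ContinuousAt Real.Gamma p.2 := (Real.differentiableAt_Gamma fun m h => by
      have h2 : 0 < p.2 := hp.2
      have h3 : (0 : ℝ) ≤ m := m.cast_nonneg
      linarith).continuousAt
    exact (h1.comp continuousAt_snd).continuousWithinAt

theorem volterraIntegrand_nonneg {κ t u : ℝ} (ht : 0 < t) (hu : 0 < u) :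
    0 ≤ volterraIntegrand κ t u :=
  mul_nonneg (by positivity) (inv_nonneg.2 (Real.Gamma_pos_of_pos hu).le)

/-- Locally uniform exponential domination of the integrand and its `t`-derivative. -/
theorem volterraIntegrand_bound (κ : ℝ) {t₀ : ℝ} (h0 : 0 < t₀) : ∃ C : ℝ,
    ∀ t ∈ Ioo (t₀ / 2) (2 * t₀), ∀ u : ℝ, 0 < u →
      volterraIntegrand κ t u ≤ C * Real.exp (-u) ∧
      |Real.exp (-(2 * κ * u)) * ((u - 1) * t ^ (u - 1 - 1)) * (Real.Gamma u)⁻¹| ≤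
        C * Real.exp (-u) := by
  -- `A` is chosen so that `A^{-u}` beats `e^{-2κu} (2 t₀)^u e^{2u}`; one factor `e^u` absorbs
  -- `|u - 1|`
  set A : ℝ := max 1 (Real.exp (2 + Real.log (2 * t₀) - 2 * κ)) with hAd
  have hA : 1 ≤ A := le_max_left _ _
  have hlA : 2 + Real.log (2 * t₀) - 2 * κ ≤ Real.log A := by
    rw [Real.le_log_iff_exp_le (by linarith)]
    exact le_max_right _ _
  set D : ℝ := (A + 1) * Real.exp (A + 1) with hD
  have hD0 : 0 < D := by positivity
  refine ⟨D * (t₀ / 2)⁻¹ + D * ((t₀ / 2)⁻¹ * (t₀ / 2)⁻¹), fun t ht u hu => ?_⟩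
  have ht0 : 0 < t := by linarith [ht.1]
  have hg := inv_Gamma_le hA hu
  have hg0 : 0 ≤ (Real.Gamma u)⁻¹ := inv_nonneg.2 (Real.Gamma_pos_of_pos hu).le
  have hti : t⁻¹ ≤ (t₀ / 2)⁻¹ := inv_anti₀ (by linarith) ht.1.le
  have htu : t ^ u ≤ Real.exp (Real.log (2 * t₀) * u) := by
    rw [← Real.rpow_def_of_pos (by linarith)]
    exact Real.rpow_le_rpow ht0.le ht.2.le hu.le
  have hkey : Real.exp (-(2 * κ * u)) * Real.exp u * Real.exp (Real.log (2 * t₀) * u) *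
      Real.exp (-(Real.log A * u)) ≤ Real.exp (-u) := by
    rw [← Real.exp_add, ← Real.exp_add, ← Real.exp_add]
    refine Real.exp_le_exp.2 ?_
    have := mul_le_mul_of_nonneg_right hlA hu.le
    linarith
  have hu1 : |u - 1| ≤ Real.exp u := by
    have := Real.add_one_le_exp u
    rw [abs_le]; constructor <;> linarith
  have h1u : 1 ≤ Real.exp u := Real.one_le_exp hu.le
  have hq : 0 < (t₀ / 2)⁻¹ := by positivity
  have hE := Real.exp_pos (-u)
  constructor
  · unfold volterraIntegrand
    rw [Real.rpow_sub_one ht0.ne', div_eq_mul_inv]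
    calc _ ≤ Real.exp (-(2 * κ * u)) * (Real.exp (Real.log (2 * t₀) * u) * (t₀ / 2)⁻¹) *
          (D * Real.exp (-(Real.log A * u))) := by gcongr
      _ = (D * (t₀ / 2)⁻¹) * (Real.exp (-(2 * κ * u)) * 1 *
          Real.exp (Real.log (2 * t₀) * u) * Real.exp (-(Real.log A * u))) := by ring
      _ ≤ (D * (t₀ / 2)⁻¹) * (Real.exp (-(2 * κ * u)) * Real.exp u *
          Real.exp (Real.log (2 * t₀) * u) * Real.exp (-(Real.log A * u))) := by gcongr
      _ ≤ (D * (t₀ / 2)⁻¹) * Real.exp (-u) := by gcongr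
      _ ≤ _ := by
        gcongr
        exact le_add_of_nonneg_right (by positivity)
  · rw [Real.rpow_sub_one ht0.ne', Real.rpow_sub_one ht0.ne', abs_mul, abs_mul, abs_mul,
      abs_of_nonneg hg0, abs_of_pos (Real.exp_pos _),
      abs_of_nonneg (by positivity : 0 ≤ t ^ u / t / t),
      div_eq_mul_inv, div_eq_mul_inv]
    calc _ ≤ Real.exp (-(2 * κ * u)) * (Real.exp u *
          (Real.exp (Real.log (2 * t₀) * u) * (t₀ / 2)⁻¹ * (t₀ / 2)⁻¹)) *
          (D * Real.exp (-(Real.log A * u))) := by gcongr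
      _ = (D * ((t₀ / 2)⁻¹ * (t₀ / 2)⁻¹)) * (Real.exp (-(2 * κ * u)) * Real.exp u *
          Real.exp (Real.log (2 * t₀) * u) * Real.exp (-(Real.log A * u))) := by ring
      _ ≤ (D * ((t₀ / 2)⁻¹ * (t₀ / 2)⁻¹)) * Real.exp (-u) := by gcongr
      _ ≤ _ := by
        gcongr
        exact le_add_of_nonneg_left (by positivity)

theorem aestronglyMeasurable_volterraIntegrand (κ : ℝ) {t : ℝ} (ht : 0 < t) :
    AEStronglyMeasurable (volterraIntegrand κ t) (volume.restrict (Ioi 0)) :=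
  ((continuousOn_volterraIntegrand κ).comp (f := fun u : ℝ => (t, u)) (by fun_prop)
    fun _ hu => ⟨ht, hu⟩).aestronglyMeasurable measurableSet_Ioi

theorem differentiableAt_volterraKernel (κ : ℝ) {t : ℝ} (ht : 0 < t) :
    DifferentiableAt ℝ (volterraKernel κ) t := by
  obtain ⟨C, hC⟩ := volterraIntegrand_bound κ ht
  have hs : Ioo (t / 2) (2 * t) ∈ 𝓝 t := Ioo_mem_nhds (by linarith) (by linarith)
  have hpos : ∀ x ∈ Ioo (t / 2) (2 * t), 0 < x := fun x hx => by linarith [hx.1]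
  have hb : IntegrableOn (fun u : ℝ => C * Real.exp (-u)) (Ioi 0) :=
    (integrableOn_exp_neg_Ioi 0).const_mul C
  have hd := (hasDerivAt_integral_of_dominated_loc_of_deriv_le (𝕜 := ℝ)
    (μ := volume.restrict (Ioi 0)) (F := volterraIntegrand κ)
    (F' := fun t u => Real.exp (-(2 * κ * u)) * ((u - 1) * t ^ (u - 1 - 1)) * (Real.Gamma u)⁻¹)
    (bound := fun u => C * Real.exp (-u)) hs ?_ ?_ ?_ ?_ hb ?_).2
  · refine ((hd.const_mul 2).differentiableAt).congr_of_eventuallyEq ?_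
    filter_upwards [lt_mem_nhds ht] with x hx
    rw [volterraKernel, if_pos hx]
  · filter_upwards [lt_mem_nhds ht] with x hx
    exact aestronglyMeasurable_volterraIntegrand κ hx
  · refine hb.mono' (aestronglyMeasurable_volterraIntegrand κ ht) ?_
    filter_upwards [ae_restrict_mem measurableSet_Ioi] with u hu
    rw [Real.norm_of_nonneg (volterraIntegrand_nonneg ht hu)]
    exact (hC t ⟨by linarith, by linarith⟩ u hu).1
  · refine ContinuousOn.aestronglyMeasurable ?_ measurableSet_Ioi
    refine ContinuousOn.mul (ContinuousOn.mul (by fun_prop) (ContinuousOn.mul (by fun_prop) ?_)) ?_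
    · exact ContinuousOn.rpow (by fun_prop) (by fun_prop) fun _ _ => Or.inl ht.ne'
    · refine ContinuousOn.inv₀ (fun p hp => ?_) fun p hp => (Real.Gamma_pos_of_pos hp).ne'
      exact (Real.differentiableAt_Gamma fun m h => by
        have h2 : 0 < p := hp
        have h3 : (0 : ℝ) ≤ m := m.cast_nonneg
        linarith).continuousAt.continuousWithinAt
  · filter_upwards [ae_restrict_mem measurableSet_Ioi] with u hu x hx
    exact (hC x hx u hu).2
  · refine ae_of_all _ fun u x hx => ?_
    exact (((Real.hasDerivAt_rpow_const (Or.inl (hpos x hx).ne')).const_mul _).mul_const _)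

theorem measurable_volterraKernel (κ : ℝ) : Measurable (volterraKernel κ) := by
  have h1 : ContinuousOn (volterraKernel κ) (Ioi 0) := fun t ht =>
    (differentiableAt_volterraKernel κ ht).continuousAt.continuousWithinAt
  have h2 : volterraKernel κ = (Ioi 0).indicator (volterraKernel κ) := by
    funext t
    by_cases ht : t ∈ Ioi (0 : ℝ)
    · rw [indicator_of_mem ht]
    · rw [indicator_of_notMem ht, volterraKernel, if_neg (show ¬0 < t from ht)]
  rw [h2, ← piecewise_eq_indicator]
  exact h1.measurable_piecewise continuousOn_const measurableSet_Ioi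

/-- The Laplace transform of the kernel on the real axis, by Tonelli's theorem. -/
theorem laplace_volterraKernel (κ : ℝ) {l : ℝ} (hl : Real.exp (-2 * κ) < l) :
    Integrable (fun t => Real.exp (-(l * t)) * volterraKernel κ t) ∧
    ∫ t, Real.exp (-(l * t)) * volterraKernel κ t = (Real.log l / 2 + κ)⁻¹ := by
  have hl0 : 0 < l := (Real.exp_pos _).trans hl
  have hlog : 0 < Real.log l + 2 * κ := by
    have := (Real.lt_log_iff_exp_lt hl0).2 hl
    linarith
  have hin : ∀ u : ℝ, 0 < u → ∫ t in Ioi 0, Real.exp (-(l * t)) * volterraIntegrand κ t u =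
      Real.exp (-(Real.log l + 2 * κ) * u) := by
    intro u hu
    have h1 := Real.integral_rpow_mul_exp_neg_mul_Ioi hu hl0
    have h2 : ∀ t : ℝ, Real.exp (-(l * t)) * volterraIntegrand κ t u =
        (Real.exp (-(2 * κ * u)) * (Real.Gamma u)⁻¹) * (t ^ (u - 1) * Real.exp (-(l * t))) := by
      intro t; rw [volterraIntegrand]; ring
    simp_rw [h2]
    rw [integral_const_mul, h1, one_div, Real.inv_rpow hl0.le, Real.rpow_def_of_pos hl0,
      ← Real.exp_neg]
    have hG := (Real.Gamma_pos_of_pos hu).ne'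
    calc _ = Real.exp (-(2 * κ * u)) * Real.exp (-(Real.log l * u)) *
          ((Real.Gamma u)⁻¹ * Real.Gamma u) := by ring
      _ = _ := by
        rw [inv_mul_cancel₀ hG, mul_one, ← Real.exp_add]; congr 1; ring
  have hint : Integrable (fun p : ℝ × ℝ => Real.exp (-(l * p.1)) * volterraIntegrand κ p.1 p.2)
      ((volume.restrict (Ioi 0)).prod (volume.restrict (Ioi 0))) := by
    have hm : AEStronglyMeasurable
        (fun p : ℝ × ℝ => Real.exp (-(l * p.1)) * volterraIntegrand κ p.1 p.2)
        ((volume.restrict (Ioi 0)).prod (volume.restrict (Ioi 0))) := by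
      rw [Measure.prod_restrict]
      exact ((by fun_prop : ContinuousOn (fun p : ℝ × ℝ => Real.exp (-(l * p.1)))
        (Ioi 0 ×ˢ Ioi 0)).mul (continuousOn_volterraIntegrand κ)).aestronglyMeasurable
        (measurableSet_Ioi.prod measurableSet_Ioi)
    rw [integrable_prod_iff' hm]
    constructor
    · filter_upwards [ae_restrict_mem measurableSet_Ioi] with u hu
      refine Integrable.of_integral_ne_zero ?_
      rw [hin u hu]; positivity
    · have : Integrable (fun u : ℝ => Real.exp (-(Real.log l + 2 * κ) * u))
          (volume.restrict (Ioi 0)) := integrableOn_exp_mul_Ioi (by linarith) 0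
      refine this.congr ?_
      filter_upwards [ae_restrict_mem measurableSet_Ioi] with u hu
      rw [← hin u hu]
      refine setIntegral_congr_fun measurableSet_Ioi fun t ht => ?_
      exact (Real.norm_of_nonneg (mul_nonneg (Real.exp_pos _).le
        (volterraIntegrand_nonneg ht hu))).symm
  have hK : ∀ t ∈ Ioi (0 : ℝ), ∫ u in Ioi 0, Real.exp (-(l * t)) * volterraIntegrand κ t u =
      2⁻¹ * (Real.exp (-(l * t)) * volterraKernel κ t) := by
    intro t ht
    rw [integral_const_mul, volterraKernel, if_pos (show 0 < t from ht)]; ring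
  have hsupp : (fun t => Real.exp (-(l * t)) * volterraKernel κ t) =
      (Ioi 0).indicator (fun t => Real.exp (-(l * t)) * volterraKernel κ t) := by
    funext t
    by_cases ht : t ∈ Ioi (0 : ℝ)
    · rw [indicator_of_mem ht]
    · rw [indicator_of_notMem ht, volterraKernel, if_neg (show ¬0 < t from ht), mul_zero]
  have h1 : IntegrableOn (fun t => Real.exp (-(l * t)) * volterraKernel κ t) (Ioi 0) := by
    have := (hint.integral_prod_left.const_mul 2)
    refine this.congr ?_
    filter_upwards [ae_restrict_mem measurableSet_Ioi] with t ht
    rw [hK t ht]; ring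
  constructor
  · rw [hsupp]
    exact h1.integrable_indicator measurableSet_Ioi
  · rw [hsupp, integral_indicator measurableSet_Ioi]
    have h2 : ∫ t in Ioi 0, 2⁻¹ * (Real.exp (-(l * t)) * volterraKernel κ t) =
        (Real.log l + 2 * κ)⁻¹ := by
      rw [← setIntegral_congr_fun measurableSet_Ioi hK, integral_integral_swap hint,
        setIntegral_congr_fun measurableSet_Ioi hin, integral_exp_mul_Ioi (by linarith)]
      rw [mul_zero, Real.exp_zero, neg_div_neg_eq, one_div]
    rw [integral_const_mul] at h2
    have h3 := hlog.ne'
    have h4 : Real.log l / 2 + κ ≠ 0 := by intro h; apply h3; linarith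
    field_simp at h2 ⊢
    linear_combination h2

theorem isCausal_volterraKernel (κ : ℝ) :
    IsCausal (fun t => (volterraKernel κ t : ℂ)) (Real.exp (-2 * κ)) where
  measurable := Complex.measurable_ofReal.comp (measurable_volterraKernel κ)
  eq_zero t ht := by rw [volterraKernel, if_neg (not_lt.2 ht), Complex.ofReal_zero]
  integrable l hl := by
    have := (laplace_volterraKernel κ hl).1.ofReal (𝕜 := ℂ)
    simpa only [Complex.coe_algebraMap, RCLike.ofReal_mul] using this

/-- The principal branches satisfy `log √ζ = (log ζ) / 2`. -/
theorem log_cpow_half {ζ : ℂ} (hζ : 0 < ζ.re) :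
    Complex.log (ζ ^ (1 / 2 : ℂ)) = Complex.log ζ / 2 := by
  have h0 : ζ ≠ 0 := fun h => by simp [h] at hζ
  rw [Complex.cpow_def_of_ne_zero h0, Complex.log_exp]
  · ring
  · have := Complex.neg_pi_lt_log_im ζ
    have h2 : (Complex.log ζ * (1 / 2)).im = (Complex.log ζ).im / 2 := by
      rw [show Complex.log ζ * (1 / 2) = Complex.log ζ / (2 : ℝ) by push_cast; ring,
        Complex.div_ofReal_im]
    rw [h2]; linarith [Real.pi_pos]
  · have := Complex.log_im_le_pi ζ
    have h2 : (Complex.log ζ * (1 / 2)).im = (Complex.log ζ).im / 2 := by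
      rw [show Complex.log ζ * (1 / 2) = Complex.log ζ / (2 : ℝ) by push_cast; ring,
        Complex.div_ofReal_im]
    rw [h2]; linarith [Real.pi_pos]

/-- The real part `log |ζ| / 2 + κ` is positive for `Re ζ > e^{-2κ}`. -/
theorem log_half_add_ne_zero {κ : ℝ} {ζ : ℂ} (hζ : Real.exp (-2 * κ) < ζ.re) :
    Complex.log ζ / 2 + κ ≠ 0 := by
  intro h
  have h1 := congrArg Complex.re h
  rw [Complex.add_re, Complex.ofReal_re, Complex.zero_re,
    show Complex.log ζ / 2 = Complex.log ζ / (2 : ℝ) by push_cast; ring,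
    Complex.div_ofReal_re, Complex.log_re] at h1
  have h2 : Real.exp (-2 * κ) < ‖ζ‖ := hζ.trans_le (Complex.re_le_norm ζ)
  have h3 := (Real.lt_log_iff_exp_lt ((Real.exp_pos _).trans h2)).2 h2
  linarith

theorem differentiableOn_symbol (θ : ℝ) :
    DifferentiableOn ℂ (symbol θ) {ζ | Real.exp (-2 * kappa θ) < ζ.re} := by
  have h1 : DifferentiableOn ℂ (fun ζ : ℂ => (Complex.log ζ / 2 + (kappa θ : ℂ))⁻¹)
      {ζ | Real.exp (-2 * kappa θ) < ζ.re} := by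
    refine DifferentiableOn.inv (DifferentiableOn.add (DifferentiableOn.div_const ?_ _)
      (differentiableOn_const _)) fun ζ hζ => log_half_add_ne_zero hζ
    refine differentiableOn_id.clog fun ζ hζ => Or.inl ?_
    exact (Real.exp_pos _).trans hζ
  refine h1.congr fun ζ hζ => ?_
  rw [symbol, log_cpow_half ((Real.exp_pos _).trans hζ)]

/-- The symbol is the Laplace transform of the Volterra kernel, by analytic continuation from the
real axis. -/
theorem laplace_volterraKernel_eq_symbol (θ : ℝ) {ζ : ℂ} (hζ : Real.exp (-2 * kappa θ) < ζ.re) :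
    ∫ t : ℝ, Complex.exp (-(ζ * t)) * (volterraKernel (kappa θ) t : ℂ) = symbol θ ζ := by
  set s : Set ℂ := {ζ | Real.exp (-2 * kappa θ) < ζ.re} with hs
  have hopen : IsOpen s := isOpen_lt continuous_const Complex.continuous_re
  have hconv : Convex ℝ s := (convex_Ioi (Real.exp (-2 * kappa θ))).is_linear_preimage
    Complex.reLm.isLinear
  have hf := (isCausal_volterraKernel (kappa θ)).differentiableOn_laplace.analyticOnNhd hopen
  have hg := (differentiableOn_symbol θ).analyticOnNhd hopen
  set x : ℝ := Real.exp (-2 * kappa θ) + 1 with hx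
  have hxs : (x : ℂ) ∈ s := by
    rw [hs, mem_ofPred_eq, Complex.ofReal_re, hx]; linarith
  refine hf.eqOn_of_preconnected_of_frequently_eq hg hconv.isPreconnected hxs ?_ hζ
  have htend : Tendsto (fun l : ℝ => (l : ℂ)) (𝓝[≠] x) (𝓝[≠] (x : ℂ)) :=
    Complex.continuous_ofReal.continuousAt.continuousWithinAt.tendsto_nhdsWithin
      fun l hl => by simpa using hl
  have hev : ∀ᶠ l : ℝ in 𝓝[≠] x,
      ∫ t : ℝ, Complex.exp (-((l : ℂ) * t)) * (volterraKernel (kappa θ) t : ℂ) =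
        symbol θ (l : ℂ) := by
    refine nhdsWithin_le_nhds ?_
    filter_upwards [lt_mem_nhds (by rw [hx]; linarith : Real.exp (-2 * kappa θ) < x)] with l hl
    have hl0 : 0 < l := (Real.exp_pos _).trans hl
    rw [symbol, log_cpow_half (by simpa using hl0), ← Complex.ofReal_log hl0.le]
    have := (laplace_volterraKernel (kappa θ) hl).2
    have h2 := congrArg (fun r : ℝ => (r : ℂ)) this
    rw [← integral_complex_ofReal] at h2
    push_cast at h2
    rw [← h2]
  exact htend.frequently hev.frequently

theorem isInverseLaplace_volterraKernel (θ : ℝ) :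
    IsInverseLaplace (symbol θ) (Real.exp (-2 * kappa θ))
      (fun t => (volterraKernel (kappa θ) t : ℂ)) := by
  refine ⟨(differentiableOn_symbol θ).analyticOnNhd
    (isOpen_lt continuous_const Complex.continuous_re), fun d hd t ht => ?_⟩
  have h1 := (isCausal_volterraKernel (kappa θ)).tendsto_inverse_laplace hd
    (differentiableAt_volterraKernel (kappa θ) ht).hasDerivAt.ofReal_comp.differentiableAt
  refine h1.congr fun R => ?_
  congr 1
  refine intervalIntegral.integral_congr fun s _ => ?_
  rw [laplace_volterraKernel_eq_symbol θ (by simpa using hd)]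

/-! ### Twofold integration of the radial equation -/

theorem memLp_sqrt_indicator (x : ℝ) :
    MemLp ((Ioc 0 x).indicator fun y => (Real.sqrt y : ℂ)) 2 halfLine := by
  have hfin : IsFiniteMeasure (halfLine.restrict (Ioc 0 x)) := ⟨by
    rw [Measure.restrict_apply_univ]
    exact (Measure.restrict_apply_le _ _).trans_lt measure_Ioc_lt_top⟩
  rw [memLp_indicator_iff_restrict measurableSet_Ioc]
  refine MemLp.of_bound (by fun_prop) (Real.sqrt x) ?_
  filter_upwards [ae_restrict_mem measurableSet_Ioc] with y hy
  rw [Complex.norm_real, Real.norm_of_nonneg (Real.sqrt_nonneg _)]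
  exact Real.sqrt_le_sqrt hy.2

/-- The vector `1_{(0,x]} √y` of `L²(0, ∞)`. -/
def cutVec (x : ℝ) : L2 := (memLp_sqrt_indicator x).toLp

/-- The integral `∫₀ˣ √y g(y) dy`. -/
def moment (g : L2) (x : ℝ) : ℂ := ∫ y in (0 : ℝ)..x, (Real.sqrt y : ℂ) * g y

theorem moment_eq_inner (g : L2) {x : ℝ} (hx : 0 ≤ x) : moment g x = inner ℂ (cutVec x) g := by
  rw [moment, intervalIntegral.integral_of_le hx, L2.inner_def]
  have h1 : ∫ y in Ioc 0 x, (Real.sqrt y : ℂ) * g y =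
      ∫ y in Ioc 0 x, (Real.sqrt y : ℂ) * g y ∂halfLine := by
    rw [Measure.restrict_restrict measurableSet_Ioc, inter_eq_left.2 Ioc_subset_Ioi_self]
  rw [h1, ← integral_indicator measurableSet_Ioc]
  refine integral_congr_ae ?_
  filter_upwards [(memLp_sqrt_indicator x).coeFn_toLp] with y hy
  rw [cutVec, hy, RCLike.inner_apply]
  by_cases h : y ∈ Ioc 0 x
  · rw [indicator_of_mem h, indicator_of_mem h, Complex.conj_ofReal, mul_comm]
  · rw [indicator_of_notMem h, indicator_of_notMem h, map_zero, mul_zero]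

theorem norm_cutVec_le {x : ℝ} (hx : 0 ≤ x) : ‖cutVec x‖ ≤ x := by
  have h : (‖cutVec x‖ : ℂ) ^ 2 = ((x ^ 2 / 2 : ℝ) : ℂ) := by
    have h0 := inner_self_eq_norm_sq_to_K (𝕜 := ℂ) (cutVec x)
    rw [← moment_eq_inner _ hx, moment] at h0
    refine h0.symm.trans ?_
    have h1 : ∫ y in (0 : ℝ)..x, (Real.sqrt y : ℂ) * cutVec x y = ∫ y in (0 : ℝ)..x, (y : ℂ) := by
      refine intervalIntegral.integral_congr_ae_restrict ?_
      rw [uIoc_of_le hx]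
      have h2 := (memLp_sqrt_indicator x).coeFn_toLp
      have h3 : volume.restrict (Ioc 0 x) ≤ halfLine := Measure.restrict_mono Ioc_subset_Ioi_self le_rfl
      filter_upwards [ae_mono h3 h2, ae_restrict_mem measurableSet_Ioc] with y hy hm
      rw [cutVec, hy, indicator_of_mem hm, ← Complex.ofReal_mul, Real.mul_self_sqrt hm.1.le]
    rw [h1, intervalIntegral.integral_ofReal, integral_id]
    simp
  have h1 : ‖cutVec x‖ ^ 2 = x ^ 2 / 2 := by exact_mod_cast h
  refine abs_le_of_sq_le_sq' ?_ hx |>.2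
  rw [h1]; nlinarith [sq_nonneg x]

theorem norm_moment_le (g : L2) {x : ℝ} (hx : 0 ≤ x) : ‖moment g x‖ ≤ x * ‖g‖ := by
  rw [moment_eq_inner g hx]
  exact (norm_inner_le_norm _ _).trans (mul_le_mul_of_nonneg_right (norm_cutVec_le hx)
    (norm_nonneg _))

theorem integrableOn_sqrt_mul (g : L2) (x : ℝ) :
    IntegrableOn (fun y => (Real.sqrt y : ℂ) * g y) (Ioc 0 x) := by
  have h := L2.integrable_inner (𝕜 := ℂ) (cutVec x) g
  have h3 : volume.restrict (Ioc 0 x) ≤ halfLine := Measure.restrict_mono Ioc_subset_Ioi_self le_rfl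
  refine (h.mono_measure h3).congr ?_
  filter_upwards [ae_mono h3 (memLp_sqrt_indicator x).coeFn_toLp, ae_restrict_mem measurableSet_Ioc]
    with y hy hm
  rw [cutVec, hy, RCLike.inner_apply, indicator_of_mem hm, Complex.conj_ofReal, mul_comm]

theorem continuousAt_moment (g : L2) {x : ℝ} (hx : 0 < x) : ContinuousAt (moment g) x := by
  have h : ContinuousOn (moment g) (uIcc 0 (x + 1)) := by
    refine intervalIntegral.continuousOn_primitive_interval ?_
    rw [uIcc_of_le (by linarith), integrableOn_Icc_iff_integrableOn_Ioc]
    exact integrableOn_sqrt_mul g _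
  refine h.continuousAt ?_
  rw [uIcc_of_le (by linarith)]
  exact Icc_mem_nhds hx (by linarith)

theorem norm_inv_mul_moment_le (g : L2) {x : ℝ} (hx : 0 < x) :
    ‖((x⁻¹ : ℝ) : ℂ) * moment g x‖ ≤ ‖g‖ := by
  rw [norm_mul, Complex.norm_real, norm_inv, Real.norm_of_nonneg hx.le, inv_mul_le_iff₀ hx]
  exact norm_moment_le g hx.le

theorem continuousOn_inv_mul_moment (g : L2) :
    ContinuousOn (fun x => ((x⁻¹ : ℝ) : ℂ) * moment g x) (Ioi 0) := by
  refine ContinuousOn.mul ?_ fun x hx => (continuousAt_moment g hx).continuousWithinAt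
  exact Complex.continuous_ofReal.comp_continuousOn
    (continuousOn_id.inv₀ fun x hx => ne_of_gt hx)

theorem intervalIntegrable_inv_mul_moment (g : L2) {x : ℝ} (hx : 0 ≤ x) :
    IntervalIntegrable (fun s => ((s⁻¹ : ℝ) : ℂ) * moment g s) volume 0 x := by
  rw [intervalIntegrable_iff_integrableOn_Ioc_of_le hx]
  refine (integrableOn_const (C := ‖g‖) (s := Ioc 0 x) measure_Ioc_lt_top.ne).mono' ?_ ?_
  · exact ((continuousOn_inv_mul_moment g).mono Ioc_subset_Ioi_self).aestronglyMeasurable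
      measurableSet_Ioc
  · filter_upwards [ae_restrict_mem measurableSet_Ioc] with s hs
    exact norm_inv_mul_moment_le g hs.1

/-- The twofold integral `∫₀ˣ s⁻¹ ∫₀ˢ √y g(y) dy ds`, that is, the solution `v` of
`(x v')' = √x g` with `v(0) = 0` and `x v' → 0`. -/
def twofold (g : L2) (x : ℝ) : ℂ := ∫ s in (0 : ℝ)..x, ((s⁻¹ : ℝ) : ℂ) * moment g s

theorem norm_twofold_le (g : L2) {x : ℝ} (hx : 0 ≤ x) : ‖twofold g x‖ ≤ x * ‖g‖ := by
  have := intervalIntegral.norm_integral_le_of_norm_le_const (a := (0 : ℝ)) (b := x) (C := ‖g‖)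
    (f := fun s => ((s⁻¹ : ℝ) : ℂ) * moment g s) fun s hs => by
      rw [uIoc_of_le hx] at hs
      exact norm_inv_mul_moment_le g hs.1
  rw [sub_zero, abs_of_nonneg hx, mul_comm] at this
  exact this

theorem hasDerivAt_twofold (g : L2) {x : ℝ} (hx : 0 < x) :
    HasDerivAt (twofold g) (((x⁻¹ : ℝ) : ℂ) * moment g x) x :=
  intervalIntegral.integral_hasDerivAt_right (intervalIntegrable_inv_mul_moment g hx.le)
    ((continuousOn_inv_mul_moment g).stronglyMeasurableAtFilter isOpen_Ioi x hx)
    ((continuousOn_inv_mul_moment g).continuousAt (Ioi_mem_nhds hx))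

theorem moment_add (g h : L2) {x : ℝ} (hx : 0 ≤ x) :
    moment (g + h) x = moment g x + moment h x := by
  rw [moment_eq_inner _ hx, moment_eq_inner _ hx, moment_eq_inner _ hx, inner_add_right]

theorem moment_smul (c : ℂ) (g : L2) {x : ℝ} (hx : 0 ≤ x) :
    moment (c • g) x = c * moment g x := by
  rw [moment_eq_inner _ hx, moment_eq_inner _ hx, inner_smul_right]

theorem twofold_add (g h : L2) {x : ℝ} (hx : 0 ≤ x) :
    twofold (g + h) x = twofold g x + twofold h x := by
  rw [twofold, twofold, twofold, ← intervalIntegral.integral_add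
    (intervalIntegrable_inv_mul_moment g hx) (intervalIntegrable_inv_mul_moment h hx)]
  refine intervalIntegral.integral_congr fun s hs => ?_
  rw [uIcc_of_le hx] at hs
  rw [moment_add g h hs.1, mul_add]

theorem twofold_smul (c : ℂ) (g : L2) {x : ℝ} (hx : 0 ≤ x) :
    twofold (c • g) x = c * twofold g x := by
  rw [twofold, twofold, ← intervalIntegral.integral_const_mul]
  refine intervalIntegral.integral_congr fun s hs => ?_
  rw [uIcc_of_le hx] at hs
  rw [moment_smul c g hs.1, mul_left_comm]

/-- `f(x) = √x (a + b log x + ∫₀ˣ s⁻¹ ∫₀ˢ √y g(y) dy ds)` almost everywhere: the integrated form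
of `f'' + f / (4 x²) = g` with boundary coefficients `a` and `b`. -/
def HasTwofoldForm (f g : L2) (a b : ℂ) : Prop :=
  ∀ᵐ x ∂halfLine, f x = (Real.sqrt x : ℂ) * (a + b * (Real.log x : ℂ) + twofold g x)

theorem HasTwofoldForm.add {f g f' g' : L2} {a b a' b' : ℂ} (h : HasTwofoldForm f g a b)
    (h' : HasTwofoldForm f' g' a' b') : HasTwofoldForm (f + f') (g + g') (a + a') (b + b') := by
  filter_upwards [h, h', Lp.coeFn_add f f', ae_restrict_mem measurableSet_Ioi] with x h1 h2 h3 hx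
  rw [h3, Pi.add_apply, h1, h2, twofold_add _ _ (le_of_lt hx)]
  ring

theorem HasTwofoldForm.smul {f g : L2} {a b : ℂ} (c : ℂ) (h : HasTwofoldForm f g a b) :
    HasTwofoldForm (c • f) (c • g) (c * a) (c * b) := by
  filter_upwards [h, Lp.coeFn_smul c f, ae_restrict_mem measurableSet_Ioi] with x h1 h3 hx
  rw [h3, Pi.smul_apply, h1, twofold_smul _ _ (le_of_lt hx), smul_eq_mul]
  ring

/-- The integrated radial equation is closed under convergence in `L²`. -/
theorem HasTwofoldForm.of_tendsto {f g : ℕ → L2} {a b : ℕ → ℂ} {f₀ g₀ : L2} {a₀ b₀ : ℂ}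
    (h : ∀ n, HasTwofoldForm (f n) (g n) (a n) (b n)) (hf : Tendsto f atTop (𝓝 f₀))
    (hg : Tendsto g atTop (𝓝 g₀)) (ha : Tendsto a atTop (𝓝 a₀)) (hb : Tendsto b atTop (𝓝 b₀)) :
    HasTwofoldForm f₀ g₀ a₀ b₀ := by
  obtain ⟨ns, hns, hae⟩ := (tendstoInMeasure_of_tendsto_Lp hf).exists_seq_tendsto_ae
  filter_upwards [hae, ae_all_iff.2 h, ae_restrict_mem measurableSet_Ioi] with x h1 h2 hx
  have hx : 0 < x := hx
  have h3 : Tendsto (fun n => twofold (g n) x) atTop (𝓝 (twofold g₀ x)) := by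
    rw [tendsto_iff_norm_sub_tendsto_zero]
    have h4 : ∀ n, twofold (g n) x - twofold g₀ x = twofold (g n + (-1 : ℂ) • g₀) x := fun n => by
      rw [twofold_add _ _ hx.le, twofold_smul _ _ hx.le]; ring
    have h5 : Tendsto (fun n => x * ‖g n + (-1 : ℂ) • g₀‖) atTop (𝓝 0) := by
      have := (tendsto_iff_norm_sub_tendsto_zero.1 hg).const_mul x
      simpa [sub_eq_add_neg] using this
    refine squeeze_zero (fun _ => norm_nonneg _) (fun n => ?_) h5
    rw [h4]
    exact norm_twofold_le _ hx.le
  have h6 := ((ha.add (hb.mul_const (Real.log x : ℂ))).add h3).const_mul (Real.sqrt x : ℂ)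
  refine tendsto_nhds_unique h1 ((h6.comp hns.tendsto_atTop).congr fun n => ?_)
  exact (h2 (ns n)).symm

theorem one_le_abs_log_eventually : ∀ᶠ x : ℝ in 𝓝[>] 0, 0 < x ∧ 1 ≤ |Real.log x| := by
  filter_upwards [Ioo_mem_nhdsGT (Real.exp_pos (-1))] with x hx
  refine ⟨hx.1, ?_⟩
  have := (Real.log_lt_iff_lt_exp hx.1).2 hx.2
  rw [abs_of_neg (by linarith)]; linarith

/-- The remainder `√x ∫₀ˣ s⁻¹ ∫₀ˢ √y g(y) dy ds` is `O(x^{3/2})` with derivative `O(x^{1/2})`; the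
logarithms in the required bounds are at least one in absolute value near zero. -/
theorem HasTwofoldForm.hasBoundaryCoeffs {f g : L2} {a b : ℂ} (h : HasTwofoldForm f g a b) :
    HasBoundaryCoeffs f a b := by
  have hd : ∀ x : ℝ, 0 < x → HasDerivAt (fun x => (Real.sqrt x : ℂ) * twofold g x)
      (((1 / (2 * Real.sqrt x) : ℝ) : ℂ) * twofold g x +
        (Real.sqrt x : ℂ) * (((x⁻¹ : ℝ) : ℂ) * moment g x)) x := fun x hx =>
    (Real.hasDerivAt_sqrt hx.ne').ofReal_comp.mul (hasDerivAt_twofold g hx)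
  refine ⟨fun x => (Real.sqrt x : ℂ) * twofold g x, ?_, ?_, ?_, ?_⟩
  · rw [contDiffOn_one_iff_derivWithin (uniqueDiffOn_Ioi 0)]
    refine ⟨fun x hx => (hd x hx).differentiableAt.differentiableWithinAt, ?_⟩
    refine ContinuousOn.congr (f := fun x : ℝ => ((1 / (2 * Real.sqrt x) : ℝ) : ℂ) * twofold g x +
        (Real.sqrt x : ℂ) * (((x⁻¹ : ℝ) : ℂ) * moment g x)) ?_ fun x hx => by
      rw [derivWithin_of_isOpen isOpen_Ioi hx, (hd x hx).deriv]
    refine ContinuousOn.add (ContinuousOn.mul ?_ fun x hx =>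
      (hasDerivAt_twofold g hx).continuousAt.continuousWithinAt)
      (ContinuousOn.mul (by fun_prop) (continuousOn_inv_mul_moment g))
    refine Complex.continuous_ofReal.comp_continuousOn (ContinuousOn.div (by fun_prop)
      (by fun_prop) fun x hx => ?_)
    have : 0 < Real.sqrt x := Real.sqrt_pos.2 hx
    positivity
  · filter_upwards [h] with x hx
    rw [hx]; push_cast; ring
  · refine Asymptotics.IsBigO.of_bound ‖g‖ ?_
    filter_upwards [one_le_abs_log_eventually] with x ⟨hx, hl⟩
    rw [norm_mul, Complex.norm_real, Real.norm_of_nonneg (Real.sqrt_nonneg _), norm_mul,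
      Real.norm_of_nonneg (Real.rpow_nonneg hx.le _), Real.norm_eq_abs,
      show (3 / 2 : ℝ) = 1 / 2 + 1 by norm_num, Real.rpow_add_one hx.ne', ← Real.sqrt_eq_rpow]
    calc _ ≤ Real.sqrt x * (x * ‖g‖) * 1 := by
          rw [mul_one]; gcongr; exact norm_twofold_le g hx.le
      _ ≤ Real.sqrt x * (x * ‖g‖) * |Real.log x| := by gcongr
      _ = _ := by ring
  · refine Asymptotics.IsBigO.of_bound (2 * ‖g‖) ?_
    filter_upwards [one_le_abs_log_eventually] with x ⟨hx, hl⟩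
    have hs : 0 < Real.sqrt x := Real.sqrt_pos.2 hx
    rw [(hd x hx).deriv, norm_mul (x ^ (1 / 2 : ℝ)) (Real.log x),
      Real.norm_of_nonneg (Real.rpow_nonneg hx.le _), Real.norm_eq_abs, ← Real.sqrt_eq_rpow]
    have h1 : ‖((1 / (2 * Real.sqrt x) : ℝ) : ℂ) * twofold g x‖ ≤ Real.sqrt x * ‖g‖ := by
      rw [norm_mul, Complex.norm_real, Real.norm_of_nonneg (by positivity)]
      calc _ ≤ 1 / (2 * Real.sqrt x) * (x * ‖g‖) := by gcongr; exact norm_twofold_le g hx.le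
        _ = (Real.sqrt x * ‖g‖) / 2 := by
          nth_rewrite 2 [← Real.mul_self_sqrt hx.le]; field_simp
        _ ≤ _ := half_le_self (by positivity)
    have h2 : ‖(Real.sqrt x : ℂ) * (((x⁻¹ : ℝ) : ℂ) * moment g x)‖ ≤ Real.sqrt x * ‖g‖ := by
      rw [norm_mul, Complex.norm_real, Real.norm_of_nonneg hs.le]
      gcongr
      exact norm_inv_mul_moment_le g hx
    calc _ ≤ Real.sqrt x * ‖g‖ + Real.sqrt x * ‖g‖ := (norm_add_le _ _).trans (add_le_add h1 h2)
      _ = 2 * ‖g‖ * (Real.sqrt x * 1) := by ring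
      _ ≤ _ := by gcongr

/-! ### The weak form of the maximal operator -/

theorem IsTestFunction.exists_Ioo {φ : ℝ → ℂ} (hφ : IsTestFunction φ) :
    ∃ a b : ℝ, 0 < a ∧ a < b ∧ tsupport φ ⊆ Ioo a b := by
  rcases (tsupport φ).eq_empty_or_nonempty with h | h
  · exact ⟨1, 2, one_pos, one_lt_two, by simp [h]⟩
  · have hc : IsCompact (tsupport φ) := hφ.2.1
    obtain ⟨m, hm, hmin⟩ := hc.exists_isLeast h
    obtain ⟨M, hM, hmax⟩ := hc.exists_isGreatest h
    have hm0 : 0 < m := hφ.2.2 hm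
    refine ⟨m / 2, M + 1, by linarith, by linarith [hmin hM], fun x hx => ⟨?_, ?_⟩⟩
    · linarith [hmin hx]
    · linarith [hmax hx]

/-- Functions that are continuous on the half-line and vanish off a compact subset are
integrable. -/
theorem IsTestFunction.integrable_of_eq_zero {φ F : ℝ → ℂ} (hφ : IsTestFunction φ)
    (hF : ∀ x, x ∉ tsupport φ → F x = 0) (hc : ContinuousOn F (Ioi 0)) :
    Integrable F halfLine := by
  have h1 : IntegrableOn F (tsupport φ) :=
    (hc.mono hφ.2.2).integrableOn_compact hφ.2.1
  exact (integrableOn_iff_integrable_of_support_subset fun x hx => by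
    by_contra h; exact hx (hF x h)).1 h1 |>.integrableOn

theorem IsTestFunction.integral_eq_zero_of_hasDerivAt {φ F F' : ℝ → ℂ} (hφ : IsTestFunction φ)
    (hF : ∀ x, x ∉ tsupport φ → F x = 0) (hF' : ∀ x, x ∉ tsupport φ → F' x = 0)
    (hd : ∀ x, 0 < x → HasDerivAt F (F' x) x) (hc : ContinuousOn F' (Ioi 0)) :
    ∫ x, F' x ∂halfLine = 0 := by
  obtain ⟨a, b, ha, hab, hK⟩ := hφ.exists_Ioo
  have hsub : uIcc a b ⊆ Ioi 0 := by
    rw [uIcc_of_le hab.le]; exact fun x hx => lt_of_lt_of_le ha hx.1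
  have h1 := intervalIntegral.integral_eq_sub_of_hasDerivAt (fun x hx => hd x (hsub hx))
    (hc.mono hsub).intervalIntegrable
  rw [hF a fun h => (hK h).1.false, hF b fun h => (hK h).2.false, sub_zero,
    intervalIntegral.integral_of_le hab.le] at h1
  rw [← h1]
  refine setIntegral_eq_of_subset_of_forall_sdiff_eq_zero measurableSet_Ioi
    (fun x hx => ha.trans hx.1) fun x hx => hF' x fun h => hx.2 ⟨(hK h).1, (hK h).2.le⟩

theorem IsTestFunction.deriv_eq_zero {φ : ℝ → ℂ} {x : ℝ} (hx : x ∉ tsupport φ) :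
    deriv φ x = 0 :=
  image_eq_zero_of_notMem_tsupport fun h => hx (tsupport_deriv_subset h)

theorem IsTestFunction.deriv_deriv_eq_zero {φ : ℝ → ℂ} {x : ℝ} (hx : x ∉ tsupport φ) :
    deriv (deriv φ) x = 0 :=
  image_eq_zero_of_notMem_tsupport fun h => hx (tsupport_deriv_subset (tsupport_deriv_subset h))

theorem diffExpr_eq_zero {φ : ℝ → ℂ} {x : ℝ} (hx : x ∉ tsupport φ) : diffExpr φ x = 0 := by
  rw [diffExpr, IsTestFunction.deriv_deriv_eq_zero hx, image_eq_zero_of_notMem_tsupport hx]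
  simp

theorem IsTestFunction.continuous_deriv {φ : ℝ → ℂ} (hφ : IsTestFunction φ) :
    Continuous (deriv φ) := hφ.differentiable_deriv.continuous

theorem IsTestFunction.continuous_deriv_deriv {φ : ℝ → ℂ} (hφ : IsTestFunction φ) :
    Continuous (deriv (deriv φ)) := by
  have h := (contDiff_infty_iff_deriv.1 hφ.1).2
  exact (contDiff_infty_iff_deriv.1 h).2.continuous

theorem IsTestFunction.continuousOn_diffExpr {φ : ℝ → ℂ} (hφ : IsTestFunction φ) :
    ContinuousOn (diffExpr φ) (Ioi 0) := by
  have h1 := hφ.continuous_deriv_deriv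
  have h2 := hφ.1.continuous
  unfold diffExpr
  refine ContinuousOn.sub (by fun_prop) (ContinuousOn.div (by fun_prop) (by fun_prop) fun x hx => ?_)
  have : (x : ℂ) ≠ 0 := by exact_mod_cast (ne_of_gt hx)
  simpa using this

theorem IsTestFunction.memLp {φ : ℝ → ℂ} (hφ : IsTestFunction φ) : MemLp φ 2 halfLine :=
  (hφ.1.continuous.memLp_of_hasCompactSupport (μ := volume) hφ.2.1).restrict _

theorem IsTestFunction.memLp_diffExpr {φ : ℝ → ℂ} (hφ : IsTestFunction φ) :
    MemLp (diffExpr φ) 2 halfLine := by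
  rw [memLp_two_iff_integrable_sq_norm
    (hφ.continuousOn_diffExpr.aestronglyMeasurable measurableSet_Ioi)]
  have := hφ.integrable_of_eq_zero (F := fun x => ((‖diffExpr φ x‖ ^ 2 : ℝ) : ℂ))
    (fun x hx => by rw [diffExpr_eq_zero hx]; simp)
    (Complex.continuous_ofReal.comp_continuousOn (hφ.continuousOn_diffExpr.norm.pow 2))
  exact this.re.congr (ae_of_all _ fun x => Complex.ofReal_re _)

theorem IsTestFunction.star {φ : ℝ → ℂ} (hφ : IsTestFunction φ) :
    IsTestFunction fun x => star (φ x) := by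
  refine ⟨Complex.conjCLE.contDiff.comp hφ.1, ?_, ?_⟩
  · exact hφ.2.1.comp_left (g := fun z : ℂ => Star.star z) (star_zero _)
  · exact (tsupport_comp_subset (g := fun z : ℂ => Star.star z) (star_zero _) φ).trans hφ.2.2

theorem diffExpr_star (φ : ℝ → ℂ) (x : ℝ) :
    diffExpr (fun y => star (φ y)) x = star (diffExpr φ x) := by
  have h : deriv (fun y => star (φ y)) = fun y => star (deriv φ y) := by
    funext y; exact deriv.star
  rw [diffExpr, diffExpr, h, deriv.star]
  simp

theorem dense_domain_deltaMin : Dense (deltaMin.domain : Set L2) := by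
  have h0 : delta0.domain ≤ deltaMin.domain := (LinearPMap.le_closure delta0).1
  refine Dense.mono h0 ?_
  rw [Submodule.dense_iff_topologicalClosure_eq_top, Submodule.topologicalClosure_eq_top_iff,
    eq_bot_iff]
  intro f hf
  rw [Submodule.mem_bot, Lp.eq_zero_iff_ae_eq_zero]
  have hloc : LocallyIntegrableOn f (Ioi 0) := by
    exact locallyIntegrableOn_of_locallyIntegrable_restrict
      ((Lp.memLp f).locallyIntegrable (by norm_num))
  have := isOpen_Ioi.ae_eq_zero_of_integral_contDiff_smul_eq_zero hloc ?_
  · exact (ae_restrict_iff' measurableSet_Ioi).2 this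
  intro g hg hgc hgs
  have hφ : IsTestFunction fun x => (g x : ℂ) := by
    refine ⟨Complex.ofRealCLM.contDiff.comp hg, hgc.comp_left (g := fun r : ℝ => (r : ℂ)) rfl, ?_⟩
    exact (tsupport_comp_subset (g := fun r : ℝ => (r : ℂ)) rfl g).trans hgs
  have hmem : hφ.memLp.toLp ∈ delta0.domain := by
    have : (hφ.memLp.toLp, hφ.memLp_diffExpr.toLp) ∈ delta0.graph := by
      rw [graph_delta0]
      exact ⟨_, hφ, hφ.memLp.coeFn_toLp, hφ.memLp_diffExpr.coeFn_toLp⟩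
    exact LinearPMap.mem_domain_of_mem_graph this
  have h2 := (Submodule.mem_orthogonal _ f).1 hf _ hmem
  rw [L2.inner_def] at h2
  rw [← setIntegral_eq_integral_of_forall_compl_eq_zero (s := Ioi 0), ← h2]
  · refine integral_congr_ae ?_
    filter_upwards [hφ.memLp.coeFn_toLp] with x hx
    rw [hx, RCLike.inner_apply, Complex.conj_ofReal, Complex.real_smul, mul_comm]
  · intro x hx
    rw [image_eq_zero_of_notMem_tsupport fun h => hx (hgs h), zero_smul]

/-- Membership in the graph of the maximal operator is the weak form of the differential
equation. -/
theorem mem_graph_deltaMax_iff {f g : L2} : (f, g) ∈ deltaMax.graph ↔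
    ∀ φ, IsTestFunction φ → ∫ x, φ x * g x ∂halfLine = ∫ x, diffExpr φ x * f x ∂halfLine := by
  -- the adjoint of the closure only sees the original graph
  have hsub1 : testGraph ≤ deltaMin.graph := by
    rw [← graph_delta0]
    exact LinearPMap.le_graph_of_le (LinearPMap.le_closure delta0)
  have hsub2 : deltaMin.graph ≤ testGraph.topologicalClosure := by
    by_cases h : delta0.IsClosable
    · rw [deltaMin, ← h.graph_closure_eq_closure_graph, graph_delta0]
    · rw [deltaMin, LinearPMap.closure_def' h, graph_delta0]
      exact Submodule.le_topologicalClosure _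
  rw [deltaMax, LinearPMap.adjoint_graph_eq_graph_adjoint dense_domain_deltaMin,
    Submodule.mem_adjoint_iff]
  have key : ∀ (φ : ℝ → ℂ) (hφ : IsTestFunction φ) (u w : L2),
      u =ᵐ[halfLine] (fun x => star (φ x)) → w =ᵐ[halfLine] diffExpr (fun x => star (φ x)) →
      inner ℂ w f - inner ℂ u g = (∫ x, diffExpr φ x * f x ∂halfLine) -
        ∫ x, φ x * g x ∂halfLine := by
    intro φ hφ u w hu hw
    rw [L2.inner_def, L2.inner_def]
    congr 1
    · refine integral_congr_ae ?_
      filter_upwards [hw] with x hx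
      rw [hx, diffExpr_star, RCLike.inner_apply, mul_comm]
      simp
    · refine integral_congr_ae ?_
      filter_upwards [hu] with x hx
      rw [hx, RCLike.inner_apply, mul_comm]
      simp
  constructor
  · intro h φ hφ
    have h1 := h hφ.star.memLp.toLp hφ.star.memLp_diffExpr.toLp
      (hsub1 ⟨_, hφ.star, hφ.star.memLp.coeFn_toLp, hφ.star.memLp_diffExpr.coeFn_toLp⟩)
    simp only at h1
    rw [key φ hφ _ _ hφ.star.memLp.coeFn_toLp hφ.star.memLp_diffExpr.coeFn_toLp] at h1
    exact (sub_eq_zero.1 h1).symm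
  · intro h a b hab
    have hcl : IsClosed {p : L2 × L2 | inner ℂ p.2 f - inner ℂ p.1 g = 0} :=
      isClosed_eq (by fun_prop) continuous_const
    refine hcl.closure_subset_iff.2 ?_ (hsub2 hab)
    rintro ⟨u, w⟩ ⟨φ, hφ, h1, h2⟩
    have h3 := key (fun x => star (φ x)) hφ.star u w
      (h1.trans (ae_of_all _ fun x => (star_star _).symm)) (by simpa only [star_star] using h2)
    show inner ℂ w f - inner ℂ u g = 0
    rw [h3, h _ hφ.star, sub_self]

theorem IsTestFunction.mul_contDiffOn {φ c : ℝ → ℂ} (hφ : IsTestFunction φ)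
    (hc : ContDiffOn ℝ ∞ c (Ioi 0)) : IsTestFunction fun x => φ x * c x := by
  refine ⟨contDiff_iff_contDiffAt.2 fun x => ?_, hφ.2.1.mul_right, ?_⟩
  · by_cases hx : x ∈ tsupport φ
    · exact hφ.1.contDiffAt.mul (hc.contDiffAt (isOpen_Ioi.mem_nhds (hφ.2.2 hx)))
    · refine (contDiffAt_const (c := (0 : ℂ))).congr_of_eventuallyEq ?_
      filter_upwards [(isClosed_tsupport φ).isOpen_compl.mem_nhds hx] with y hy
      rw [image_eq_zero_of_notMem_tsupport hy, zero_mul]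
  · exact (closure_mono (Function.support_mul_subset_left φ c)).trans hφ.2.2

theorem contDiffOn_sqrt : ContDiffOn ℝ ∞ (fun x : ℝ => (Real.sqrt x : ℂ)) (Ioi 0) :=
  Complex.ofRealCLM.contDiff.comp_contDiffOn fun _ hx =>
    (Real.contDiffAt_sqrt (ne_of_gt hx)).contDiffWithinAt

theorem IsTestFunction.mul_sqrt {φ : ℝ → ℂ} (hφ : IsTestFunction φ) :
    IsTestFunction fun x => φ x * (Real.sqrt x : ℂ) := hφ.mul_contDiffOn contDiffOn_sqrt

theorem IsTestFunction.div_sqrt {φ : ℝ → ℂ} (hφ : IsTestFunction φ) :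
    IsTestFunction fun x => φ x / (Real.sqrt x : ℂ) := by
  simp_rw [div_eq_mul_inv]
  refine hφ.mul_contDiffOn (contDiffOn_sqrt.inv fun x hx => ?_)
  exact_mod_cast (Real.sqrt_pos.2 hx).ne'

/-- Green's identity for `√x v` and a test function `φ`, where `x v' = w`. The factor on the right
is the derivative of `φ / √x`. -/
theorem IsTestFunction.green {φ v w : ℝ → ℂ} (hφ : IsTestFunction φ)
    (hv : ∀ x, 0 < x → HasDerivAt v (((x⁻¹ : ℝ) : ℂ) * w x) x) (hw : ContinuousOn w (Ioi 0)) :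
    ∫ x, diffExpr φ x * ((Real.sqrt x : ℂ) * v x) ∂halfLine =
      ∫ x, deriv (fun y : ℝ => φ y / (Real.sqrt y : ℂ)) x * w x ∂halfLine := by
  have hη := hφ.div_sqrt
  have hvc : ContinuousOn v (Ioi 0) := fun x hx => (hv x hx).continuousAt.continuousWithinAt
  have hηs : ∀ x, x ∉ tsupport φ → deriv (fun y : ℝ => φ y / (Real.sqrt y : ℂ)) x = 0 := by
    intro x hx
    refine IsTestFunction.deriv_eq_zero fun h => hx ?_
    simp_rw [div_eq_mul_inv] at h
    exact closure_mono (Function.support_mul_subset_left φ _) h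
  have hi1 : Integrable (fun x => diffExpr φ x * ((Real.sqrt x : ℂ) * v x)) halfLine := by
    refine hφ.integrable_of_eq_zero (fun x hx => by rw [diffExpr_eq_zero hx, zero_mul]) ?_
    exact hφ.continuousOn_diffExpr.mul (contDiffOn_sqrt.continuousOn.mul hvc)
  have hi2 : Integrable (fun x => deriv (fun y : ℝ => φ y / (Real.sqrt y : ℂ)) x * w x)
      halfLine := by
    refine hφ.integrable_of_eq_zero (fun x hx => by rw [hηs x hx, zero_mul]) ?_
    exact hη.continuous_deriv.continuousOn.mul hw
  rw [← sub_eq_zero, ← neg_eq_zero, neg_sub, ← integral_sub hi2 hi1]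
  refine hφ.integral_eq_zero_of_hasDerivAt
    (F := fun x => (deriv φ x * (Real.sqrt x : ℂ) - φ x * (((2 * Real.sqrt x)⁻¹ : ℝ) : ℂ)) * v x)
    ?_ ?_ ?_ ?_
  · intro x hx
    rw [IsTestFunction.deriv_eq_zero hx, image_eq_zero_of_notMem_tsupport hx]; simp
  · intro x hx
    rw [diffExpr_eq_zero hx, hηs x hx]; simp
  · intro x hx
    have hs : 0 < Real.sqrt x := Real.sqrt_pos.2 hx
    have hsc : (Real.sqrt x : ℂ) ≠ 0 := by exact_mod_cast hs.ne'
    have hx2 : (x : ℂ) = (Real.sqrt x : ℂ) ^ 2 := by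
      rw [← Complex.ofReal_pow, Real.sq_sqrt hx.le]
    have d1 := (hφ.differentiable x).hasDerivAt
    have d2 := (hφ.differentiable_deriv x).hasDerivAt
    have d3 := (Real.hasDerivAt_sqrt hx.ne').ofReal_comp
    have d4 := ((((Real.hasDerivAt_sqrt hx.ne').const_mul 2).inv (by positivity))).ofReal_comp
    have d5 : deriv (fun y : ℝ => φ y / (Real.sqrt y : ℂ)) x = _ := (d1.div d3 hsc).deriv
    refine (((d2.mul d3).sub (d1.mul d4)).mul (hv x hx)).congr_deriv ?_
    rw [d5, diffExpr]
    simp only [Pi.inv_apply, Pi.sub_apply, Pi.mul_apply]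
    push_cast
    rw [hx2]
    field_simp
    ring
  · exact (hη.continuous_deriv.continuousOn.mul hw).sub
      (hφ.continuousOn_diffExpr.mul (contDiffOn_sqrt.continuousOn.mul hvc))

/-- Integration by parts against the primitive `moment g`. -/
theorem IsTestFunction.integral_deriv_mul_moment {η : ℝ → ℂ} (hη : IsTestFunction η) (g : L2) :
    ∫ x, deriv η x * moment g x ∂halfLine =
      -∫ x, η x * ((Real.sqrt x : ℂ) * g x) ∂halfLine := by
  obtain ⟨a, b, ha, hab, hK⟩ := hη.exists_Ioo
  have hz : ∀ x, x ∉ Ioc 0 b → η x = 0 := fun x hx =>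
    image_eq_zero_of_notMem_tsupport fun h => hx ⟨ha.trans (hK h).1, (hK h).2.le⟩
  have hz' : ∀ x, x ∉ Ioc 0 b → deriv η x = 0 := fun x hx =>
    IsTestFunction.deriv_eq_zero fun h => hx ⟨ha.trans (hK h).1, (hK h).2.le⟩
  have hres : ∀ F : ℝ → ℂ, (∀ x, x ∉ Ioc 0 b → F x = 0) →
      ∫ x, F x ∂halfLine = ∫ x in Ioc 0 b, F x := fun F hF =>
    setIntegral_eq_of_subset_of_forall_sdiff_eq_zero measurableSet_Ioi Ioc_subset_Ioi_self
      fun x hx => hF x hx.2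
  rw [hres _ fun _ hx => by rw [hz' _ hx, zero_mul], hres _ fun x hx => by rw [hz x hx, zero_mul]]
  set h : ℝ → ℂ := fun y => (Real.sqrt y : ℂ) * g y with hh
  have hhi : IntegrableOn h (Ioc 0 b) := integrableOn_sqrt_mul g b
  have hdi : IntegrableOn (deriv η) (Ioc 0 b) :=
    (hη.continuous_deriv.integrableOn_Icc (a := 0) (b := b)).mono_set Ioc_subset_Icc_self
  have h1 : ∀ x ∈ Ioc 0 b, deriv η x * moment g x =
      ∫ y in Ioc 0 b, (Iic x).indicator (fun y => deriv η x * h y) y := by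
    intro x hx
    rw [setIntegral_indicator measurableSet_Iic, Ioc_inter_Iic, min_eq_right hx.2,
      integral_const_mul, moment, intervalIntegral.integral_of_le hx.1.le]
  rw [setIntegral_congr_fun measurableSet_Ioc h1, integral_integral_swap]
  · rw [← integral_neg]
    refine setIntegral_congr_fun measurableSet_Ioc fun y hy => ?_
    have h2 : ∀ x, (Iic x).indicator (fun y => deriv η x * h y) y =
        (Ici y).indicator (fun x => deriv η x * h y) x := by
      intro x
      by_cases hxy : y ≤ x
      · rw [indicator_of_mem (show y ∈ Iic x from hxy), indicator_of_mem (show x ∈ Ici y from hxy)]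
      · rw [indicator_of_notMem (show y ∉ Iic x from hxy),
          indicator_of_notMem (show x ∉ Ici y from hxy)]
    simp_rw [h2]
    rw [setIntegral_indicator measurableSet_Ici, integral_mul_const]
    have h3 : (Ioc 0 b ∩ Ici y : Set ℝ) =ᵐ[volume] Ioc y b := by
      have h6 : (Ioc 0 b ∩ Ici y : Set ℝ) = Icc y b := by
        ext x; constructor
        · exact fun hx => ⟨hx.2, hx.1.2⟩
        · exact fun hx => ⟨⟨hy.1.trans_le hx.1, hx.2⟩, hx.1⟩
      rw [h6]; exact Ioc_ae_eq_Icc.symm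
    rw [setIntegral_congr_set h3, ← intervalIntegral.integral_of_le hy.2,
      intervalIntegral.integral_eq_sub_of_hasDerivAt (fun x _ => (hη.differentiable x).hasDerivAt)
        (hη.continuous_deriv.intervalIntegrable _ _),
      image_eq_zero_of_notMem_tsupport (fun h => (hK h).2.false : b ∉ tsupport η)]
    ring
  · have h4 : Integrable (fun p : ℝ × ℝ => deriv η p.1 * h p.2)
        ((volume.restrict (Ioc 0 b)).prod (volume.restrict (Ioc 0 b))) := hdi.mul_prod hhi
    have h5 : MeasurableSet {p : ℝ × ℝ | p.2 ≤ p.1} := measurableSet_le measurable_snd measurable_fst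
    refine (h4.indicator h5).congr (ae_of_all _ fun p => ?_)
    simp only [Function.uncurry]
    by_cases hp : p.2 ≤ p.1
    · rw [indicator_of_mem (show p ∈ {p : ℝ × ℝ | p.2 ≤ p.1} from hp),
        indicator_of_mem (show p.2 ∈ Iic p.1 from hp)]
    · rw [indicator_of_notMem (show p ∉ {p : ℝ × ℝ | p.2 ≤ p.1} from hp),
        indicator_of_notMem (show p.2 ∉ Iic p.1 from hp)]

theorem IsTestFunction.integral_mul_moment_form {φ : ℝ → ℂ} (hφ : IsTestFunction φ) (g : L2) :
    ∫ x, deriv (fun y : ℝ => φ y / (Real.sqrt y : ℂ)) x * moment g x ∂halfLine =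
      -∫ x, φ x * g x ∂halfLine := by
  rw [hφ.div_sqrt.integral_deriv_mul_moment]
  congr 1
  refine setIntegral_congr_fun measurableSet_Ioi fun x hx => ?_
  have hsc : (Real.sqrt x : ℂ) ≠ 0 := by exact_mod_cast (Real.sqrt_pos.2 hx).ne'
  rw [← mul_assoc, div_mul_cancel₀ _ hsc]

theorem IsTestFunction.integral_deriv {η : ℝ → ℂ} (hη : IsTestFunction η) :
    ∫ x, deriv η x ∂halfLine = 0 :=
  hη.integral_eq_zero_of_hasDerivAt (fun _ hx => image_eq_zero_of_notMem_tsupport hx)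
    (fun _ hx => IsTestFunction.deriv_eq_zero hx) (fun x _ => (hη.differentiable x).hasDerivAt)
    hη.continuous_deriv.continuousOn

/-- Solutions of the integrated radial equation are in the domain of the maximal operator, by Green's
identity. -/
theorem HasTwofoldForm.mem_graph_deltaMax {f g : L2} {a b : ℂ} (h : HasTwofoldForm f g a b) :
    (f, -g) ∈ deltaMax.graph := by
  rw [mem_graph_deltaMax_iff]
  intro φ hφ
  have hv : ∀ x : ℝ, 0 < x → HasDerivAt (fun x : ℝ => a + b * (Real.log x : ℂ) + twofold g x)
      (((x⁻¹ : ℝ) : ℂ) * (b + moment g x)) x := by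
    intro x hx
    refine ((((Real.hasDerivAt_log hx.ne').ofReal_comp.const_mul b).const_add a).add
      (hasDerivAt_twofold g hx)).congr_deriv ?_
    ring
  have hm : ContinuousOn (moment g) (Ioi 0) := fun x hx =>
    (continuousAt_moment g hx).continuousWithinAt
  have h1 := hφ.green hv (continuousOn_const.add hm)
  have h2 : ∫ x, diffExpr φ x * f x ∂halfLine = ∫ x, diffExpr φ x *
      ((Real.sqrt x : ℂ) * (a + b * (Real.log x : ℂ) + twofold g x)) ∂halfLine := by
    refine integral_congr_ae ?_
    filter_upwards [h] with x hx
    rw [hx]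
  have h3 : ∫ x, φ x * (-g : L2) x ∂halfLine = -∫ x, φ x * g x ∂halfLine := by
    rw [← integral_neg]
    refine integral_congr_ae ?_
    filter_upwards [Lp.coeFn_neg g] with x hx
    rw [hx, Pi.neg_apply, mul_neg]
  rw [h2, h1, h3, ← hφ.integral_mul_moment_form]
  have hη := hφ.div_sqrt
  have hi : Integrable (fun x => deriv (fun y : ℝ => φ y / (Real.sqrt y : ℂ)) x) halfLine :=
    hη.integrable_of_eq_zero (fun _ hx => IsTestFunction.deriv_eq_zero hx)
      hη.continuous_deriv.continuousOn
  have hi2 : Integrable (fun x => deriv (fun y : ℝ => φ y / (Real.sqrt y : ℂ)) x * moment g x)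
      halfLine :=
    hη.integrable_of_eq_zero (fun _ hx => by rw [IsTestFunction.deriv_eq_zero hx, zero_mul])
      (hη.continuous_deriv.continuousOn.mul hm)
  simp_rw [mul_add]
  rw [integral_add (hi.mul_const b) hi2, integral_mul_const, hη.integral_deriv, zero_mul, zero_add]

/-- The lemma of du Bois-Reymond on the half-line. -/
theorem eq_of_integral_deriv_mul_eq_zero {u : ℝ → ℂ} (hu : ContinuousOn u (Ioi 0))
    (h : ∀ η, IsTestFunction η → ∫ x, deriv η x * u x ∂halfLine = 0) :
    ∃ c : ℂ, ∀ x, 0 < x → u x = c := by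
  have hreal : ∀ {g : ℝ → ℝ}, ContDiff ℝ ∞ g → HasCompactSupport g → tsupport g ⊆ Ioi 0 →
      IsTestFunction fun x => (g x : ℂ) := by
    intro g hg hgc hgs
    refine ⟨Complex.ofRealCLM.contDiff.comp hg, hgc.comp_left (g := fun r : ℝ => (r : ℂ)) rfl, ?_⟩
    exact (tsupport_comp_subset (g := fun r : ℝ => (r : ℂ)) rfl g).trans hgs
  let B : ContDiffBump (2 : ℝ) := ⟨1 / 2, 1, by norm_num, by norm_num⟩
  have hχ : IsTestFunction fun x => (B.normed volume x : ℂ) := by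
    refine hreal B.contDiff_normed B.hasCompactSupport_normed ?_
    rw [B.tsupport_normed_eq]
    intro x hx
    rw [Metric.mem_closedBall, Real.dist_eq, abs_le] at hx
    have h1 : -1 ≤ x - 2 := hx.1
    exact show 0 < x by linarith
  have hint : ∀ {φ : ℝ → ℂ}, IsTestFunction φ → Integrable φ halfLine := fun hφ =>
    hφ.integrable_of_eq_zero (fun _ hx => image_eq_zero_of_notMem_tsupport hx)
      hφ.1.continuous.continuousOn
  have hintu : ∀ {φ : ℝ → ℂ}, IsTestFunction φ → Integrable (fun x => φ x * u x) halfLine :=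
    fun hφ => hφ.integrable_of_eq_zero
      (fun _ hx => by rw [image_eq_zero_of_notMem_tsupport hx, zero_mul])
      (hφ.1.continuous.continuousOn.mul hu)
  have hχ1 : ∫ x, (B.normed volume x : ℂ) ∂halfLine = 1 := by
    rw [setIntegral_eq_integral_of_forall_compl_eq_zero fun x hx =>
      image_eq_zero_of_notMem_tsupport (f := fun x => (B.normed volume x : ℂ))
        fun h => hx (hχ.2.2 h), integral_complex_ofReal, B.integral_normed, Complex.ofReal_one]
  -- a test function with vanishing integral is the derivative of a test function
  have hprim : ∀ {d : ℝ → ℂ}, IsTestFunction d → ∫ x, d x ∂halfLine = 0 →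
      ∫ x, d x * u x ∂halfLine = 0 := by
    intro d hd hd0
    obtain ⟨a, b, ha, hab, hK⟩ := hd.exists_Ioo
    have hder : ∀ x, HasDerivAt (fun x => ∫ y in (0 : ℝ)..x, d y) (d x) x := fun x =>
      intervalIntegral.integral_hasDerivAt_right (hd.1.continuous.intervalIntegrable _ _)
        hd.1.continuous.stronglyMeasurable.stronglyMeasurableAtFilter hd.1.continuous.continuousAt
    have hderiv : deriv (fun x => ∫ y in (0 : ℝ)..x, d y) = d := funext fun x => (hder x).deriv
    have hdz : ∀ x, x ∉ Ioo a b → d x = 0 := fun x hx =>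
      image_eq_zero_of_notMem_tsupport fun h => hx (hK h)
    have hsupp : Function.support (fun x => ∫ y in (0 : ℝ)..x, d y) ⊆ Icc a b := by
      intro x hx
      by_contra hn
      refine hx ?_
      rw [mem_Icc, not_and_or, not_le, not_le] at hn
      rcases hn with hn | hn
      · simp only
        rw [intervalIntegral.integral_congr (g := fun _ => 0), intervalIntegral.integral_zero]
        intro y hy
        refine hdz y fun h => ?_
        rcases le_total 0 x with hx0 | hx0
        · rw [uIcc_of_le hx0] at hy; linarith [h.1, hy.2]
        · rw [uIcc_of_ge hx0] at hy; linarith [h.1, hy.2]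
      · simp only
        rw [intervalIntegral.integral_of_le (by linarith), ← hd0]
        refine (setIntegral_eq_of_subset_of_forall_sdiff_eq_zero measurableSet_Ioi
          Ioc_subset_Ioi_self fun y hy => hdz y fun h => ?_).symm
        exact hy.2 ⟨hy.1, by linarith [h.2]⟩
    have htest : IsTestFunction fun x => ∫ y in (0 : ℝ)..x, d y := by
      refine ⟨?_, HasCompactSupport.of_support_subset_isCompact isCompact_Icc hsupp, ?_⟩
      · rw [contDiff_infty_iff_deriv, hderiv]
        exact ⟨fun x => (hder x).differentiableAt, hd.1⟩
      · exact (closure_minimal hsupp isClosed_Icc).trans fun x hx => lt_of_lt_of_le ha hx.1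
    have := h _ htest
    rwa [hderiv] at this
  -- subtracting a multiple of a fixed bump makes the integral of any test function vanish
  set c : ℂ := ∫ x, (B.normed volume x : ℂ) * u x ∂halfLine with hc
  have hae := isOpen_Ioi.ae_eq_zero_of_integral_contDiff_smul_eq_zero (μ := volume)
    (U := Ioi (0 : ℝ)) (f := fun x => u x - c)
    ((hu.sub continuousOn_const).locallyIntegrableOn measurableSet_Ioi) (by
      intro g hg hgc hgs
      have hφ := hreal hg hgc hgs
      rw [← setIntegral_eq_integral_of_forall_compl_eq_zero (s := Ioi 0) fun x hx => by
        rw [image_eq_zero_of_notMem_tsupport fun h => hx (hgs h), zero_smul]]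
      set m : ℂ := ∫ x, (g x : ℂ) ∂halfLine with hm
      have hd : IsTestFunction ((fun x => (g x : ℂ)) + (-m) • fun x => (B.normed volume x : ℂ)) :=
        hφ.add (hχ.const_smul (-m))
      have h1 := hprim hd (by
        simp only [Pi.add_apply, Pi.smul_apply, smul_eq_mul]
        rw [integral_add (hint hφ) ((hint hχ).const_mul _), integral_const_mul, hχ1, ← hm]
        ring)
      rw [← h1]
      have h2 : ∫ x, (g x : ℂ) * (u x - c) ∂halfLine =
          (∫ x, (g x : ℂ) * u x ∂halfLine) - m * c := by
        simp_rw [mul_sub]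
        rw [integral_sub (hintu hφ) ((hint hφ).mul_const c), integral_mul_const]
      have h3 : ∀ x, ((fun x => (g x : ℂ)) + (-m) • fun x => (B.normed volume x : ℂ)) x * u x =
          (g x : ℂ) * u x + (-m) * ((B.normed volume x : ℂ) * u x) := fun x => by
        simp only [Pi.add_apply, Pi.smul_apply, smul_eq_mul]; ring
      simp_rw [h3, Complex.real_smul]
      rw [h2, integral_add (hintu hφ) ((hintu hχ).const_mul _), integral_const_mul, ← hc]
      ring)
  refine ⟨c, fun x hx => ?_⟩
  have h4 : (fun x => u x) =ᵐ[volume.restrict (Ioi 0)] fun _ => c := by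
    refine (ae_restrict_iff' measurableSet_Ioi).2 ?_
    filter_upwards [hae] with x hx h0 using sub_eq_zero.1 (hx h0)
  exact Measure.eqOn_open_of_ae_eq h4 isOpen_Ioi hu continuousOn_const hx

/-! ### Regularity and uniqueness for the radial equation -/

theorem eq_zero_of_tendsto_add_log {a b : ℂ}
    (h : Tendsto (fun x : ℝ => a + b * (Real.log x : ℂ)) (𝓝[>] 0) (𝓝 0)) : a = 0 ∧ b = 0 := by
  have hinv : Tendsto (fun x : ℝ => (((Real.log x)⁻¹ : ℝ) : ℂ)) (𝓝[>] 0) (𝓝 0) := by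
    have h1 : Tendsto (fun x : ℝ => (Real.log x)⁻¹) (𝓝[>] 0) (𝓝 0) :=
      tendsto_inv_atBot_zero.comp Real.tendsto_log_nhdsGT_zero
    exact_mod_cast (Complex.continuous_ofReal.tendsto 0).comp h1
  have hb : b = 0 := by
    have h1 := h.mul hinv
    have h2 : Tendsto (fun x : ℝ => a * (((Real.log x)⁻¹ : ℝ) : ℂ) + b) (𝓝[>] 0) (𝓝 (a * 0 + b)) :=
      (hinv.const_mul a).add_const b
    rw [zero_mul] at h1
    have h3 := tendsto_nhds_unique (h1.congr' ?_) h2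
    · simpa using h3.symm
    · filter_upwards [one_le_abs_log_eventually] with x ⟨_, hl⟩
      have : (Real.log x : ℂ) ≠ 0 := by
        intro h0
        have : Real.log x = 0 := by exact_mod_cast h0
        rw [this, abs_zero] at hl; linarith
      push_cast
      field_simp
  subst hb
  simp only [zero_mul, add_zero] at h
  exact ⟨tendsto_nhds_unique tendsto_const_nhds h, rfl⟩

/-- Functions in the domain of the maximal operator solve the integrated radial equation: by the
lemma of du Bois-Reymond `x v' - ∫₀ˣ √y g(y) dy` is constant for `f = √x v`, and the two constants of
integration are the boundary coefficients by comparison at zero. -/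
theorem HasBoundaryCoeffs.hasTwofoldForm {f g : L2} {a b : ℂ} (h : HasBoundaryCoeffs f a b)
    (hfg : (f, -g) ∈ deltaMax.graph) : HasTwofoldForm f g a b := by
  obtain ⟨r, hr1, hr2, hr3, -⟩ := h
  rw [mem_graph_deltaMax_iff] at hfg
  set v : ℝ → ℂ := fun x => a + b * (Real.log x : ℂ) + r x / (Real.sqrt x : ℂ) with hv
  have hvc : ContDiffOn ℝ 1 v (Ioi 0) := by
    have hs : ContDiffOn ℝ 1 (fun x : ℝ => (Real.sqrt x : ℂ)⁻¹) (Ioi 0) :=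
      (contDiffOn_sqrt.of_le (mod_cast le_top)).inv fun x hx => by
        exact_mod_cast (Real.sqrt_pos.2 hx).ne'
    simp only [hv, div_eq_mul_inv]
    refine (contDiffOn_const.add (contDiffOn_const.mul ?_)).add (hr1.mul hs)
    exact Complex.ofRealCLM.contDiff.comp_contDiffOn fun x hx =>
        (Real.contDiffAt_log.2 (ne_of_gt hx)).contDiffWithinAt
  have hvd : ∀ x : ℝ, 0 < x → HasDerivAt v (deriv v x) x := fun x hx =>
    ((hvc.differentiableOn (by simp)).differentiableAt (isOpen_Ioi.mem_nhds hx)).hasDerivAt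
  have hdc : ContinuousOn (deriv v) (Ioi 0) := hvc.continuousOn_deriv_of_isOpen isOpen_Ioi le_rfl
  have hfv : ∀ᵐ x ∂halfLine, f x = (Real.sqrt x : ℂ) * v x := by
    filter_upwards [hr2, ae_restrict_mem measurableSet_Ioi] with x h1 hx
    have : (Real.sqrt x : ℂ) ≠ 0 := by exact_mod_cast (Real.sqrt_pos.2 hx).ne'
    rw [h1, hv]
    push_cast
    field_simp
  have hwc : ContinuousOn (fun x : ℝ => (x : ℂ) * deriv v x) (Ioi 0) :=
    Complex.continuous_ofReal.continuousOn.mul hdc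
  have hmc : ContinuousOn (moment g) (Ioi 0) := fun x hx =>
    (continuousAt_moment g hx).continuousWithinAt
  have hw : ∀ x : ℝ, 0 < x → HasDerivAt v (((x⁻¹ : ℝ) : ℂ) * ((x : ℂ) * deriv v x)) x := by
    intro x hx
    refine (hvd x hx).congr_deriv ?_
    rw [← mul_assoc, ← Complex.ofReal_mul, inv_mul_cancel₀ hx.ne', Complex.ofReal_one, one_mul]
  obtain ⟨c, hc⟩ := eq_of_integral_deriv_mul_eq_zero (hwc.sub hmc) (by
    intro η hη
    have hφ := hη.mul_sqrt
    have h1 := hφ.green hw hwc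
    have h2 := hφ.integral_mul_moment_form g
    have hq : (fun y : ℝ => η y * (Real.sqrt y : ℂ) / (Real.sqrt y : ℂ)) = η := by
      funext y
      by_cases hy : 0 < y
      · exact mul_div_cancel_right₀ _ (by exact_mod_cast (Real.sqrt_pos.2 hy).ne')
      · rw [image_eq_zero_of_notMem_tsupport fun h => hy (hη.2.2 h)]; simp
    rw [hq] at h1 h2
    have h3 := hfg _ hφ
    have h4 : ∫ x, η x * (Real.sqrt x : ℂ) * (-g : L2) x ∂halfLine =
        -∫ x, η x * (Real.sqrt x : ℂ) * g x ∂halfLine := by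
      rw [← integral_neg]
      refine integral_congr_ae ?_
      filter_upwards [Lp.coeFn_neg g] with x hx
      rw [hx, Pi.neg_apply, mul_neg]
    have h5 : ∫ x, diffExpr (fun x => η x * (Real.sqrt x : ℂ)) x * f x ∂halfLine =
        ∫ x, diffExpr (fun x => η x * (Real.sqrt x : ℂ)) x *
          ((Real.sqrt x : ℂ) * v x) ∂halfLine := by
      refine integral_congr_ae ?_
      filter_upwards [hfv] with x hx
      rw [hx]
    have hi : ∀ w : ℝ → ℂ, ContinuousOn w (Ioi 0) →
        Integrable (fun x => deriv η x * w x) halfLine := fun w hw =>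
      hη.integrable_of_eq_zero
        (fun _ hx => by rw [IsTestFunction.deriv_eq_zero hx, zero_mul])
        (hη.continuous_deriv.continuousOn.mul hw)
    simp only [Pi.sub_apply, mul_sub]
    rw [integral_sub (hi _ hwc) (hi _ hmc), ← h1, h2, ← h4, ← h5, h3, sub_self])
  -- both sides of the claimed formula for `v` have the same derivative
  have hz : ∀ x : ℝ, 0 < x →
      HasDerivAt (fun x : ℝ => v x - c * (Real.log x : ℂ) - twofold g x) 0 x := by
    intro x hx
    refine (((hvd x hx).sub ((Real.hasDerivAt_log hx.ne').ofReal_comp.const_mul c)).sub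
      (hasDerivAt_twofold g hx)).congr_deriv ?_
    have h1 := hc x hx
    have hx0 : (x : ℂ) ≠ 0 := by exact_mod_cast hx.ne'
    simp only [Pi.sub_apply] at h1
    push_cast
    field_simp
    linear_combination h1
  have hconst : ∀ x : ℝ, 0 < x → v x - c * (Real.log x : ℂ) - twofold g x =
      v 1 - c * (Real.log (1 : ℝ) : ℂ) - twofold g 1 := fun x hx =>
    isOpen_Ioi.is_const_of_deriv_eq_zero isPreconnected_Ioi
      (fun y hy => (hz y hy).differentiableAt.differentiableWithinAt)
      (fun y hy => (hz y hy).deriv) hx (mem_Ioi.2 one_pos)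
  set C : ℂ := v 1 - c * (Real.log (1 : ℝ) : ℂ) - twofold g 1 with hC
  have hlim : Tendsto (fun x : ℝ => (a - C) + (b - c) * (Real.log x : ℂ)) (𝓝[>] 0) (𝓝 0) := by
    have h1 : Tendsto (fun x : ℝ => twofold g x) (𝓝[>] 0) (𝓝 0) := by
      have h2 : Tendsto (fun x : ℝ => x * ‖g‖) (𝓝[>] 0) (𝓝 0) := by
        have : Tendsto (fun x : ℝ => x * ‖g‖) (𝓝 0) (𝓝 (0 * ‖g‖)) := tendsto_id.mul_const _
        rw [zero_mul] at this
        exact this.mono_left nhdsWithin_le_nhds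
      refine squeeze_zero_norm' ?_ h2
      filter_upwards [self_mem_nhdsWithin] with x hx
      exact norm_twofold_le g (le_of_lt hx)
    have h3 : Tendsto (fun x : ℝ => r x / (Real.sqrt x : ℂ)) (𝓝[>] 0) (𝓝 0) := by
      have h4 : (fun x : ℝ => r x / (Real.sqrt x : ℂ)) =O[𝓝[>] 0] fun x : ℝ => Real.log x * x := by
        obtain ⟨M, hM⟩ := hr3.bound
        refine Asymptotics.IsBigO.of_bound M ?_
        filter_upwards [hM, self_mem_nhdsWithin] with x hx hx0
        have hx0 : 0 < x := hx0
        have hs : 0 < Real.sqrt x := Real.sqrt_pos.2 hx0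
        rw [norm_div, Complex.norm_real, Real.norm_of_nonneg hs.le, div_le_iff₀ hs]
        refine hx.trans (le_of_eq ?_)
        rw [norm_mul, norm_mul, Real.norm_of_nonneg (Real.rpow_nonneg hx0.le _),
          show (3 / 2 : ℝ) = 1 / 2 + 1 by norm_num, Real.rpow_add_one hx0.ne',
          ← Real.sqrt_eq_rpow, Real.norm_of_nonneg hx0.le]
        ring
      refine h4.trans_tendsto ?_
      have := tendsto_log_mul_rpow_nhdsGT_zero (r := 1) one_pos
      simpa using this
    have h5 := h1.sub h3
    rw [sub_zero] at h5
    refine h5.congr' ?_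
    filter_upwards [self_mem_nhdsWithin] with x hx
    have h6 := hconst x hx
    rw [hv] at h6
    simp only at h6
    linear_combination -h6
  obtain ⟨e1, e2⟩ := eq_zero_of_tendsto_add_log hlim
  filter_upwards [hfv, ae_restrict_mem measurableSet_Ioi] with x h1 hx
  rw [h1]
  congr 1
  have h6 := hconst x hx
  linear_combination h6 + (sub_eq_zero.1 e1).symm - (Real.log x : ℂ) * e2

/-- The solution of `(x u')' = l x u` with `x u' → 0` at the origin is not square integrable:
`x Re (ū u')` increases from zero, hence `|u|²` is nondecreasing. -/
theorem HasTwofoldForm.eq_zero {f : L2} {l : ℝ} {a : ℂ} (hl : 0 ≤ l)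
    (h : HasTwofoldForm f ((l : ℂ) • f) a 0) : f = 0 := by
  set g : L2 := (l : ℂ) • f with hg
  set u : ℝ → ℂ := fun x => a + twofold g x with hu
  have hud : ∀ x : ℝ, 0 < x → HasDerivAt u (x⁻¹ • moment g x) x := fun x hx =>
    ((hasDerivAt_twofold g hx).const_add a).congr_deriv (by rw [Complex.real_smul])
  have huc : ContinuousOn u (Ioi 0) := fun x hx => (hud x hx).continuousAt.continuousWithinAt
  have hfu : ∀ᵐ x ∂halfLine, f x = (Real.sqrt x : ℂ) * u x := by
    filter_upwards [h] with x hx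
    rw [hx, hu]; ring
  have hmom : ∀ x : ℝ, 0 < x → moment g x = ∫ y in (0 : ℝ)..x, (l * y) • u y := by
    intro x hx
    rw [moment, intervalIntegral.integral_of_le hx.le, intervalIntegral.integral_of_le hx.le]
    have h3 : volume.restrict (Ioc 0 x) ≤ halfLine :=
      Measure.restrict_mono Ioc_subset_Ioi_self le_rfl
    refine integral_congr_ae ?_
    filter_upwards [ae_mono h3 hfu, ae_mono h3 (Lp.coeFn_smul (l : ℂ) f),
      ae_restrict_mem measurableSet_Ioc] with y h1 h2 hy
    rw [hg, h2, Pi.smul_apply, h1, smul_eq_mul, Complex.real_smul]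
    have := Real.mul_self_sqrt hy.1.le
    have h4 : (Real.sqrt y : ℂ) * (Real.sqrt y : ℂ) = (y : ℂ) := by exact_mod_cast this
    push_cast
    linear_combination (l * u y) * h4
  have hmi : ∀ x : ℝ, 0 < x → IntervalIntegrable (fun y : ℝ => (l * y) • u y) volume 0 x := by
    intro x hx
    rw [intervalIntegrable_iff_integrableOn_Ioc_of_le hx.le]
    refine (integrableOn_const (C := l * x * (‖a‖ + x * ‖g‖)) (s := Ioc 0 x)
      measure_Ioc_lt_top.ne).mono' ?_ ?_
    · exact ((continuousOn_const.mul continuousOn_id).smul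
        (huc.mono Ioc_subset_Ioi_self)).aestronglyMeasurable measurableSet_Ioc
    · filter_upwards [ae_restrict_mem measurableSet_Ioc] with y hy
      have hy0 : 0 < y := hy.1
      rw [norm_smul, Real.norm_of_nonneg (by positivity)]
      have h1 : ‖u y‖ ≤ ‖a‖ + x * ‖g‖ := (norm_add_le _ _).trans
        (add_le_add le_rfl ((norm_twofold_le g hy0.le).trans
          (mul_le_mul_of_nonneg_right hy.2 (norm_nonneg _))))
      have := hy.2
      gcongr
  have hmd : ∀ x : ℝ, 0 < x → HasDerivAt (moment g) ((l * x) • u x) x := by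
    intro x hx
    have hc : ContinuousOn (fun y : ℝ => (l * y) • u y) (Ioi 0) :=
      (continuousOn_const.mul continuousOn_id).smul huc
    refine (intervalIntegral.integral_hasDerivAt_right (hmi x hx)
      (hc.stronglyMeasurableAtFilter isOpen_Ioi x hx)
      (hc.continuousAt (Ioi_mem_nhds hx))).congr_of_eventuallyEq ?_
    filter_upwards [lt_mem_nhds hx] with y hy using hmom y hy
  set e : ℝ → ℝ := fun x => inner ℝ (u x) (moment g x) with he
  have hed : ∀ x : ℝ, 0 < x →
      HasDerivAt e (l * x * ‖u x‖ ^ 2 + x⁻¹ * ‖moment g x‖ ^ 2) x := by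
    intro x hx
    refine ((hud x hx).inner ℝ (hmd x hx)).congr_deriv ?_
    rw [real_inner_smul_right, real_inner_smul_left, real_inner_self_eq_norm_sq,
      real_inner_self_eq_norm_sq]
  have hmono : MonotoneOn e (Ioi 0) := by
    refine monotoneOn_of_deriv_nonneg (convex_Ioi 0)
      (fun x hx => (hed x hx).continuousAt.continuousWithinAt) (fun x hx => ?_) fun x hx => ?_
    · rw [interior_Ioi] at hx
      exact (hed x hx).differentiableAt.differentiableWithinAt
    · rw [interior_Ioi] at hx
      have hx : 0 < x := hx
      rw [(hed x hx).deriv]; positivity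
  have he0 : Tendsto e (𝓝[>] 0) (𝓝 0) := by
    have h2 : Tendsto (fun x : ℝ => (‖a‖ + x * ‖g‖) * (x * ‖g‖)) (𝓝[>] 0) (𝓝 0) := by
      have : ContinuousAt (fun x : ℝ => (‖a‖ + x * ‖g‖) * (x * ‖g‖)) 0 := by fun_prop
      have h3 := this.tendsto
      simp only [zero_mul, mul_zero] at h3
      exact h3.mono_left nhdsWithin_le_nhds
    refine squeeze_zero_norm' ?_ h2
    filter_upwards [self_mem_nhdsWithin] with x hx
    have hx : 0 < x := hx
    refine (norm_inner_le_norm (𝕜 := ℝ) _ _).trans ?_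
    have h1 : ‖u x‖ ≤ ‖a‖ + x * ‖g‖ :=
      (norm_add_le _ _).trans (add_le_add le_rfl (norm_twofold_le g hx.le))
    exact mul_le_mul h1 (norm_moment_le g hx.le) (norm_nonneg _) (by positivity)
  have hepos : ∀ x : ℝ, 0 < x → 0 ≤ e x := by
    intro x hx
    refine le_of_tendsto he0 ?_
    filter_upwards [Ioo_mem_nhdsGT hx] with y hy
    exact hmono hy.1 hx hy.2.le
  have hnd : ∀ x : ℝ, 0 < x → HasDerivAt (fun x => ‖u x‖ ^ 2) (2 * (x⁻¹ * e x)) x := by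
    intro x hx
    refine (hud x hx).norm_sq.congr_deriv ?_
    rw [real_inner_smul_right]
  have hnmono : MonotoneOn (fun x => ‖u x‖ ^ 2) (Ioi 0) := by
    refine monotoneOn_of_deriv_nonneg (convex_Ioi 0)
      (fun x hx => (hnd x hx).continuousAt.continuousWithinAt) (fun x hx => ?_) fun x hx => ?_
    · rw [interior_Ioi] at hx
      exact (hnd x hx).differentiableAt.differentiableWithinAt
    · rw [interior_Ioi] at hx
      have hx : 0 < x := hx
      rw [(hnd x hx).deriv]
      have := hepos x hx
      positivity
  have hu0 : ∀ x : ℝ, 0 < x → u x = 0 := by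
    intro x hx
    by_contra hne
    have hp : 0 < x * ‖u x‖ ^ 2 := by have := norm_pos_iff.2 hne; positivity
    have hi : IntegrableOn (fun y => ‖f y‖ ^ 2) (Ioi x) :=
      IntegrableOn.mono_set ((memLp_two_iff_integrable_sq_norm
        (Lp.memLp f).aestronglyMeasurable).1 (Lp.memLp f)) (Ioi_subset_Ioi hx.le)
    have hcst : IntegrableOn (fun _ : ℝ => x * ‖u x‖ ^ 2) (Ioi x) := by
      refine hi.mono' aestronglyMeasurable_const ?_
      have h3 : volume.restrict (Ioi x) ≤ halfLine :=
        Measure.restrict_mono (Ioi_subset_Ioi hx.le) le_rfl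
      filter_upwards [ae_mono h3 hfu, ae_restrict_mem measurableSet_Ioi] with y h1 hy
      have hy : x < y := hy
      rw [Real.norm_of_nonneg hp.le, h1, norm_mul, Complex.norm_real,
        Real.norm_of_nonneg (Real.sqrt_nonneg _), mul_pow, Real.sq_sqrt (by linarith)]
      exact mul_le_mul hy.le (hnmono hx (hx.trans hy) hy.le) (by positivity) (by linarith)
    rw [integrableOn_const_iff] at hcst
    rcases hcst with h1 | h1
    · exact hp.ne' (by simpa using h1)
    · simp at h1
  rw [Lp.eq_zero_iff_ae_eq_zero]
  filter_upwards [hfu, ae_restrict_mem measurableSet_Ioi] with x h1 hx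
  rw [h1, hu0 x hx, mul_zero]; rfl

/-! ### The complementary exponential integral -/

/-- The entire exponential integral `Ein(z) = ∫₀ᶻ (1 - e^{-u}) / u du`. -/
def einInt (z : ℝ) : ℝ := ∫ u in (0 : ℝ)..z, (1 - Real.exp (-u)) / u

theorem one_sub_exp_div_mem {u : ℝ} (hu : 0 < u) : (1 - Real.exp (-u)) / u ∈ Icc (0 : ℝ) 1 := by
  have h1 := Real.add_one_le_exp (-u)
  have h2 : Real.exp (-u) ≤ 1 := Real.exp_le_one_iff.2 (by linarith)
  exact ⟨div_nonneg (by linarith) hu.le, (div_le_one hu).2 (by linarith)⟩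

theorem continuousOn_one_sub_exp_div :
    ContinuousOn (fun u : ℝ => (1 - Real.exp (-u)) / u) (Ioi 0) :=
  ContinuousOn.div (by fun_prop) continuousOn_id fun _ hu => ne_of_gt hu

theorem intervalIntegrable_one_sub_exp_div {z : ℝ} (hz : 0 ≤ z) :
    IntervalIntegrable (fun u : ℝ => (1 - Real.exp (-u)) / u) volume 0 z := by
  rw [intervalIntegrable_iff_integrableOn_Ioc_of_le hz]
  refine (integrableOn_const (C := (1 : ℝ)) (s := Ioc 0 z) measure_Ioc_lt_top.ne).mono'
    ((continuousOn_one_sub_exp_div.mono Ioc_subset_Ioi_self).aestronglyMeasurable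
      measurableSet_Ioc) ?_
  filter_upwards [ae_restrict_mem measurableSet_Ioc] with u hu
  have := one_sub_exp_div_mem hu.1
  rw [Real.norm_of_nonneg this.1]
  exact this.2

theorem hasDerivAt_einInt {z : ℝ} (hz : 0 < z) :
    HasDerivAt einInt ((1 - Real.exp (-z)) / z) z :=
  intervalIntegral.integral_hasDerivAt_right (intervalIntegrable_one_sub_exp_div hz.le)
    (continuousOn_one_sub_exp_div.stronglyMeasurableAtFilter isOpen_Ioi z hz)
    (continuousOn_one_sub_exp_div.continuousAt (Ioi_mem_nhds hz))

theorem einInt_mem {z : ℝ} (hz : 0 ≤ z) : einInt z ∈ Icc (0 : ℝ) z := by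
  rw [einInt, intervalIntegral.integral_of_le hz]
  constructor
  · exact setIntegral_nonneg measurableSet_Ioc fun u hu => (one_sub_exp_div_mem hu.1).1
  · calc _ ≤ ∫ _ in Ioc 0 z, (1 : ℝ) :=
          setIntegral_mono_on ((intervalIntegrable_iff_integrableOn_Ioc_of_le hz).1
            (intervalIntegrable_one_sub_exp_div hz)) (integrableOn_const measure_Ioc_lt_top.ne)
            measurableSet_Ioc fun u hu => (one_sub_exp_div_mem hu.1).2
      _ = z := by simp [hz]

theorem einInt_zero : einInt 0 = 0 := intervalIntegral.integral_same

theorem tendsto_einInt_zero : Tendsto einInt (𝓝[≥] 0) (𝓝 0) := by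
  refine squeeze_zero' ?_ ?_ (tendsto_id.mono_left (nhdsWithin_le_nhds (s := Ici (0 : ℝ))))
  · filter_upwards [self_mem_nhdsWithin] with z hz using (einInt_mem hz).1
  · filter_upwards [self_mem_nhdsWithin] with z hz using (einInt_mem hz).2

/-- The derivative of the Gamma function at one, as an integral. -/
theorem integral_log_mul_exp_neg :
    ∫ u in Ioi (0 : ℝ), Real.log u * Real.exp (-u) = -Real.eulerMascheroniConstant := by
  have h1 := Complex.hasDerivAt_GammaIntegral (s := 1) (by simp)
  have h2 : HasDerivAt Complex.GammaIntegral (-(Real.eulerMascheroniConstant : ℂ)) 1 := by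
    refine Complex.hasDerivAt_Gamma_one.congr_of_eventuallyEq ?_
    have : {s : ℂ | 0 < s.re} ∈ 𝓝 (1 : ℂ) :=
      (isOpen_lt continuous_const Complex.continuous_re).mem_nhds (by simp)
    filter_upwards [this] with s hs
    exact (Complex.Gamma_eq_integral hs).symm
  have h3 := h1.unique h2
  simp only [sub_self, Complex.cpow_zero, one_mul] at h3
  have h4 : ∫ t in Ioi (0 : ℝ), (Real.log t : ℂ) * (Real.exp (-t) : ℂ) =
      ((∫ u in Ioi (0 : ℝ), Real.log u * Real.exp (-u) : ℝ) : ℂ) := by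
    rw [← integral_complex_ofReal]
    push_cast; rfl
  rw [h4] at h3
  exact_mod_cast h3

theorem integrableOn_log_mul_exp_neg :
    IntegrableOn (fun u : ℝ => Real.log u * Real.exp (-u)) (Ioi 0) := by
  refine Integrable.of_integral_ne_zero ?_
  rw [integral_log_mul_exp_neg]
  have := Real.one_half_lt_eulerMascheroniConstant
  intro h; linarith

theorem laplace_log {l : ℝ} (hl : 0 < l) :
    IntegrableOn (fun r : ℝ => Real.exp (-(l * r)) * Real.log r) (Ioi 0) ∧
    l * ∫ r in Ioi (0 : ℝ), Real.exp (-(l * r)) * Real.log r =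
      -Real.eulerMascheroniConstant - Real.log l := by
  have h1 := (integrableOn_Ioi_comp_mul_left_iff
    (fun u : ℝ => Real.log u * Real.exp (-u)) 0 hl).2 (by
      rw [mul_zero]; exact integrableOn_log_mul_exp_neg)
  have h2 := integral_comp_mul_left_Ioi (fun u : ℝ => Real.log u * Real.exp (-u)) 0 hl
  rw [mul_zero, integral_log_mul_exp_neg, smul_eq_mul] at h2
  have h3 : IntegrableOn (fun r : ℝ => Real.log l * Real.exp (-l * r)) (Ioi 0) :=
    (integrableOn_exp_mul_Ioi (by linarith) 0).const_mul _
  have heq : ∀ r ∈ Ioi (0 : ℝ), Real.log (l * r) * Real.exp (-(l * r)) -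
      Real.log l * Real.exp (-l * r) = Real.exp (-(l * r)) * Real.log r := by
    intro r hr
    rw [Real.log_mul hl.ne' (ne_of_gt hr), neg_mul]; ring
  refine ⟨(h1.sub h3).congr_fun heq measurableSet_Ioi, ?_⟩
  rw [← setIntegral_congr_fun measurableSet_Ioi heq, integral_sub h1 h3, h2, integral_const_mul,
    integral_exp_mul_Ioi (by linarith), mul_zero, Real.exp_zero]
  field_simp

/-- `Ein(z) - log z → γ` as `z → ∞`: integrate `∫₀ᶻ e^{-u} log u du` by parts. -/
theorem tendsto_einInt_sub_log :
    Tendsto (fun z => einInt z - Real.log z) atTop (𝓝 Real.eulerMascheroniConstant) := by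
  have hftc : ∀ z : ℝ, 0 < z → ∫ u in (0 : ℝ)..z, Real.log u * Real.exp (-u) =
      Real.log z * (1 - Real.exp (-z)) - einInt z := by
    intro z hz
    have hd : ∀ u : ℝ, 0 < u → HasDerivAt
        (fun u => Real.log u * (1 - Real.exp (-u)) - einInt u) (Real.log u * Real.exp (-u)) u := by
      intro u hu
      have h1 : HasDerivAt (fun u : ℝ => 1 - Real.exp (-u)) (Real.exp (-u)) u := by
        have := ((hasDerivAt_neg u).exp).const_sub 1
        simpa using this
      refine (((Real.hasDerivAt_log hu.ne').mul h1).sub (hasDerivAt_einInt hu)).congr_deriv ?_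
      field_simp
      ring
    have hlim : Tendsto (fun u => Real.log u * (1 - Real.exp (-u)) - einInt u)
        (𝓝[>] 0) (𝓝 0) := by
      have h1 : Tendsto (fun u : ℝ => Real.log u * (1 - Real.exp (-u))) (𝓝[>] 0) (𝓝 0) := by
        have h2 := (tendsto_log_mul_rpow_nhdsGT_zero (r := 1) one_pos).norm
        simp only [Real.rpow_one, norm_zero] at h2
        refine squeeze_zero_norm' ?_ h2
        filter_upwards [self_mem_nhdsWithin] with u hu
        have hu : 0 < u := hu
        have h3 := Real.add_one_le_exp (-u)
        have h4 : Real.exp (-u) ≤ 1 := Real.exp_le_one_iff.2 (by linarith)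
        rw [norm_mul, norm_mul, Real.norm_of_nonneg hu.le,
          Real.norm_of_nonneg (by linarith : 0 ≤ 1 - Real.exp (-u))]
        refine mul_le_mul_of_nonneg_left ?_ (norm_nonneg _)
        linarith
      have h2 := h1.sub (tendsto_einInt_zero.mono_left (nhdsWithin_mono 0 Ioi_subset_Ici_self))
      rwa [sub_zero] at h2
    have h := intervalIntegral.integral_eq_sub_of_hasDerivAt_of_tendsto hz
      (fun u hu => hd u hu.1)
      ((intervalIntegrable_iff_integrableOn_Ioc_of_le hz.le).2
        (integrableOn_log_mul_exp_neg.mono_set Ioc_subset_Ioi_self)) hlim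
      ((hd z hz).continuousAt.tendsto.mono_left nhdsWithin_le_nhds)
    rw [h, sub_zero]
  have h1 := intervalIntegral_tendsto_integral_Ioi 0 integrableOn_log_mul_exp_neg tendsto_id
  rw [integral_log_mul_exp_neg] at h1
  have h2 : Tendsto (fun z : ℝ => Real.log z * Real.exp (-z)) atTop (𝓝 0) := by
    have h3 := Real.tendsto_pow_mul_exp_neg_atTop_nhds_zero 1
    refine squeeze_zero_norm' ?_ h3
    filter_upwards [eventually_ge_atTop 1] with z hz
    rw [Real.norm_of_nonneg (mul_nonneg (Real.log_nonneg hz) (Real.exp_pos _).le), pow_one]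
    gcongr
    exact (Real.log_le_sub_one_of_pos (by linarith)).trans (by linarith)
  have h3 := h1.neg.sub h2
  rw [neg_neg, sub_zero] at h3
  refine h3.congr' ?_
  filter_upwards [eventually_gt_atTop 0] with z hz
  simp only [id]
  rw [hftc z hz]
  ring

theorem integral_inv_mul_one_sub_exp {r x : ℝ} (hr : 0 < r) (hx : 0 ≤ x) :
    ∫ s in (0 : ℝ)..x, s⁻¹ * (1 - Real.exp (-s ^ 2 / (4 * r))) = einInt (x ^ 2 / (4 * r)) / 2 := by
  have hd : ∀ s : ℝ, 0 < s → HasDerivAt (fun s => einInt (s ^ 2 / (4 * r)) / 2)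
      (s⁻¹ * (1 - Real.exp (-s ^ 2 / (4 * r)))) s := by
    intro s hs
    have h1 : HasDerivAt (fun s : ℝ => s ^ 2 / (4 * r)) (2 * s / (4 * r)) s := by
      simpa using (hasDerivAt_pow 2 s).div_const (4 * r)
    refine (((hasDerivAt_einInt (by positivity)).comp s h1).div_const 2).congr_deriv ?_
    rw [neg_div]
    field_simp
  have hc : ContinuousOn (fun s => einInt (s ^ 2 / (4 * r)) / 2) (Icc 0 x) := by
    intro s hs
    rcases hs.1.eq_or_lt with h | h
    · subst h
      refine ContinuousWithinAt.mono ?_ (Icc_subset_Ici_self)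
      show Tendsto _ _ _
      have h1 : Tendsto (fun s : ℝ => s ^ 2 / (4 * r)) (𝓝[≥] 0) (𝓝[≥] 0) := by
        refine tendsto_nhdsWithin_of_tendsto_nhds_of_eventually_within _ ?_
          (Eventually.of_forall fun s => show 0 ≤ s ^ 2 / (4 * r) by positivity)
        have h2 : ContinuousAt (fun s : ℝ => s ^ 2 / (4 * r)) 0 := by fun_prop
        have h3 := h2.tendsto
        simp only [ne_eq, OfNat.ofNat_ne_zero, not_false_eq_true, zero_pow, zero_div] at h3
        exact h3.mono_left nhdsWithin_le_nhds
      have h2 := (tendsto_einInt_zero.comp h1).div_const 2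
      simpa [einInt_zero] using h2
    · exact (hd s h).continuousAt.continuousWithinAt
  have hint : IntervalIntegrable (fun s : ℝ => s⁻¹ * (1 - Real.exp (-s ^ 2 / (4 * r))))
      volume 0 x := by
    rw [intervalIntegrable_iff_integrableOn_Ioc_of_le hx]
    refine (integrableOn_const (C := x / (4 * r)) (s := Ioc 0 x) measure_Ioc_lt_top.ne).mono'
      (by fun_prop) ?_
    filter_upwards [ae_restrict_mem measurableSet_Ioc] with s hs
    have hs0 : 0 < s := hs.1
    have h1 := Real.add_one_le_exp (-s ^ 2 / (4 * r))
    have h2 : Real.exp (-s ^ 2 / (4 * r)) ≤ 1 := Real.exp_le_one_iff.2 (by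
      rw [neg_div]; have : 0 ≤ s ^ 2 / (4 * r) := by positivity
      linarith)
    rw [norm_mul, norm_inv, Real.norm_of_nonneg hs0.le, Real.norm_of_nonneg (by linarith),
      inv_mul_le_iff₀ hs0]
    calc _ ≤ s ^ 2 / (4 * r) := by rw [neg_div] at h1; rw [neg_div]; linarith
      _ = s * (s / (4 * r)) := by ring
      _ ≤ _ := by have := hs.2; gcongr
  rw [intervalIntegral.integral_eq_sub_of_hasDerivAt_of_le hx hc (fun s hs => hd s hs.1) hint]
  simp [einInt_zero]

theorem hasDerivAt_einInt_div {x r : ℝ} (hx : 0 < x) (hr : 0 < r) :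
    HasDerivAt (fun r => einInt (x ^ 2 / (4 * r)) / 2)
      (Real.exp (-x ^ 2 / (4 * r)) / (2 * r) - 1 / (2 * r)) r := by
  have h1 : HasDerivAt (fun r : ℝ => x ^ 2 / (4 * r)) (-(x ^ 2 / (4 * r ^ 2))) r := by
    refine ((hasDerivAt_const r (x ^ 2)).div ((hasDerivAt_id r).const_mul 4)
      (by positivity)).congr_deriv ?_
    simp only [id]
    field_simp
    ring
  refine (((hasDerivAt_einInt (by positivity)).comp r h1).div_const 2).congr_deriv ?_
  rw [neg_div]
  field_simp
  ring

theorem einInt_div_le {x r : ℝ} (hr : 0 < r) :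
    |einInt (x ^ 2 / (4 * r)) / 2| ≤ x ^ 2 / (8 * r) := by
  have h1 := einInt_mem (z := x ^ 2 / (4 * r)) (by positivity)
  rw [abs_of_nonneg (div_nonneg h1.1 zero_le_two)]
  calc _ ≤ x ^ 2 / (4 * r) / 2 := by gcongr; exact h1.2
    _ = _ := by field_simp; ring

theorem tendsto_exp_mul_einInt_atTop {l x : ℝ} (hl : 0 < l) :
    Tendsto (fun r => Real.exp (-(l * r)) * (einInt (x ^ 2 / (4 * r)) / 2)) atTop (𝓝 0) := by
  have h1 : Tendsto (fun r : ℝ => x ^ 2 / 8 * r⁻¹) atTop (𝓝 0) := by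
    have := (tendsto_inv_atTop_zero (𝕜 := ℝ)).const_mul (x ^ 2 / 8)
    rwa [mul_zero] at this
  refine squeeze_zero_norm' ?_ h1
  filter_upwards [eventually_gt_atTop 0] with r hr
  rw [norm_mul, Real.norm_of_nonneg (Real.exp_pos _).le, Real.norm_eq_abs]
  calc _ ≤ 1 * (x ^ 2 / (8 * r)) := by
        gcongr
        · exact Real.exp_le_one_iff.2 (by have := mul_pos hl hr; linarith)
        · exact einInt_div_le hr
    _ = _ := by field_simp

/-- Integration by parts in the time variable, from a positive time. -/
theorem integral_exp_mul_einInt {l x s : ℝ} (hl : 0 < l) (hx : 0 < x) (hs : 0 < s)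
    (hi : IntegrableOn (fun r => Real.exp (-(l * r)) * (einInt (x ^ 2 / (4 * r)) / 2)) (Ioi s)) :
    l * (∫ r in Ioi s, Real.exp (-(l * r)) * (einInt (x ^ 2 / (4 * r)) / 2)) -
        Real.exp (-(l * s)) * (einInt (x ^ 2 / (4 * s)) / 2) =
      (∫ r in Ioi s, Real.exp (-(l * r)) * (Real.exp (-x ^ 2 / (4 * r)) / (2 * r))) -
        ∫ r in Ioi s, Real.exp (-(l * r)) / (2 * r) := by
  have hb : IntegrableOn (fun r : ℝ => Real.exp (-l * r) * (2 * s)⁻¹) (Ioi s) :=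
    (integrableOn_exp_mul_Ioi (by linarith) s).mul_const _
  have hinv : ∀ r ∈ Ioi s, (2 * r)⁻¹ ≤ (2 * s)⁻¹ := fun r hr =>
    inv_anti₀ (by positivity) (by have : s < r := hr; linarith)
  have h1 : IntegrableOn (fun r : ℝ => Real.exp (-(l * r)) / (2 * r)) (Ioi s) := by
    refine hb.mono' (Measurable.aestronglyMeasurable (by fun_prop)) ?_
    filter_upwards [ae_restrict_mem measurableSet_Ioi] with r hr
    have hr0 : 0 < r := hs.trans hr
    rw [Real.norm_of_nonneg (by positivity), div_eq_mul_inv, neg_mul]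
    exact mul_le_mul_of_nonneg_left (hinv r hr) (Real.exp_pos _).le
  have h2 : IntegrableOn (fun r : ℝ => Real.exp (-(l * r)) *
      (Real.exp (-x ^ 2 / (4 * r)) / (2 * r))) (Ioi s) := by
    refine hb.mono' (Measurable.aestronglyMeasurable (by fun_prop)) ?_
    filter_upwards [ae_restrict_mem measurableSet_Ioi] with r hr
    have hr0 : 0 < r := hs.trans hr
    rw [Real.norm_of_nonneg (by positivity), div_eq_mul_inv, neg_mul]
    have h3 : Real.exp (-x ^ 2 / (4 * r)) ≤ 1 := Real.exp_le_one_iff.2 (by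
      rw [neg_div]; have : 0 ≤ x ^ 2 / (4 * r) := by positivity
      linarith)
    refine mul_le_mul_of_nonneg_left ?_ (Real.exp_pos _).le
    exact (mul_le_mul h3 (hinv r hr) (by positivity) zero_le_one).trans_eq (one_mul _)
  have h3 := integral_Ioi_of_hasDerivAt_of_tendsto'
    (f := fun r => Real.exp (-(l * r)) * (einInt (x ^ 2 / (4 * r)) / 2))
    (f' := fun r => -(l * (Real.exp (-(l * r)) * (einInt (x ^ 2 / (4 * r)) / 2))) +
      (Real.exp (-(l * r)) * (Real.exp (-x ^ 2 / (4 * r)) / (2 * r)) -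
        Real.exp (-(l * r)) / (2 * r))) (a := s) (m := 0) (fun r hr => ?_)
    ((hi.const_mul l).neg.add (h2.sub h1)) (tendsto_exp_mul_einInt_atTop hl)
  · have e1 : IntegrableOn (fun r => -(l * (Real.exp (-(l * r)) *
        (einInt (x ^ 2 / (4 * r)) / 2)))) (Ioi s) := (hi.const_mul l).neg
    have e2 : IntegrableOn (fun r => Real.exp (-(l * r)) * (Real.exp (-x ^ 2 / (4 * r)) / (2 * r)) -
        Real.exp (-(l * r)) / (2 * r)) (Ioi s) := h2.sub h1
    rw [integral_add e1 e2, integral_neg, integral_sub h2 h1, integral_const_mul] at h3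
    linear_combination -h3
  · have hr0 : 0 < r := lt_of_lt_of_le hs hr
    have h4 : HasDerivAt (fun r : ℝ => Real.exp (-(l * r))) (-l * Real.exp (-(l * r))) r := by
      have := ((hasDerivAt_id r).const_mul l).neg.exp
      refine this.congr_deriv ?_
      simp; ring
    refine (h4.mul (hasDerivAt_einInt_div hx hr0)).congr_deriv ?_
    field_simp

/-- The limiting case of a vanishing initial time, in which the logarithmic singularity of `Ein` at
infinity contributes `log x` and the Euler-Mascheroni constant. -/
theorem integral_exp_mul_einInt_zero {l x : ℝ} (hl : 0 < l) (hx : 0 < x)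
    (hi : IntegrableOn (fun r => Real.exp (-(l * r)) * (einInt (x ^ 2 / (4 * r)) / 2)) (Ioi 0))
    (hk : IntegrableOn (fun r => Real.exp (-(l * r)) *
      (Real.exp (-x ^ 2 / (4 * r)) / (2 * r))) (Ioi 0)) :
    l * ∫ r in Ioi 0, Real.exp (-(l * r)) * (einInt (x ^ 2 / (4 * r)) / 2) =
      (∫ r in Ioi 0, Real.exp (-(l * r)) * (Real.exp (-x ^ 2 / (4 * r)) / (2 * r))) +
        Real.log x + (Real.log l / 2 - Real.log 2 + Real.eulerMascheroniConstant) := by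
  set H₀ : ℝ := Real.eulerMascheroniConstant / 2 + Real.log x - Real.log 2 with hH
  obtain ⟨hlog, hlogv⟩ := laplace_log hl
  have hd : ∀ r : ℝ, 0 < r → HasDerivAt
      (fun r => Real.exp (-(l * r)) * (einInt (x ^ 2 / (4 * r)) / 2 + Real.log r / 2))
      (-(l * (Real.exp (-(l * r)) * (einInt (x ^ 2 / (4 * r)) / 2)) +
        l / 2 * (Real.exp (-(l * r)) * Real.log r)) +
      Real.exp (-(l * r)) * (Real.exp (-x ^ 2 / (4 * r)) / (2 * r))) r := by
    intro r hr
    have h4 : HasDerivAt (fun r : ℝ => Real.exp (-(l * r))) (-l * Real.exp (-(l * r))) r := by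
      have := ((hasDerivAt_id r).const_mul l).neg.exp
      refine this.congr_deriv ?_
      simp; ring
    refine (h4.mul ((hasDerivAt_einInt_div hx hr).add
      ((Real.hasDerivAt_log hr.ne').div_const 2))).congr_deriv ?_
    simp only [Pi.add_apply]
    field_simp
    ring
  have hint : IntegrableOn (fun r => -(l * (Real.exp (-(l * r)) *
      (einInt (x ^ 2 / (4 * r)) / 2)) + l / 2 * (Real.exp (-(l * r)) * Real.log r)) +
      Real.exp (-(l * r)) * (Real.exp (-x ^ 2 / (4 * r)) / (2 * r))) (Ioi 0) :=
    ((hi.const_mul l).add (hlog.const_mul (l / 2))).neg.add hk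
  have hzero : Tendsto
      (fun r => Real.exp (-(l * r)) * (einInt (x ^ 2 / (4 * r)) / 2 + Real.log r / 2))
      (𝓝[>] 0) (𝓝 H₀) := by
    have h1 : Tendsto (fun r : ℝ => x ^ 2 / (4 * r)) (𝓝[>] 0) atTop := by
      have := tendsto_inv_nhdsGT_zero (𝕜 := ℝ)
      refine (this.const_mul_atTop (show 0 < x ^ 2 / 4 by positivity)).congr fun r => ?_
      rw [← div_eq_mul_inv, div_div]
    have h2 := ((tendsto_einInt_sub_log.comp h1).div_const 2).add_const (Real.log x - Real.log 2)
    have h3 : Tendsto (fun r : ℝ => Real.exp (-(l * r))) (𝓝[>] 0) (𝓝 1) := by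
      have h4 : Continuous fun r : ℝ => Real.exp (-(l * r)) := by fun_prop
      have h5 := h4.tendsto 0
      simp only [mul_zero, neg_zero, Real.exp_zero] at h5
      exact h5.mono_left nhdsWithin_le_nhds
    have h4 := h3.mul h2
    rw [one_mul, show Real.eulerMascheroniConstant / 2 + (Real.log x - Real.log 2) = H₀ by
      rw [hH]; ring] at h4
    refine h4.congr' ?_
    filter_upwards [self_mem_nhdsWithin] with r hr
    have hr : 0 < r := hr
    simp only [Function.comp]
    rw [Real.log_div (by positivity) (by positivity), Real.log_pow,
      Real.log_mul (by norm_num) hr.ne', show (4 : ℝ) = 2 ^ 2 by norm_num, Real.log_pow]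
    push_cast
    ring
  have htop : Tendsto
      (fun r => Real.exp (-(l * r)) * (einInt (x ^ 2 / (4 * r)) / 2 + Real.log r / 2))
      atTop (𝓝 0) := by
    have h1 : Tendsto (fun r : ℝ => Real.exp (-(l * r)) * (Real.log r / 2)) atTop (𝓝 0) := by
      have h2 : Tendsto (fun r : ℝ => l * r) atTop atTop := tendsto_id.const_mul_atTop hl
      have h3 := ((Real.tendsto_pow_mul_exp_neg_atTop_nhds_zero 1).comp h2).const_mul (l⁻¹ / 2)
      rw [mul_zero] at h3
      refine squeeze_zero_norm' ?_ h3
      filter_upwards [eventually_ge_atTop 1] with r hr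
      have := Real.log_nonneg hr
      rw [Real.norm_of_nonneg (by positivity)]
      simp only [Function.comp, pow_one]
      have h4 : Real.log r ≤ r := (Real.log_le_sub_one_of_pos (by linarith)).trans (by linarith)
      calc _ ≤ Real.exp (-(l * r)) * (r / 2) := by gcongr
        _ = _ := by field_simp
    have h2 := (tendsto_exp_mul_einInt_atTop (x := x) hl).add h1
    rw [add_zero] at h2
    exact h2.congr fun r => by ring
  set F : ℝ → ℝ := Function.update
    (fun r => Real.exp (-(l * r)) * (einInt (x ^ 2 / (4 * r)) / 2 + Real.log r / 2)) 0 H₀ with hF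
  have hFd : ∀ r ∈ Ioi (0 : ℝ), HasDerivAt F
      (-(l * (Real.exp (-(l * r)) * (einInt (x ^ 2 / (4 * r)) / 2)) +
        l / 2 * (Real.exp (-(l * r)) * Real.log r)) +
      Real.exp (-(l * r)) * (Real.exp (-x ^ 2 / (4 * r)) / (2 * r))) r := by
    intro r hr
    refine (hd r hr).congr_of_eventuallyEq ?_
    filter_upwards [Ioi_mem_nhds hr] with y hy
    rw [hF, Function.update_of_ne (ne_of_gt hy)]
  have hFc : ContinuousWithinAt F (Ici 0) 0 := by
    rw [← Ioi_insert, continuousWithinAt_insert_self]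
    rw [ContinuousWithinAt, hF, Function.update_self]
    refine hzero.congr' ?_
    filter_upwards [self_mem_nhdsWithin] with y hy
    rw [Function.update_of_ne (ne_of_gt hy)]
  have hFt : Tendsto F atTop (𝓝 0) := by
    refine htop.congr' ?_
    filter_upwards [eventually_gt_atTop 0] with y hy
    rw [hF, Function.update_of_ne (ne_of_gt hy)]
  have h := integral_Ioi_of_hasDerivAt_of_tendsto hFc hFd hint hFt
  have e1 : IntegrableOn (fun r => -(l * (Real.exp (-(l * r)) * (einInt (x ^ 2 / (4 * r)) / 2)) +
      l / 2 * (Real.exp (-(l * r)) * Real.log r))) (Ioi 0) :=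
    ((hi.const_mul l).add (hlog.const_mul (l / 2))).neg
  rw [integral_add e1 hk, integral_neg,
    integral_add (hi.const_mul l) (hlog.const_mul (l / 2)), integral_const_mul,
    integral_const_mul, hF, Function.update_self, hH] at h
  linear_combination -h - hlogv / 2

/-! ### The resolvent in integrated form -/

/-- The twofold integral at a fixed point, as a continuous functional on `L²(0, ∞)`. -/
def twofoldL {x : ℝ} (hx : 0 ≤ x) : L2 →L[ℂ] ℂ :=
  LinearMap.mkContinuous
    { toFun := fun g => twofold g x
      map_add' := fun g h => twofold_add g h hx
      map_smul' := fun c g => twofold_smul c g hx } x fun g => norm_twofold_le g hx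

theorem twofoldL_apply {x : ℝ} (hx : 0 ≤ x) (g : L2) : twofoldL hx g = twofold g x := rfl

theorem moment_traceVec {r x : ℝ} (hr : 0 < r) (hx : 0 ≤ x) :
    moment (traceVec r) x = ((1 - Real.exp (-x ^ 2 / (4 * r)) : ℝ) : ℂ) := by
  have h1 : moment (traceVec r) x =
      ∫ y in (0 : ℝ)..x, ((y / (2 * r) * Real.exp (-y ^ 2 / (4 * r)) : ℝ) : ℂ) := by
    rw [moment, intervalIntegral.integral_of_le hx, intervalIntegral.integral_of_le hx]
    have h3 : volume.restrict (Ioc 0 x) ≤ halfLine :=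
      Measure.restrict_mono Ioc_subset_Ioi_self le_rfl
    refine integral_congr_ae ?_
    filter_upwards [ae_mono h3 (coeFn_traceVec r), ae_restrict_mem measurableSet_Ioc] with y h1 hy
    rw [h1, causalTrace_of_pos hr, traceKernel, ← Complex.ofReal_mul]
    congr 1
    linear_combination (Real.exp (-y ^ 2 / (4 * r)) / (2 * r)) * Real.mul_self_sqrt hy.1.le
  have h2 : ∀ y : ℝ, HasDerivAt (fun y : ℝ => -Real.exp (-y ^ 2 / (4 * r)))
      (y / (2 * r) * Real.exp (-y ^ 2 / (4 * r))) y := by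
    intro y
    have h3 : HasDerivAt (fun y : ℝ => -y ^ 2 / (4 * r)) (-(2 * y) / (4 * r)) y := by
      simpa using (hasDerivAt_pow 2 y).neg.div_const (4 * r)
    refine h3.exp.neg.congr_deriv ?_
    field_simp
    ring
  rw [h1, intervalIntegral.integral_ofReal,
    intervalIntegral.integral_eq_sub_of_hasDerivAt (fun y _ => h2 y)
      (Continuous.intervalIntegrable (by fun_prop) _ _)]
  congr 1
  simp
  ring

theorem twofold_traceVec {r x : ℝ} (hr : 0 < r) (hx : 0 ≤ x) :
    twofold (traceVec r) x = ((einInt (x ^ 2 / (4 * r)) / 2 : ℝ) : ℂ) := by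
  rw [← integral_inv_mul_one_sub_exp hr hx, ← intervalIntegral.integral_ofReal, twofold]
  refine intervalIntegral.integral_congr fun s hs => ?_
  rw [uIcc_of_le hx] at hs
  rw [moment_traceVec hr hs.1]
  push_cast
  rfl

/-- The integral `∫_s^∞ e^{-lr} n_r dr` of the trace kernels `n_r`. -/
def tailVec (l s : ℝ) : L2 := ∫ r in Ioi s, ((Real.exp (-(l * r)) : ℝ) : ℂ) • traceVec r

theorem tailVec_zero (l : ℝ) : tailVec l 0 = decayVec l := by
  refine setIntegral_eq_integral_of_forall_compl_eq_zero fun r hr => ?_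
  rw [traceVec_of_nonpos (not_lt.1 hr), smul_zero]

theorem twofold_tailVec {l s x : ℝ} (hl : 0 < l) (hs : 0 ≤ s) (hx : 0 ≤ x) :
    IntegrableOn (fun r => Real.exp (-(l * r)) * (einInt (x ^ 2 / (4 * r)) / 2)) (Ioi s) ∧
    twofold (tailVec l s) x =
      ((∫ r in Ioi s, Real.exp (-(l * r)) * (einInt (x ^ 2 / (4 * r)) / 2) : ℝ) : ℂ) := by
  have hi := (integrable_exp_smul_traceVec hl).integrableOn (s := Ioi s)
  have heq : ∀ r ∈ Ioi s, twofoldL hx (((Real.exp (-(l * r)) : ℝ) : ℂ) • traceVec r) =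
      ((Real.exp (-(l * r)) * (einInt (x ^ 2 / (4 * r)) / 2) : ℝ) : ℂ) := by
    intro r hr
    rw [map_smul, twofoldL_apply, twofold_traceVec (hs.trans_lt hr) hx, smul_eq_mul,
      ← Complex.ofReal_mul]
  constructor
  · have h1 := ((twofoldL hx).integrable_comp hi).re
    refine h1.congr ?_
    filter_upwards [ae_restrict_mem measurableSet_Ioi] with r hr
    rw [heq r hr]
    exact Complex.ofReal_re _
  · rw [← twofoldL_apply hx, tailVec, ← (twofoldL hx).integral_comp_comm hi,
      setIntegral_congr_fun measurableSet_Ioi heq, integral_complex_ofReal]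

theorem coeFn_tailVec {l s : ℝ} (hl : 0 < l) (hs : 0 ≤ s) : ∀ᵐ x ∂halfLine,
    IntegrableOn (fun r => Real.exp (-(l * r)) * (Real.exp (-x ^ 2 / (4 * r)) / (2 * r))) (Ioi s) ∧
    tailVec l s x = (Real.sqrt x : ℂ) *
      ((∫ r in Ioi s, Real.exp (-(l * r)) * (Real.exp (-x ^ 2 / (4 * r)) / (2 * r)) : ℝ) : ℂ) := by
  have hm : Measurable fun p : ℝ × ℝ =>
      ((Real.exp (-(l * p.2)) : ℝ) : ℂ) * (causalTrace p.1 p.2 : ℂ) :=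
    Measurable.mul (by fun_prop) (Complex.measurable_ofReal.comp measurable_causalTrace)
  have h := coeFn_integral_L2 (μ := volume.restrict (Ioi s))
    (N := fun r => ((Real.exp (-(l * r)) : ℝ) : ℂ) • traceVec r)
    (k := fun x r => ((Real.exp (-(l * r)) : ℝ) : ℂ) * (causalTrace x r : ℂ))
    hm.aestronglyMeasurable (integrable_exp_smul_traceVec hl).integrableOn
    (ae_of_all _ fun r => by
      filter_upwards [Lp.coeFn_smul ((Real.exp (-(l * r)) : ℝ) : ℂ) (traceVec r),
        coeFn_traceVec r] with x h1 h2
      rw [h1, Pi.smul_apply, h2, smul_eq_mul])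
  filter_upwards [h.1, h.2, ae_restrict_mem measurableSet_Ioi] with x h1 h2 hx
  have hsx : 0 < Real.sqrt x := Real.sqrt_pos.2 hx
  have heq : ∀ r ∈ Ioi s, ((Real.exp (-(l * r)) : ℝ) : ℂ) * (causalTrace x r : ℂ) =
      ((Real.sqrt x * (Real.exp (-(l * r)) * (Real.exp (-x ^ 2 / (4 * r)) / (2 * r))) : ℝ) : ℂ) := by
    intro r hr
    rw [causalTrace_of_pos (hs.trans_lt hr), traceKernel, ← Complex.ofReal_mul]
    congr 1
    ring
  constructor
  · have h3 := (h1.re).const_mul (Real.sqrt x)⁻¹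
    refine Integrable.congr h3 ?_
    filter_upwards [ae_restrict_mem measurableSet_Ioi] with r hr
    rw [heq r hr]
    show (Real.sqrt x)⁻¹ * (Real.sqrt x * _) = _
    rw [inv_mul_cancel_left₀ hsx.ne']
  · rw [tailVec, h2, setIntegral_congr_fun measurableSet_Ioi heq, integral_complex_ofReal,
      integral_const_mul, Complex.ofReal_mul]

theorem hasTwofoldForm_tailVec {l s : ℝ} (hl : 0 < l) (hs : 0 < s) :
    HasTwofoldForm (tailVec l s)
      ((l : ℂ) • tailVec l s + (-((Real.exp (-(l * s)) : ℝ) : ℂ)) • traceVec s)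
      ((∫ r in Ioi s, Real.exp (-(l * r)) / (2 * r) : ℝ) : ℂ) 0 := by
  filter_upwards [coeFn_tailVec hl hs.le, ae_restrict_mem measurableSet_Ioi] with x h1 hx
  have hx : 0 < x := hx
  obtain ⟨hi, h2⟩ := twofold_tailVec hl hs.le hx.le
  rw [h1.2, twofold_add _ _ hx.le, twofold_smul _ _ hx.le, twofold_smul _ _ hx.le, h2,
    twofold_traceVec hs hx.le]
  have h3 := integral_exp_mul_einInt hl hx hs hi
  congr 1
  rw [zero_mul, add_zero]
  have h4 := congrArg (fun r : ℝ => (r : ℂ)) h3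
  simp only [Complex.ofReal_sub, Complex.ofReal_mul] at h4
  linear_combination -h4

/-- The decaying solution behaves like `√x (-log x - c)` at zero, with
`c = (log l) / 2 - log 2 + γ`. -/
theorem hasTwofoldForm_decayVec {l : ℝ} (hl : 0 < l) :
    HasTwofoldForm (decayVec l) ((l : ℂ) • decayVec l)
      (-((Real.log l / 2 - Real.log 2 + Real.eulerMascheroniConstant : ℝ) : ℂ)) (-1) := by
  rw [← tailVec_zero]
  filter_upwards [coeFn_tailVec hl le_rfl, ae_restrict_mem measurableSet_Ioi] with x h1 hx
  have hx : 0 < x := hx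
  obtain ⟨hi, h2⟩ := twofold_tailVec hl le_rfl hx.le
  rw [h1.2, twofold_smul _ _ hx.le, h2]
  have h3 := integral_exp_mul_einInt_zero hl hx hi h1.1
  congr 1
  have h4 := congrArg (fun r : ℝ => (r : ℂ)) h3
  simp only [Complex.ofReal_add, Complex.ofReal_mul] at h4
  rw [h4]
  push_cast
  ring

theorem setIntegral_Ioi_comp_add_left {E : Type*} [NormedAddCommGroup E] [NormedSpace ℝ E]
    (F : ℝ → E) (s : ℝ) : ∫ t in Ioi (0 : ℝ), F (s + t) = ∫ r in Ioi s, F r := by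
  rw [← integral_indicator measurableSet_Ioi, ← integral_indicator measurableSet_Ioi,
    ← integral_add_left_eq_self ((Ioi s).indicator F) s]
  refine integral_congr_ae (ae_of_all _ fun t => ?_)
  show _ = (Ioi s).indicator F (s + t)
  by_cases ht : 0 < t
  · rw [indicator_of_mem (show t ∈ Ioi 0 from ht),
      indicator_of_mem (show s + t ∈ Ioi s from lt_add_of_pos_right s ht)]
  · rw [indicator_of_notMem (show t ∉ Ioi 0 from ht),
      indicator_of_notMem (show s + t ∉ Ioi s from fun h => ht (pos_of_lt_add_right h))]

theorem inner_decayVec_traceVec {l s : ℝ} (hl : 0 < l) (hs : 0 < s) :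
    inner ℂ (decayVec l) (traceVec s) =
      ((Real.exp (l * s) : ℝ) : ℂ) * ((∫ r in Ioi s, Real.exp (-(l * r)) / (2 * r) : ℝ) : ℂ) := by
  rw [← inner_decayVec hl, ← setIntegral_eq_integral_of_forall_compl_eq_zero (s := Ioi 0)
    fun r hr => by
      rw [traceVec_of_nonpos (not_lt.1 (show ¬(0 : ℝ) < r from hr)), inner_zero_left, mul_zero]]
  rw [← setIntegral_Ioi_comp_add_left (fun r => Real.exp (-(l * r)) / (2 * r)) s,
    ← integral_complex_ofReal, ← integral_const_mul]
  refine setIntegral_congr_fun measurableSet_Ioi fun r hr => ?_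
  rw [inner_traceVec hr hs, ← Complex.ofReal_mul, ← Complex.ofReal_mul]
  congr 1
  have h1 : Real.exp (-(l * r)) = Real.exp (l * s) * Real.exp (-(l * (s + r))) := by
    rw [← Real.exp_add]; congr 1; ring
  rw [h1, add_comm r s]
  ring

/-- The resolvent `∫₀^∞ e^{-lt} T₊(t) f dt` of the Friedrichs heat semigroup. -/
def friedrichsResolvent (l : ℝ) (f : L2) : L2 :=
  ∫ t in Ioi (0 : ℝ), ((Real.exp (-(l * t)) : ℝ) : ℂ) • friedrichsOp t f

theorem integrableOn_exp_smul_friedrichsOp {l : ℝ} (hl : 0 < l) (f : L2) :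
    IntegrableOn (fun t => ((Real.exp (-(l * t)) : ℝ) : ℂ) • friedrichsOp t f) (Ioi 0) := by
  have hb : IntegrableOn (fun t : ℝ => Real.exp (-l * t) * ‖f‖) (Ioi 0) :=
    (integrableOn_exp_mul_Ioi (by linarith) 0).mul_const _
  refine hb.mono' ?_ (ae_of_all _ fun t => ?_)
  · exact ((continuous_exp_neg_mul l).continuousOn.smul
      ((continuousOn_friedrichsOp f).mono Ioi_subset_Ici_self)).aestronglyMeasurable
      measurableSet_Ioi
  · rw [norm_smul, Complex.norm_real, Real.norm_of_nonneg (Real.exp_pos _).le, neg_mul]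
    gcongr
    exact ((friedrichsOp t).le_opNorm f).trans
      (mul_le_of_le_one_left (norm_nonneg f) (norm_friedrichsOp_le t))

theorem friedrichsResolvent_add {l : ℝ} (hl : 0 < l) (f g : L2) :
    friedrichsResolvent l (f + g) = friedrichsResolvent l f + friedrichsResolvent l g := by
  unfold friedrichsResolvent
  rw [← integral_add (integrableOn_exp_smul_friedrichsOp hl f)
    (integrableOn_exp_smul_friedrichsOp hl g)]
  simp_rw [map_add, smul_add]

theorem friedrichsResolvent_smul (l : ℝ) (c : ℂ) (f : L2) :
    friedrichsResolvent l (c • f) = c • friedrichsResolvent l f := by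
  unfold friedrichsResolvent
  rw [← integral_smul]
  simp_rw [map_smul, smul_comm c]

theorem norm_friedrichsResolvent_le {l : ℝ} (hl : 0 < l) (f : L2) :
    ‖friedrichsResolvent l f‖ ≤ l⁻¹ * ‖f‖ := by
  have hb : IntegrableOn (fun t : ℝ => Real.exp (-l * t) * ‖f‖) (Ioi 0) :=
    (integrableOn_exp_mul_Ioi (by linarith) 0).mul_const _
  refine (norm_integral_le_of_norm_le hb (ae_of_all _ fun t => ?_)).trans_eq ?_
  · rw [norm_smul, Complex.norm_real, Real.norm_of_nonneg (Real.exp_pos _).le, neg_mul]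
    gcongr
    exact ((friedrichsOp t).le_opNorm f).trans
      (mul_le_of_le_one_left (norm_nonneg f) (norm_friedrichsOp_le t))
  · rw [integral_mul_const, integral_exp_mul_Ioi (by linarith), mul_zero, Real.exp_zero,
      neg_div_neg_eq, one_div]

theorem friedrichsResolvent_traceVec (l : ℝ) {s : ℝ} (hs : 0 < s) :
    friedrichsResolvent l (traceVec s) = ((Real.exp (l * s) : ℝ) : ℂ) • tailVec l s := by
  rw [tailVec, ← setIntegral_Ioi_comp_add_left, friedrichsResolvent, ← integral_smul]
  refine setIntegral_congr_fun measurableSet_Ioi fun t ht => ?_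
  rw [friedrichsOp_traceVec hs (le_of_lt ht), smul_smul, ← Complex.ofReal_mul, ← Real.exp_add]
  congr 4
  ring

/-- The Friedrichs resolvent solves the radial equation without logarithmic term. By density and
continuity it suffices to consider trace kernels, where it is an explicit integral. -/
theorem hasTwofoldForm_friedrichsResolvent {l : ℝ} (hl : 0 < l) (f : L2) :
    HasTwofoldForm (friedrichsResolvent l f) ((l : ℂ) • friedrichsResolvent l f + (-1 : ℂ) • f)
      (inner ℂ (decayVec l) f) 0 := by
  let V : Submodule ℂ L2 :=
    { carrier := {f | HasTwofoldForm (friedrichsResolvent l f)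
        ((l : ℂ) • friedrichsResolvent l f + (-1 : ℂ) • f) (inner ℂ (decayVec l) f) 0}
      zero_mem' := by
        have h0 : friedrichsResolvent l 0 = 0 := by
          have := friedrichsResolvent_smul l 0 0
          simpa using this
        have h1 := (hasTwofoldForm_decayVec hl).smul 0
        simp only [zero_smul, zero_mul] at h1
        show HasTwofoldForm _ _ _ _
        rw [h0, smul_zero, smul_zero, add_zero, inner_zero_right]
        exact h1
      add_mem' := by
        intro f g hf hg
        have h1 := HasTwofoldForm.add hf hg
        rw [Set.mem_ofPred_eq, friedrichsResolvent_add hl, inner_add_right]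
        convert h1 using 1
        · module
        · rw [add_zero]
      smul_mem' := by
        intro c f hf
        have h1 := HasTwofoldForm.smul c hf
        rw [Set.mem_ofPred_eq, friedrichsResolvent_smul, inner_smul_right]
        convert h1 using 1
        · module
        · rw [mul_zero] }
  have hV : IsClosed (V : Set L2) := by
    refine IsSeqClosed.isClosed fun u f hu hf => ?_
    have hR : Tendsto (fun n => friedrichsResolvent l (u n)) atTop
        (𝓝 (friedrichsResolvent l f)) := by
      rw [tendsto_iff_norm_sub_tendsto_zero] at hf ⊢
      have h1 := hf.const_mul l⁻¹
      rw [mul_zero] at h1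
      refine squeeze_zero (fun _ => norm_nonneg _) (fun n => ?_) h1
      have h2 : friedrichsResolvent l (u n) - friedrichsResolvent l f =
          friedrichsResolvent l (u n - f) := by
        have h3 := friedrichsResolvent_add hl (u n - f) f
        rw [sub_add_cancel] at h3
        rw [h3, add_sub_cancel_right]
      rw [h2]
      exact norm_friedrichsResolvent_le hl _
    exact HasTwofoldForm.of_tendsto hu hR ((hR.const_smul _).add (hf.const_smul _))
      (tendsto_const_nhds.inner hf) tendsto_const_nhds
  refine mem_of_traceVec_mem (V := V) hV (fun s hs => ?_) f
  have h1 := (hasTwofoldForm_tailVec hl hs).smul ((Real.exp (l * s) : ℝ) : ℂ)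
  show HasTwofoldForm _ _ _ _
  rw [friedrichsResolvent_traceVec l hs, inner_decayVec_traceVec hl hs]
  convert h1 using 1
  · rw [smul_add, smul_smul _ (-((Real.exp (-(l * s)) : ℝ) : ℂ)), mul_neg, ← Complex.ofReal_mul,
      ← Real.exp_add, add_neg_cancel, Real.exp_zero, Complex.ofReal_one, smul_comm]
  · rw [mul_zero]

/-! ### The realizations and their heat semigroups -/

/-- The graph of `Δ(θ)` in terms of the integrated radial equation. -/
theorem mem_graph_delta_iff {θ : ℝ} {f g : L2} : (f, g) ∈ (delta θ).graph ↔
    ∃ a b : ℂ, HasTwofoldForm f (-g) a b ∧ (Real.cos θ : ℂ) * a + (Real.sin θ : ℂ) * b = 0 := by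
  constructor
  · intro h
    have hmax : (f, g) ∈ deltaMax.graph :=
      LinearPMap.le_graph_of_le LinearPMap.domRestrict_le h
    obtain ⟨a, b, hab, hc⟩ := (LinearPMap.mem_domain_of_mem_graph h).1
    exact ⟨a, b, hab.hasTwofoldForm (by rwa [neg_neg]), hc⟩
  · rintro ⟨a, b, h, hc⟩
    have hmax := h.mem_graph_deltaMax
    rw [neg_neg, LinearPMap.mem_graph_iff] at hmax
    obtain ⟨y, hy1, hy2⟩ := hmax
    rw [LinearPMap.mem_graph_iff]
    simp only at hy1 hy2
    subst hy1
    exact ⟨⟨y, ⟨a, b, h.hasBoundaryCoeffs, hc⟩, y.2⟩, rfl,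
      (LinearPMap.domRestrict_apply rfl).trans hy2⟩

theorem integrableOn_exp_smul_corrOp {K : ℝ → ℂ} {σ : ℝ} (hK : IsCausal K σ) {l : ℝ} (hl : σ < l)
    (hl0 : 0 < l) (f : L2) :
    IntegrableOn (fun t => ((Real.exp (-(l * t)) : ℝ) : ℂ) • corrOp K t f) (Ioi 0) := by
  obtain ⟨k, hk, hkl⟩ := exists_between (max_lt hl hl0)
  set M : ℝ := (∫ u, ‖((Real.exp (-(k * u)) : ℝ) : ℂ) * K u‖) * ∫ u, pairWeight u with hM
  have hb : IntegrableOn (fun t : ℝ => Real.exp ((k - l) * t) * (M * ‖f‖)) (Ioi 0) :=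
    (integrableOn_exp_mul_Ioi (by linarith) 0).mul_const _
  refine hb.mono' ?_ (ae_of_all _ fun t => ?_)
  · exact ((continuous_exp_neg_mul l).smul
      ((continuous_corrOp hK).clm_apply continuous_const)).aestronglyMeasurable
  · rw [norm_smul, Complex.norm_real, Real.norm_of_nonneg (Real.exp_pos _).le]
    have h1 := norm_corrOp_le hK ((le_max_left σ 0).trans_lt hk) ((le_max_right σ 0).trans hk.le) t
    calc _ ≤ Real.exp (-(l * t)) * (M * Real.exp (k * t) * ‖f‖) := by
          gcongr
          exact ((corrOp K t).le_opNorm f).trans (by gcongr)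
      _ = (Real.exp (k * t) * Real.exp (-(l * t))) * (M * ‖f‖) := by ring
      _ = _ := by rw [← Real.exp_add]; congr 2; ring

theorem laplace_heatOp {K : ℝ → ℂ} {σ : ℝ} (hK : IsCausal K σ) {l : ℝ} (hl : σ < l) (hl0 : 0 < l)
    (f : L2) : ∫ t in Ioi (0 : ℝ), ((Real.exp (-(l * t)) : ℝ) : ℂ) • heatOp K t f =
      friedrichsResolvent l f +
        ((∫ t, ((Real.exp (-(l * t)) : ℝ) : ℂ) * K t) * inner ℂ (decayVec l) f) • decayVec l := by
  rw [← laplace_corrOp hK hl hl0, friedrichsResolvent,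
    ← integral_add (integrableOn_exp_smul_friedrichsOp hl0 f)
      (integrableOn_exp_smul_corrOp hK hl hl0 f)]
  refine integral_congr_ae (ae_of_all _ fun t => ?_)
  simp only
  rw [← smul_add]
  rfl

/-- The coefficient `c` in the expansion `√x (-log x - c)` at zero of the square integrable solution
of `Δ f = -l f`. -/
def decayCoeff (l : ℝ) : ℝ := Real.log l / 2 - Real.log 2 + Real.eulerMascheroniConstant

/-- `Δ(θ) + l` is injective when the square integrable solution violates the boundary
condition. -/
theorem eq_zero_of_mem_graph_delta {θ l : ℝ} (hl : 0 < l)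
    (hne : Real.cos θ * decayCoeff l + Real.sin θ ≠ 0) {f : L2}
    (hf : (f, -((l : ℂ) • f)) ∈ (delta θ).graph) : f = 0 := by
  obtain ⟨a, b, h, hc⟩ := mem_graph_delta_iff.1 hf
  rw [neg_neg] at h
  have hw := h.add ((hasTwofoldForm_decayVec hl).smul b)
  rw [smul_comm b (l : ℂ), ← smul_add, mul_neg_one, add_neg_cancel] at hw
  have hw0 := hw.eq_zero hl.le
  have hab : a = b * (decayCoeff l : ℂ) := by
    rw [hw0] at hw
    have hbot : (ae halfLine).NeBot := by
      rw [ae_neBot, ne_eq, Measure.restrict_eq_zero, Real.volume_Ioi]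
      exact ENNReal.top_ne_zero
    obtain ⟨x, h1, h2, hx⟩ := (hw.and ((Lp.coeFn_zero ℂ 2 halfLine).and
      (ae_restrict_mem measurableSet_Ioi))).exists
    have hx : 0 < x := hx
    rw [h2, smul_zero, show (0 : L2) = (0 : ℂ) • (0 : L2) by simp, twofold_smul _ _ hx.le] at h1
    have hs : (Real.sqrt x : ℂ) ≠ 0 := by exact_mod_cast (Real.sqrt_pos.2 hx).ne'
    have h3 : a + b * -(decayCoeff l : ℂ) = 0 := by
      have h4 := (mul_eq_zero.1 h1.symm).resolve_left hs
      rw [zero_mul, zero_mul, add_zero, add_zero] at h4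
      exact h4
    linear_combination h3
  have hb : b = 0 := by
    rw [hab] at hc
    have h1 : b * ((Real.cos θ * decayCoeff l + Real.sin θ : ℝ) : ℂ) = 0 := by
      rw [Complex.ofReal_add, Complex.ofReal_mul]
      linear_combination hc
    exact (mul_eq_zero.1 h1).resolve_right (by exact_mod_cast hne)
  rw [hb, zero_smul, add_zero] at hw0
  exact hw0

/-- If the Laplace transform `m` of `K` satisfies `cos θ (1 - m c) - sin θ m = 0`, then the
corrected kernels form the heat semigroup of `Δ(θ)`. -/
theorem isHeatSemigroup_heatOp {θ : ℝ} {K : ℝ → ℂ} {σ : ℝ} (hK : IsCausal K σ)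
    (hm : ∀ l, σ < l → 0 < l → (Real.cos θ : ℂ) *
      (1 - (∫ t, ((Real.exp (-(l * t)) : ℝ) : ℂ) * K t) * (decayCoeff l : ℂ)) -
        (Real.sin θ : ℂ) * (∫ t, ((Real.exp (-(l * t)) : ℝ) : ℂ) * K t) = 0)
    (hne : ∀ l, σ < l → 0 < l → Real.cos θ * decayCoeff l + Real.sin θ ≠ 0) :
    IsHeatSemigroup (delta θ) (heatOp K) := by
  set k : ℝ := max σ 0 + 1 with hk
  have hk0 : 0 < k := by have := le_max_right σ 0; linarith
  have hkσ : σ < k := by have := le_max_left σ 0; linarith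
  refine isHeatSemigroup_of_laplace (σ := k) (M := 1 +
    (∫ u, ‖((Real.exp (-(k * u)) : ℝ) : ℂ) * K u‖) * ∫ u, pairWeight u) ?_ ?_ ?_ ?_ ?_
  · rw [heatOp, friedrichsOp_of_nonpos le_rfl, corrOp_zero hK, add_zero]
  · exact fun f => (continuousOn_friedrichsOp f).add
      ((continuous_corrOp hK).clm_apply continuous_const).continuousOn
  · intro t ht
    refine (norm_add_le _ _).trans ?_
    rw [add_mul, one_mul]
    exact add_le_add ((norm_friedrichsOp_le t).trans (Real.one_le_exp (by positivity)))
      (norm_corrOp_le hK hkσ hk0.le t)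
  · intro l hl f
    have hl0 : 0 < l := hk0.trans hl
    have hlσ : σ < l := hkσ.trans hl
    rw [laplace_heatOp hK hlσ hl0]
    set m : ℂ := ∫ t, ((Real.exp (-(l * t)) : ℝ) : ℂ) * K t with hmd
    have h := (hasTwofoldForm_friedrichsResolvent hl0 f).add
      ((hasTwofoldForm_decayVec hl0).smul (m * inner ℂ (decayVec l) f))
    refine mem_graph_delta_iff.2 ⟨inner ℂ (decayVec l) f +
      m * inner ℂ (decayVec l) f * -(decayCoeff l : ℂ),
      0 + m * inner ℂ (decayVec l) f * -1, ?_, ?_⟩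
    · convert h using 1
      · module
      · rfl
    · have h1 := hm l hlσ hl0
      rw [← hmd] at h1
      linear_combination (inner ℂ (decayVec l) f) * h1
  · intro l hl f hf
    exact eq_zero_of_mem_graph_delta (hk0.trans hl) (hne l (hkσ.trans hl) (hk0.trans hl)) hf

theorem isHeatKernel_correctedKernel {θ : ℝ} {K : ℝ → ℂ} {σ : ℝ} (hK : IsCausal K σ)
    (hm : ∀ l, σ < l → 0 < l → (Real.cos θ : ℂ) *
      (1 - (∫ t, ((Real.exp (-(l * t)) : ℝ) : ℂ) * K t) * (decayCoeff l : ℂ)) -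
        (Real.sin θ : ℂ) * (∫ t, ((Real.exp (-(l * t)) : ℝ) : ℂ) * K t) = 0)
    (hne : ∀ l, σ < l → 0 < l → Real.cos θ * decayCoeff l + Real.sin θ ≠ 0) :
    IsHeatKernel (delta θ) (correctedKernel K) :=
  ⟨heatOp K, isHeatSemigroup_heatOp hK hm hne, fun _ ht =>
    ⟨aestronglyMeasurable_correctedKernel hK ht, heatOp_kernel hK ht⟩⟩

theorem isHeatKernel_of_ne {θ : ℝ} (hcos : Real.cos θ ≠ 0) :
    IsHeatKernel (delta θ) (correctedKernel fun t => (volterraKernel (kappa θ) t : ℂ)) := by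
  have hκ : ∀ l, Real.cos θ * decayCoeff l + Real.sin θ =
      Real.cos θ * (Real.log l / 2 + kappa θ) := by
    intro l
    rw [decayCoeff, kappa, Real.tan_eq_sin_div_cos]
    field_simp
    ring
  have hpos : ∀ l, Real.exp (-2 * kappa θ) < l → 0 < l → Real.log l / 2 + kappa θ ≠ 0 := by
    intro l hl hl0
    have := (Real.lt_log_iff_exp_lt hl0).2 hl
    intro h; linarith
  refine isHeatKernel_correctedKernel (isCausal_volterraKernel (kappa θ)) (fun l hl hl0 => ?_)
    fun l hl hl0 => ?_
  · have h1 : ∫ t, ((Real.exp (-(l * t)) : ℝ) : ℂ) * (volterraKernel (kappa θ) t : ℂ) =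
        (((Real.log l / 2 + kappa θ)⁻¹ : ℝ) : ℂ) := by
      rw [← (laplace_volterraKernel (kappa θ) hl).2, ← integral_complex_ofReal]
      push_cast; rfl
    rw [h1]
    have h2 := mul_inv_cancel₀ (hpos l hl hl0)
    have h3 : Real.cos θ * (1 - (Real.log l / 2 + kappa θ)⁻¹ * decayCoeff l) -
        Real.sin θ * (Real.log l / 2 + kappa θ)⁻¹ = 0 := by
      linear_combination (-(Real.log l / 2 + kappa θ)⁻¹) * hκ l - Real.cos θ * h2
    exact_mod_cast h3
  · rw [hκ l]
    exact mul_ne_zero hcos (hpos l hl hl0)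

theorem isCausal_zero : IsCausal (fun _ => 0) 0 where
  measurable := measurable_const
  eq_zero _ _ := rfl
  integrable l _ := by simp

theorem isHeatKernel_pi_div_two :
    IsHeatKernel (delta (Real.pi / 2)) (correctedKernel fun _ => 0) := by
  refine isHeatKernel_correctedKernel isCausal_zero (fun l _ _ => ?_) fun l _ _ => ?_
  · simp
  · simp

end RegSing
end

theorem theorem4p3 (θ : ℝ) (hθ : θ ∈ Set.Ico 0 Real.pi) :
    (∀ x t : ℝ, 0 < x → 0 < t →
      Tendsto (fun y : ℝ => y ^ (-(1 / 2) : ℝ) * RegSing.friedrichsKernel x y t)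
        (𝓝[>] 0) (𝓝 (RegSing.traceKernel x t))) ∧
    ∃ K : ℝ → ℂ,
      (θ ≠ Real.pi / 2 →
        RegSing.IsInverseLaplace (RegSing.symbol θ) (Real.exp (-2 * RegSing.kappa θ)) K) ∧
      (θ = Real.pi / 2 → ∀ t : ℝ, 0 < t → K t = 0) ∧
      (∀ b : ℝ, 0 < b → IntervalIntegrable K volume 0 b) ∧
      RegSing.IsHeatKernel (RegSing.delta θ) (RegSing.correctedKernel K) := by
  refine ⟨fun x t hx ht => RegSing.tendsto_friedrichsKernel hx ht, ?_⟩
  by_cases h : θ = Real.pi / 2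
  · subst h
    exact ⟨fun _ => 0, fun h => (h rfl).elim, fun _ _ _ => rfl,
      fun b _ => RegSing.isCausal_zero.intervalIntegrable b, RegSing.isHeatKernel_pi_div_two⟩
  · have hcos : Real.cos θ ≠ 0 := by
      intro h0
      refine h (Real.injOn_cos ⟨hθ.1, hθ.2.le⟩ ⟨by positivity, by linarith [Real.pi_pos]⟩ ?_)
      rw [h0, Real.cos_pi_div_two]
    exact ⟨fun t => (RegSing.volterraKernel (RegSing.kappa θ) t : ℂ),
      fun _ => RegSing.isInverseLaplace_volterraKernel θ, fun h' => (h h').elim,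
      fun b _ => (RegSing.isCausal_volterraKernel _).intervalIntegrable b,
      RegSing.isHeatKernel_of_ne hcos⟩
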